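/- **Conventions.** Let $d(A)$ be the Turing degree of $A\subseteq\omega$, let $\Phi_e$ be the $e$-th Turing functional, and identify binary relations on $\omega$ with subsets of $\omega$ via a computable pairing function. A property of sets $D\subseteq\omega$ holds *on a cone* if there is a set $A$ such that it holds of every $D\ge_T A$. For a binary relation $R$ on $(\omega,<)$ and $D\subseteq\omega$, the degree spectrum of $R$ below $D$ is $$\mathrm{dgSp}(R)_{\le D}=\{\,d(R^{\mathcal B}\oplus D) : \mathcal B \text{ is a } D\text{-computable linear order with domain } \omega,\ \mathcal B\cong(\omega,<)\,\},$$ where $R^{\mathcal B}$ is the image of $R$ under the isomorphism $(\omega,<)\to\mathcal B$. Let $$\Sigma^0_1(D)=\{d(W\oplus D): W \text{ c.e. in } D\},\qquad \Delta^0_2(D)=\{d(C\oplus D): C \text{ is } \Delta^0_2 \text{ relative to } D\}.$$ A number $e$ is a $\Delta^0_2(D)$-index of $C$ if $\Phi_e^D(x,s)$ is a total $\{0,1\}$-valued function with $\lim_s\Phi_e^D(x,s)=C(x)$ for all $x$; the sets that are $\Delta^0_2$ relative to $D$ are the sets that have such an index. For maps $F,G$ taking sets $D$ to sets of degrees, put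 $F\le G$ if $F(D)\subseteq G(D)$ on a cone. This is a preorder; the *degree spectrum of $R$ on a cone*, $\mathrm{dgSp}_{rel}(R)$, is the class of $D\mapsto \mathrm{dgSp}(R)_{\le D}$ in the associated partial order, and the c.e. degrees $\Sigma^0_1$ and the $\Delta^0_2$ degrees are regarded as elements of this partial order too. Below, $\subsetneq$ between elements of it is its strict order ($F\le G$ and not $G\le F$). The degree spectrum of $R$ is *uniformly equal to the $\Delta^0_2$ degrees relative to $D$* if there are (partial) $D$-computable functions $f,g_1,g_2$ such that, for every $\Delta^0_2(D)$-index $e$ of a set $C$, the values $f(e)$, $g_1(e)$, $g_2(e)$ are defined, $f(e)$ is an index of a $D$-computable copy $\mathcal B$ of $(\omega,<)$, and $$R^{\mathcal B}=\Phi_{g_1(e)}^{C\oplus D}\quad\text{and}\quad C=\Phi_{g_2(e)}^{R^{\mathcal B}\oplus D}.$$ **Theorem.** There is a computable binary relation $R$ on $(\omega,<)$ such that 1. for all $D$ on a cone, $\Sigma^0_1(D)\subsetneq \mathrm{dgSp}(R)_{\le D}\subseteq\Delta^0_2(D)$; 2. for all $D$ on a cone, the degree spectrum of $R$ is not uniformly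 equal to the $\Delta^0_2$ degrees relative to $D$; 3. consequently, either $\Sigma^0_1\subsetneq\mathrm{dgSp}_{rel}(R)\subsetneq\Delta^0_2$, or $\mathrm{dgSp}_{rel}(R)=\Delta^0_2$ but it is not the case that, on a cone, the degree spectrum of $R$ is uniformly equal to the $\Delta^0_2$ degrees. -/

import Mathlib

open Filter
open scoped Computability

namespace DegSpec

/-! ### Sets of natural numbers, oracles and Turing degrees -/

open Classical in
/-- The characteristic function of a set of natural numbers, in the form of an oracle. -/
noncomputable def chi (A : Set ℕ) : ℕ →. ℕ := fun n => Part.some (if n ∈ A then 1 else 0)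

/-- The join `A ⊕ B`. -/
def join (A B : Set ℕ) : Set ℕ := (fun n => 2 * n) '' A ∪ (fun n => 2 * n + 1) '' B

/-- The Turing degree `d(A)` of a set. -/
noncomputable def deg (A : Set ℕ) : TuringDegree :=
  toAntisymmetrization TuringReducible (chi A)

/-- A binary relation on `ω` as a subset of `ω`. -/
def pairSet (B : ℕ → ℕ → Prop) : Set ℕ := {n | B n.unpair.1 n.unpair.2}

/-- `P` holds on a cone: it holds of every set that computes some fixed set. -/
def OnCone (P : Set ℕ → Prop) : Prop := ∃ A : Set ℕ, ∀ D : Set ℕ, chi A ≤ᵀ chi D → P D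

/-! ### Indices of functions that are partial computable in an oracle

The programs are the codes for partial recursive functions of `Nat.Partrec.Code`, with one more
basic instruction that queries the oracle; they are numbered in the same way. -/

inductive OracleCode : Type
  | zero : OracleCode
  | succ : OracleCode
  | left : OracleCode
  | right : OracleCode
  | query : OracleCode
  | pair : OracleCode → OracleCode → OracleCode
  | comp : OracleCode → OracleCode → OracleCode
  | prec : OracleCode → OracleCode → OracleCode
  | rfind' : OracleCode → OracleCode

/-- The partial function computed by a program with oracle `X`. -/
noncomputable def OracleCode.eval (X : Set ℕ) : OracleCode → ℕ →. ℕ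
  | zero => pure 0
  | succ => Nat.succ
  | left => ↑fun n : ℕ => n.unpair.1
  | right => ↑fun n : ℕ => n.unpair.2
  | query => chi X
  | pair cf cg => fun n => Nat.pair <$> eval X cf n <*> eval X cg n
  | comp cf cg => fun n => eval X cg n >>= eval X cf
  | prec cf cg =>
    Nat.unpaired fun a n =>
      n.rec (eval X cf a) fun y IH => do
        let i ← IH
        eval X cg (Nat.pair a (Nat.pair y i))
  | rfind' cf =>
    Nat.unpaired fun a m =>
      (Nat.rfind fun n => (fun m => m = 0) <$> eval X cf (Nat.pair a (n + m))).map (· + m)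

/-- The program with number `e`. -/
def OracleCode.ofNat : ℕ → OracleCode
  | 0 => zero
  | 1 => succ
  | 2 => left
  | 3 => right
  | 4 => query
  | n + 5 =>
    let m := n.div2.div2
    have hm : m < n + 5 := by
      simp only [m, Nat.div2_val]
      omega
    have _m1 : m.unpair.1 < n + 5 := lt_of_le_of_lt m.unpair_left_le hm
    have _m2 : m.unpair.2 < n + 5 := lt_of_le_of_lt m.unpair_right_le hm
    match n.bodd, n.div2.bodd with
    | false, false => pair (ofNat m.unpair.1) (ofNat m.unpair.2)
    | false, true => comp (ofNat m.unpair.1) (ofNat m.unpair.2)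
    | true, false => prec (ofNat m.unpair.1) (ofNat m.unpair.2)
    | true, true => rfind' (ofNat m)
decreasing_by all_goals first | exact _m1 | exact _m2 | exact hm

/-- The `e`-th Turing functional `Φ_e^X`. -/
noncomputable def Phi (e : ℕ) (X : Set ℕ) : ℕ →. ℕ := (OracleCode.ofNat e).eval X

/-! ### Classes of sets and of degrees, relative to a set `D` -/

/-- `W` is c.e. in `D`: it is the domain of a function that is partial computable in `D`. -/
def CEIn (D W : Set ℕ) : Prop := ∃ f : ℕ →. ℕ, f ≤ᵀ chi D ∧ f.Dom = W

/-- `g` is total and `{0,1}`-valued and is a `Δ⁰₂` approximation of `C`, that is,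
`lim_s g(x, s) = C(x)` for all `x`. -/
def IsApprox (g : ℕ →. ℕ) (C : Set ℕ) : Prop :=
  ∃ A : ℕ → Set ℕ, (∀ x s : ℕ, g (Nat.pair x s) = chi (A s) x) ∧
    ∀ x : ℕ, ∀ᶠ s in atTop, (x ∈ A s ↔ x ∈ C)

/-- `C` is `Δ⁰₂` relative to `D`. -/
def IsDelta02 (D C : Set ℕ) : Prop := ∃ g : ℕ →. ℕ, g ≤ᵀ chi D ∧ IsApprox g C

/-- `e` is an index for the set `C`, as a set that is `Δ⁰₂` relative to `D`. -/
def IsDelta02Index (D : Set ℕ) (e : ℕ) (C : Set ℕ) : Prop := IsApprox (Phi e D) C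

/-- The c.e. degrees, relative to `D`. -/
def ceDegrees (D : Set ℕ) : Set TuringDegree := {a | ∃ W, CEIn D W ∧ a = deg (join W D)}

/-- The `Δ⁰₂` degrees, relative to `D`. -/
def delta02Degrees (D : Set ℕ) : Set TuringDegree := {a | ∃ C, IsDelta02 D C ∧ a = deg (join C D)}

/-! ### Degree spectra

The structures have domain `ω` and one binary relation `L`. A copy is another such structure `B`
with an isomorphism `i : L ≃r B`. -/

/-- The relation `R^B` on the copy `B` that corresponds to `R` under the isomorphism `i`. -/
def transfer {L B : ℕ → ℕ → Prop} (i : L ≃r B) (R : ℕ → ℕ → Prop) : ℕ → ℕ → Prop :=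
  fun x y => R (i.symm x) (i.symm y)

/-- The degree spectrum of the binary relation `R` on `(ω, L)` below (the degree of) `D`: the
degrees of the sets `R^B ⊕ D`, where `B` is a `D`-computable copy of `(ω, L)`. -/
def dgSp (L R : ℕ → ℕ → Prop) (D : Set ℕ) : Set TuringDegree :=
  {a | ∃ (B : ℕ → ℕ → Prop) (i : L ≃r B), chi (pairSet B) ≤ᵀ chi D ∧
    a = deg (join (pairSet (transfer i R)) D)}

/-- Relative to `D`, the degree spectrum of `R` on `(ω, L)` is uniformly equal to the `Δ⁰₂`
degrees: there are (partial) functions `f`, `g₁`, `g₂`, computable in `D`, such that for every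
index `e` of a set `C` that is `Δ⁰₂` relative to `D`, `f(e)` is an index of a `D`-computable copy
`B` of `(ω, L)`, and `g₁(e)` and `g₂(e)` are indices of computations, relative to `D`, of `R^B`
from `C` and of `C` from `R^B`. -/
def UniformlyDelta02 (L R : ℕ → ℕ → Prop) (D : Set ℕ) : Prop :=
  ∃ f g₁ g₂ : ℕ →. ℕ, f ≤ᵀ chi D ∧ g₁ ≤ᵀ chi D ∧ g₂ ≤ᵀ chi D ∧
    ∀ (e : ℕ) (C : Set ℕ), IsDelta02Index D e C →
      ∃ m ∈ f e, ∃ j ∈ g₁ e, ∃ k ∈ g₂ e, ∃ (B : ℕ → ℕ → Prop) (i : L ≃r B),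
        Phi m D = chi (pairSet B) ∧
        Phi j (join C D) = chi (pairSet (transfer i R)) ∧
        Phi k (join (pairSet (transfer i R)) D) = chi C

/-! ### The partial order of degree spectra on a cone -/

theorem chi_le_join_left (A B : Set ℕ) : chi A ≤ᵀ chi (join A B) := by
  have h2 : Nat.RecursiveIn {chi (join A B)} (fun n : ℕ => Part.some (2 * n)) :=
    Nat.Primrec.recursiveIn (f := fun n => 2 * n)
      (Primrec.nat_iff.1 (Primrec.nat_mul.comp (Primrec.const 2) Primrec.id))
  refine RecursiveIn.iff_nat.2 (((Nat.RecursiveIn.oracle _ (Set.mem_singleton (chi (join A B)))).comp h2).of_eq fun n => ?_)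
  have : 2 * n ∈ join A B ↔ n ∈ A := by
    simp only [join, Set.mem_union, Set.mem_image]
    constructor
    · rintro (⟨m, hm, h⟩ | ⟨m, hm, h⟩)
      · obtain rfl : m = n := by omega
        exact hm
      · omega
    · exact fun h => Or.inl ⟨n, h, rfl⟩
  exact (Part.bind_some _ _).trans (by simp only [chi]; split_ifs <;> tauto)

theorem chi_le_join_right (A B : Set ℕ) : chi B ≤ᵀ chi (join A B) := by
  have h2 : Nat.RecursiveIn {chi (join A B)} (fun n : ℕ => Part.some (2 * n + 1)) :=
    Nat.Primrec.recursiveIn (f := fun n => 2 * n + 1)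
      (Primrec.nat_iff.1 (Primrec.succ.comp
        (Primrec.nat_mul.comp (Primrec.const 2) Primrec.id)))
  refine RecursiveIn.iff_nat.2 (((Nat.RecursiveIn.oracle _ (Set.mem_singleton (chi (join A B)))).comp h2).of_eq fun n => ?_)
  have : 2 * n + 1 ∈ join A B ↔ n ∈ B := by
    simp only [join, Set.mem_union, Set.mem_image]
    constructor
    · rintro (⟨m, hm, h⟩ | ⟨m, hm, h⟩)
      · omega
      · obtain rfl : m = n := by omega
        exact hm
    · exact fun h => Or.inr ⟨n, h, rfl⟩
  exact (Part.bind_some _ _).trans (by simp only [chi]; split_ifs <;> tauto)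

theorem OnCone.and {P Q : Set ℕ → Prop} (hP : OnCone P) (hQ : OnCone Q) :
    OnCone fun D => P D ∧ Q D := by
  obtain ⟨A, hA⟩ := hP
  obtain ⟨B, hB⟩ := hQ
  exact ⟨join A B, fun D hD =>
    ⟨hA D ((chi_le_join_left A B).trans hD), hB D ((chi_le_join_right A B).trans hD)⟩⟩

/-- Maps that assign to (the degree of) a set `D` a class of degrees. -/
def ClassMap : Type := Set ℕ → Set TuringDegree

/-- `F ≤ G` if `F(D) ⊆ G(D)` for all `D` on a cone. -/
instance : Preorder ClassMap where
  le F G := OnCone fun D => F D ⊆ G D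
  le_refl F := ⟨∅, fun _ _ => Set.Subset.rfl⟩
  le_trans F G H h₁ h₂ := by
    obtain ⟨A, hA⟩ := OnCone.and h₁ h₂
    exact ⟨A, fun D hD => (hA D hD).1.trans (hA D hD).2⟩

/-- Such maps up to equality on a cone, partially ordered by inclusion on a cone. -/
abbrev ConeClass : Type := Antisymmetrization ClassMap (· ≤ ·)

/-- The class of degrees on a cone that is given by the map `F`. -/
def onConeClass (F : Set ℕ → Set TuringDegree) : ConeClass :=
  toAntisymmetrization (α := ClassMap) (· ≤ ·) F

/-- The degree spectrum on a cone of the relation `R` on `(ω, L)`. -/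
def dgSpRel (L R : ℕ → ℕ → Prop) : ConeClass := onConeClass (dgSp L R)

end DegSpec

open DegSpec

/-!
The relation is `cyc`: `ω` is divided into consecutive finite blocks, and the relation is the
directed cycle through each of them. The lengths of the blocks are chosen such that each length
occurs infinitely often (`exists_blockLen_eq`), but two neighbouring lengths, in their order, occur
only at one place (`blockLen_pair_injective`).

Computability is dealt with by the cone. Any function on finite strings is computable on some cone,
so that a function is computable in all `D` on a cone as soon as each of its values depends on a
finite part of `D` whose length is known in advance (`onCone_turingReducible`); and it is
computable in `W ⊕ D` if finite parts of `W` and `D` certify its values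
(`onCone_turingReducible_join`). Copies of `ω` are built by inserting `0, 1, 2, …` one after the
other (`insOrder`). The insertions are made by requirements that each act finitely often and
respect the elements that were present when a requirement of higher priority acted; then the result
is a copy of `ω` (`exists_relIso_insOrder`, `eventually_pos_lt_of_tags`).

* All c.e. degrees occur (`onCone_ceDegrees_subset`): when `n` enters `W`, an insertion at the
  beginning of a block that belongs to `n` opens the cycle there for good.
* Some degree that occurs is not c.e. (`onCone_not_dgSp_subset`). Suppose that `W` is to compute
  the relation and conversely. A requirement waits until `W` computes an edge that closes a
  cycle, and the relation on a finite set `F` computes `W` on the use of that computation. It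
  then opens the cycle by an insertion, so that `W` has to change. Afterwards it moves the blocks of
  `F`, from the first one on, to later blocks of the same lengths (`exists_restoring_plan`).
  The relation on `F` is now what it was and computes the old values of `W`, but a c.e. set does
  not return to old values. Finite injury (`IsStep.exists_run`) combines these strategies.
* All degrees that occur are `Δ⁰₂` (`onCone_dgSp_subset`): the position of an element is
  approximated by counting its predecessors.
* Uniform equality fails (`onCone_not_uniformlyDelta02`). By the recursion theorem the index `e`
  of a `Δ⁰₂` set `C ⊆ {0}` is known during the construction of `C`, and with it the copy and the
  reductions between its relation and `C`. Changing `C` back and forth makes the relation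
  alternate on a finite set between two states. Such a set can return to an earlier state, but not
  again and again: positions only increase, blocks that are restored have not been torn apart in
  between, and two neighbouring lengths determine the place of a block, so that blocks cannot move
  past it (`cyc_iff_of_alternating`). Hence the two states coincide after a bounded number of
  changes, while they compute different sets `C`.

The degree spectrum on a cone is therefore the class of the `Δ⁰₂` degrees or lies strictly between
it and the class of the c.e. degrees.
-/

namespace DegSpec

/-! ### Programs with an oracle: indices and the use principle -/

/-- The sets `X` and `Y` have the same elements below `n`. -/
def Agree (n : ℕ) (X Y : Set ℕ) : Prop := ∀ i < n, (i ∈ X ↔ i ∈ Y)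

theorem Agree.refl (n : ℕ) (X : Set ℕ) : Agree n X X := fun _ _ => Iff.rfl

theorem Agree.symm {n : ℕ} {X Y : Set ℕ} (h : Agree n X Y) : Agree n Y X :=
  fun i hi => (h i hi).symm

theorem Agree.trans {n : ℕ} {X Y Z : Set ℕ} (h : Agree n X Y) (h' : Agree n Y Z) :
    Agree n X Z := fun i hi => (h i hi).trans (h' i hi)

theorem Agree.mono {m n : ℕ} {X Y : Set ℕ} (h : Agree n X Y) (hm : m ≤ n) : Agree m X Y :=
  fun i hi => h i (hi.trans_le hm)

theorem Agree.join {n : ℕ} {X Y X' Y' : Set ℕ} (h : Agree n X X') (h' : Agree n Y Y') :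
    Agree n (join X Y) (join X' Y') := by
  intro i hi
  simp only [DegSpec.join, Set.mem_union, Set.mem_image]
  constructor
  · rintro (⟨m, hm, rfl⟩ | ⟨m, hm, rfl⟩)
    · exact Or.inl ⟨m, (h m (by omega)).1 hm, rfl⟩
    · exact Or.inr ⟨m, (h' m (by omega)).1 hm, rfl⟩
  · rintro (⟨m, hm, rfl⟩ | ⟨m, hm, rfl⟩)
    · exact Or.inl ⟨m, (h m (by omega)).2 hm, rfl⟩
    · exact Or.inr ⟨m, (h' m (by omega)).2 hm, rfl⟩

theorem two_mul_mem_join {A B : Set ℕ} {n : ℕ} : 2 * n ∈ join A B ↔ n ∈ A := by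
  simp only [join, Set.mem_union, Set.mem_image]
  constructor
  · rintro (⟨m, hm, h⟩ | ⟨m, hm, h⟩)
    · obtain rfl : m = n := by omega
      exact hm
    · omega
  · exact fun h => Or.inl ⟨n, h, rfl⟩

theorem two_mul_add_one_mem_join {A B : Set ℕ} {n : ℕ} : 2 * n + 1 ∈ join A B ↔ n ∈ B := by
  simp only [join, Set.mem_union, Set.mem_image]
  constructor
  · rintro (⟨m, hm, h⟩ | ⟨m, hm, h⟩)
    · omega
    · obtain rfl : m = n := by omega
      exact hm
  · exact fun h => Or.inr ⟨n, h, rfl⟩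

open Classical in
theorem chi_congr {A B : Set ℕ} {n : ℕ} (h : n ∈ A ↔ n ∈ B) : chi A n = chi B n := by
  simp only [chi, h]

theorem Nat.recursiveIn_add {O : Set (ℕ →. ℕ)} {f g : ℕ →. ℕ} (hf : Nat.RecursiveIn O f)
    (hg : Nat.RecursiveIn O g) :
    Nat.RecursiveIn O fun n => (fun z : ℕ => z.unpair.1 + z.unpair.2) <$>
      (Nat.pair <$> f n <*> g n) := by
  have h : Nat.RecursiveIn O ((fun z : ℕ => z.unpair.1 + z.unpair.2 : ℕ → ℕ) : ℕ →. ℕ) :=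
    Nat.Primrec.recursiveIn (f := fun z : ℕ => z.unpair.1 + z.unpair.2)
      (Primrec.nat_iff.1 (Primrec.nat_add.comp (Primrec.fst.comp Primrec.unpair)
        (Primrec.snd.comp Primrec.unpair)))
  exact (h.comp (hf.pair hg)).of_eq fun n => Part.bind_some_eq_map _ _

theorem OracleCode.recursiveIn_eval (X : Set ℕ) (c : OracleCode) :
    Nat.RecursiveIn {chi X} (c.eval X) := by
  induction c with
  | zero => exact .zero
  | succ => exact .succ
  | left => exact .left
  | right => exact .right
  | query => exact .oracle _ rfl
  | pair cf cg hf hg => exact .pair hf hg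
  | comp cf cg hf hg => exact .comp hf hg
  | prec cf cg hf hg => exact .prec hf hg
  | rfind' cf hf =>
    have e : Nat.RecursiveIn {chi X}
        ((fun z : ℕ => Nat.pair z.unpair.1.unpair.1 (z.unpair.2 + z.unpair.1.unpair.2) :
          ℕ → ℕ) : ℕ →. ℕ) :=
      Nat.Primrec.recursiveIn
        (f := fun z : ℕ => Nat.pair z.unpair.1.unpair.1 (z.unpair.2 + z.unpair.1.unpair.2))
        (Primrec.nat_iff.1 (Primrec₂.natPair.comp
          (Primrec.fst.comp (Primrec.unpair.comp (Primrec.fst.comp Primrec.unpair)))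
          (Primrec.nat_add.comp (Primrec.snd.comp Primrec.unpair)
            (Primrec.snd.comp (Primrec.unpair.comp (Primrec.fst.comp Primrec.unpair))))))
    have h : Nat.RecursiveIn {chi X} fun z : ℕ =>
        cf.eval X (Nat.pair z.unpair.1.unpair.1 (z.unpair.2 + z.unpair.1.unpair.2)) :=
      (hf.comp e).of_eq fun z => Part.bind_some _ _
    refine (Nat.recursiveIn_add h.rfind .right).of_eq fun n => ?_
    simp only [eval, Nat.unpaired]
    refine Part.ext fun y => ?_
    simp [Seq.seq, eq_comm]

theorem OracleCode.exists_eval_eq {X : Set ℕ} {f : ℕ →. ℕ} (h : Nat.RecursiveIn {chi X} f) :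
    ∃ c : OracleCode, c.eval X = f := by
  induction h with
  | zero => exact ⟨.zero, rfl⟩
  | succ => exact ⟨.succ, rfl⟩
  | left => exact ⟨.left, rfl⟩
  | right => exact ⟨.right, rfl⟩
  | oracle g hg => exact ⟨.query, hg.symm⟩
  | pair _ _ hf hg =>
    obtain ⟨cf, rfl⟩ := hf
    obtain ⟨cg, rfl⟩ := hg
    exact ⟨.pair cf cg, rfl⟩
  | comp _ _ hf hg =>
    obtain ⟨cf, rfl⟩ := hf
    obtain ⟨cg, rfl⟩ := hg
    exact ⟨.comp cf cg, rfl⟩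
  | prec _ _ hf hg =>
    obtain ⟨cf, rfl⟩ := hf
    obtain ⟨cg, rfl⟩ := hg
    exact ⟨.prec cf cg, rfl⟩
  | rfind _ hf =>
    obtain ⟨cf, rfl⟩ := hf
    refine ⟨.comp (.rfind' cf) (.pair (.pair .left .right) .zero), ?_⟩
    funext n
    refine Part.ext fun y => ?_
    simp [eval, Seq.seq, pure, PFun.pure]

theorem OracleCode.ofNat_surjective : Function.Surjective OracleCode.ofNat := by
  have key : ∀ (m : ℕ) (b₁ b₂ : Bool), ∃ n : ℕ,
      n.bodd = b₁ ∧ n.div2.bodd = b₂ ∧ n.div2.div2 = m := fun m b₁ b₂ =>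
    ⟨Nat.bit b₁ (Nat.bit b₂ m), by simp⟩
  intro c
  induction c with
  | zero => exact ⟨0, by simp [ofNat]⟩
  | succ => exact ⟨1, by simp [ofNat]⟩
  | left => exact ⟨2, by simp [ofNat]⟩
  | right => exact ⟨3, by simp [ofNat]⟩
  | query => exact ⟨4, by simp [ofNat]⟩
  | pair cf cg hf hg =>
    obtain ⟨a, rfl⟩ := hf
    obtain ⟨b, rfl⟩ := hg
    obtain ⟨n, h₁, h₂, h₃⟩ := key (Nat.pair a b) false false
    exact ⟨n + 5, by simp [ofNat, h₁, h₂, h₃]⟩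
  | comp cf cg hf hg =>
    obtain ⟨a, rfl⟩ := hf
    obtain ⟨b, rfl⟩ := hg
    obtain ⟨n, h₁, h₂, h₃⟩ := key (Nat.pair a b) false true
    exact ⟨n + 5, by simp [ofNat, h₁, h₂, h₃]⟩
  | prec cf cg hf hg =>
    obtain ⟨a, rfl⟩ := hf
    obtain ⟨b, rfl⟩ := hg
    obtain ⟨n, h₁, h₂, h₃⟩ := key (Nat.pair a b) true false
    exact ⟨n + 5, by simp [ofNat, h₁, h₂, h₃]⟩
  | rfind' cf hf =>
    obtain ⟨a, rfl⟩ := hf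
    obtain ⟨n, h₁, h₂, h₃⟩ := key a true true
    exact ⟨n + 5, by simp [ofNat, h₁, h₂, h₃]⟩

theorem Phi_turingReducible (e : ℕ) (X : Set ℕ) : Phi e X ≤ᵀ chi X :=
  RecursiveIn.iff_nat.2 (OracleCode.recursiveIn_eval X _)

theorem exists_Phi_eq {X : Set ℕ} {f : ℕ →. ℕ} (h : f ≤ᵀ chi X) : ∃ e, Phi e X = f := by
  obtain ⟨c, hc⟩ := OracleCode.exists_eval_eq (RecursiveIn.iff_nat.1 h)
  obtain ⟨e, rfl⟩ := OracleCode.ofNat_surjective c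
  exact ⟨e, hc⟩

theorem OracleCode.exists_use (X : Set ℕ) (c : OracleCode) :
    ∀ {x y : ℕ}, y ∈ c.eval X x → ∃ u, ∀ Y, Agree u X Y → y ∈ c.eval Y x := by
  induction c with
  | zero => exact fun h => ⟨0, fun _ _ => h⟩
  | succ => exact fun h => ⟨0, fun _ _ => h⟩
  | left => exact fun h => ⟨0, fun _ _ => h⟩
  | right => exact fun h => ⟨0, fun _ _ => h⟩
  | query =>
    intro x y h
    refine ⟨x + 1, fun Y hY => ?_⟩
    rw [eval, ← chi_congr (hY x (Nat.lt_succ_self x))]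
    exact h
  | pair cf cg hf hg =>
    intro x y h
    simp only [eval, Seq.seq, Part.map_eq_map, Part.mem_bind_iff, Part.mem_map_iff,
      exists_exists_and_eq_and] at h ⊢
    obtain ⟨a, ha, b, hb, rfl⟩ := h
    obtain ⟨u, hu⟩ := hf ha
    obtain ⟨v, hv⟩ := hg hb
    exact ⟨max u v, fun Y hY => ⟨a, hu Y (hY.mono (le_max_left _ _)), b,
      hv Y (hY.mono (le_max_right _ _)), rfl⟩⟩
  | comp cf cg hf hg =>
    intro x y h
    obtain ⟨a, ha, hb⟩ := Part.mem_bind_iff.1 h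
    obtain ⟨u, hu⟩ := hg ha
    obtain ⟨v, hv⟩ := hf hb
    exact ⟨max u v, fun Y hY => Part.mem_bind_iff.2 ⟨a, hu Y (hY.mono (le_max_left _ _)),
      hv Y (hY.mono (le_max_right _ _))⟩⟩
  | prec cf cg hf hg =>
    intro x y h
    simp only [eval, Nat.unpaired] at h ⊢
    generalize x.unpair.2 = n at h ⊢
    induction n generalizing y with
    | zero => exact hf h
    | succ n ih =>
      obtain ⟨a, ha, hb⟩ := Part.mem_bind_iff.1 h
      obtain ⟨u, hu⟩ := ih ha
      obtain ⟨v, hv⟩ := hg hb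
      exact ⟨max u v, fun Y hY => Part.mem_bind_iff.2 ⟨a, hu Y (hY.mono (le_max_left _ _)),
        hv Y (hY.mono (le_max_right _ _))⟩⟩
  | rfind' cf hf =>
    intro x y h
    simp only [eval, Nat.unpaired] at h ⊢
    obtain ⟨a, ha', rfl⟩ := (Part.mem_map_iff _).1 h
    obtain ⟨ha, hb⟩ := Nat.mem_rfind.1 ha'
    -- a single bound on the uses of the computations that the search runs through
    have key : ∀ n ≤ a, ∃ u, ∀ Y, Agree u X Y →
        ∀ b, b ∈ ((fun m => decide (m = 0)) <$> cf.eval X (Nat.pair x.unpair.1 (n + x.unpair.2)) :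
          Part Bool) →
          b ∈ ((fun m => decide (m = 0)) <$> cf.eval Y (Nat.pair x.unpair.1 (n + x.unpair.2)) :
          Part Bool) := by
      intro n hn
      have hd : ∃ b, b ∈ ((fun m => decide (m = 0)) <$>
          cf.eval X (Nat.pair x.unpair.1 (n + x.unpair.2)) : Part Bool) := by
        rcases hn.lt_or_eq with hn | rfl
        · exact ⟨_, hb hn⟩
        · exact ⟨_, ha⟩
      obtain ⟨b, hbm⟩ := hd
      obtain ⟨c, hc, rfl⟩ := (Part.mem_map_iff _).1 hbm
      obtain ⟨u, hu⟩ := hf hc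
      refine ⟨u, fun Y hY b hb' => ?_⟩
      rw [Part.mem_unique hb' hbm]
      exact (Part.mem_map_iff _).2 ⟨c, hu Y hY, rfl⟩
    choose u hu using fun n : Fin (a + 1) => key n (Nat.lt_succ_iff.1 n.2)
    refine ⟨Finset.univ.sup u, fun Y hY =>
      (Part.mem_map_iff _).2 ⟨a, Nat.mem_rfind.2 ⟨?_, fun {m} hm => ?_⟩, rfl⟩⟩
    · exact hu ⟨a, by omega⟩ Y (hY.mono (Finset.le_sup (Finset.mem_univ _))) _ ha
    · exact hu ⟨m, by omega⟩ Y (hY.mono (Finset.le_sup (Finset.mem_univ _))) _ (hb hm)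

/-- The use principle. -/
theorem Phi_exists_use {e x y : ℕ} {X : Set ℕ} (h : y ∈ Phi e X x) :
    ∃ u, ∀ Y, Agree u X Y → y ∈ Phi e Y x :=
  OracleCode.exists_use X _ h

/-! ### Continuous operators are Turing functionals on a cone -/

theorem OnCone.mono {P Q : Set ℕ → Prop} (hP : OnCone P) (h : ∀ D, P D → Q D) : OnCone Q := by
  obtain ⟨A, hA⟩ := hP
  exact ⟨A, fun D hD => h D (hA D hD)⟩

theorem Nat.recursiveIn_some_comp {O : Set (ℕ →. ℕ)} {f : ℕ →. ℕ} {g : ℕ → ℕ}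
    (hf : Nat.RecursiveIn O f) (hg : Nat.RecursiveIn O fun n => Part.some (g n)) :
    Nat.RecursiveIn O fun n => f (g n) :=
  (hf.comp hg).of_eq fun _ => Part.bind_some _ _

theorem Nat.recursiveIn_some_pair {O : Set (ℕ →. ℕ)} {f g : ℕ → ℕ}
    (hf : Nat.RecursiveIn O fun n => Part.some (f n))
    (hg : Nat.RecursiveIn O fun n => Part.some (g n)) :
    Nat.RecursiveIn O fun n => Part.some (Nat.pair (f n) (g n)) :=
  (hf.pair hg).of_eq fun n => by
    refine Part.ext fun y => ?_
    simp [Seq.seq]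

theorem Nat.recursiveIn_some_const {O : Set (ℕ →. ℕ)} (a : ℕ) :
    Nat.RecursiveIn O fun _ => Part.some a :=
  Nat.Primrec.recursiveIn (f := fun _ => a) (Primrec.nat_iff.1 (Primrec.const a))

theorem Nat.recursiveIn_some_id {O : Set (ℕ →. ℕ)} :
    Nat.RecursiveIn O Part.some :=
  Nat.Primrec.recursiveIn (f := fun n => n) (Primrec.nat_iff.1 Primrec.id)

/-- Unbounded search for a zero of a total function that is recursive in the oracles. -/
theorem Nat.recursiveIn_find {O : Set (ℕ →. ℕ)} {f : ℕ → ℕ → ℕ} {g : ℕ → ℕ}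
    (hf : Nat.RecursiveIn O fun n => Part.some (f n.unpair.1 n.unpair.2))
    (hg : ∀ x, f x (g x) = 0 ∧ ∀ m < g x, f x m ≠ 0) :
    Nat.RecursiveIn O fun n => Part.some (g n) := by
  refine hf.rfind.of_eq fun n => Part.eq_some_iff.2 (Nat.mem_rfind.2 ⟨?_, fun {m} hm => ?_⟩)
  · simp [(hg n).1]
  · simpa using (hg n).2 m hm

/-- Every function is computable on a cone: the base of the cone can be any set. -/
theorem onCone_recursiveIn (H : ℕ → ℕ) :
    OnCone fun D => Nat.RecursiveIn {chi D} fun n => Part.some (H n) := by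
  classical
  refine ⟨{z | z.unpair.2 ≠ H z.unpair.1}, fun D hD => ?_⟩
  refine Nat.recursiveIn_find
    (f := fun x y => if y ≠ H x then 1 else 0) ((RecursiveIn.iff_nat.1 hD).of_eq fun n => ?_)
    fun x => ⟨by simp, fun m hm => by simp [hm.ne]⟩
  by_cases h : n.unpair.2 = H n.unpair.1 <;> simp [chi, h]

theorem Nat.recursiveIn_some_rec {O : Set (ℕ →. ℕ)} {h : ℕ → ℕ} (a : ℕ)
    (hh : Nat.RecursiveIn O fun z => Part.some (h z)) :
    Nat.RecursiveIn O fun n => Part.some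
      (Nat.rec (motive := fun _ => ℕ) a (fun y i => h (Nat.pair y i)) n) := by
  have h₂ : Nat.RecursiveIn O fun z : ℕ => Part.some (h z.unpair.2) :=
    Nat.recursiveIn_some_comp (f := fun z => Part.some (h z)) hh .right
  have h₃ := Nat.RecursiveIn.prec (Nat.recursiveIn_some_const a) h₂
  refine (Nat.recursiveIn_some_comp h₃ (Nat.recursiveIn_some_pair
    (Nat.recursiveIn_some_const 0) Nat.recursiveIn_some_id)).of_eq fun n => ?_
  simp only [Nat.unpair_pair]
  induction n with
  | zero => rfl
  | succ n ih =>
    simp only [ih]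
    exact Part.bind_some _ _

open Classical in
/-- A code for the first `n` values of the characteristic function of `D`. -/
noncomputable def res (D : Set ℕ) : ℕ → ℕ
  | 0 => 0
  | n + 1 => Nat.pair (if n ∈ D then 1 else 0) (res D n)

open Classical in
theorem recursiveIn_res (D : Set ℕ) : Nat.RecursiveIn {chi D} fun n => Part.some (res D n) := by
  have h₁ : Nat.RecursiveIn {chi D} fun z : ℕ => chi D z.unpair.1 :=
    Nat.recursiveIn_some_comp (f := chi D) (.oracle _ rfl) .left
  refine (Nat.recursiveIn_some_rec 0 (h := fun z =>
    Nat.pair (if z.unpair.1 ∈ D then 1 else 0) z.unpair.2)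
    (Nat.recursiveIn_some_pair h₁ .right)).of_eq fun n => congrArg Part.some ?_
  induction n with
  | zero => rfl
  | succ n ih => simp [res, ← ih]

open Classical in
theorem res_eq_iff {D D' : Set ℕ} {n : ℕ} : res D n = res D' n ↔ Agree n D D' := by
  induction n with
  | zero => simp [res, Agree]
  | succ n ih =>
    simp only [res, Nat.pair_eq_pair, ih]
    constructor
    · rintro ⟨h, h'⟩ i hi
      rcases (Nat.lt_succ_iff_lt_or_eq.1 hi) with hi | rfl
      · exact h' i hi
      · by_cases h₁ : i ∈ D <;> by_cases h₂ : i ∈ D' <;> simp [h₁, h₂] at h ⊢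
    · intro h
      refine ⟨?_, h.mono n.le_succ⟩
      exact if_congr (h n n.lt_succ_self) rfl rfl

/-- An operator whose values depend on finitely many bits of its argument, with a bound on these
bits that does not depend on the argument, is computable on a cone. -/
theorem onCone_turingReducible (G : ℕ → Set ℕ → ℕ → ℕ) (μ : ℕ → ℕ → ℕ)
    (hG : ∀ e x D D', Agree (μ e x) D D' → G e D x = G e D' x) :
    OnCone fun D => ∀ e, (fun x => Part.some (G e D x)) ≤ᵀ chi D := by
  classical
  let H : ℕ → ℕ := fun z =>
    if h : ∃ D, res D (μ z.unpair.1 z.unpair.2.unpair.1) = z.unpair.2.unpair.2 then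
      G z.unpair.1 h.choose z.unpair.2.unpair.1 else 0
  have hH : ∀ e x D, H (Nat.pair e (Nat.pair x (res D (μ e x)))) = G e D x := by
    intro e x D
    have h : ∃ D', res D' (μ e x) = res D (μ e x) := ⟨D, rfl⟩
    simp only [H, Nat.unpair_pair]
    rw [dif_pos h]
    exact hG e x _ _ (res_eq_iff.1 h.choose_spec)
  refine ((onCone_recursiveIn H).and (onCone_recursiveIn fun z => μ z.unpair.1 z.unpair.2)).mono ?_
  rintro D ⟨h₁, h₂⟩ e
  refine RecursiveIn.iff_nat.2 ?_
  have h₃ := Nat.recursiveIn_some_comp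
    (f := fun z => Part.some (μ z.unpair.1 z.unpair.2)) h₂ (Nat.recursiveIn_some_pair
    (Nat.recursiveIn_some_const e) Nat.recursiveIn_some_id)
  have h₄ := Nat.recursiveIn_some_comp (f := fun n => Part.some (H n)) h₁ (Nat.recursiveIn_some_pair
    (Nat.recursiveIn_some_const e) (Nat.recursiveIn_some_pair Nat.recursiveIn_some_id
      (Nat.recursiveIn_some_comp (f := fun n => Part.some (res D n)) (recursiveIn_res D) h₃)))
  refine h₄.of_eq fun x => ?_
  simp only [Nat.unpair_pair, hH]

/-- `V e W D n x v` says that the bits of `W` and `D` below `n` certify that the value at `x` is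
`v`. If every value has a certificate and only true values have one, then the function is
computable from `W ⊕ D`, for all `D` on a cone. -/
theorem onCone_turingReducible_join (V : ℕ → Set ℕ → Set ℕ → ℕ → ℕ → ℕ → Prop)
    (hV : ∀ e n x v W W' D D', Agree n W W' → Agree n D D' → V e W D n x v → V e W' D' n x v) :
    OnCone fun D => ∀ (e : ℕ) (W : Set ℕ) (g : ℕ → ℕ), (∀ x, ∃ n, V e W D n x (g x)) →
      (∀ n x v, V e W D n x v → v = g x) →
      (fun x => Part.some (g x)) ≤ᵀ chi (join W D) := by
  classical
  have key := onCone_turingReducible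
    (fun e Y z => if V e {m | 2 * m ∈ Y} {m | 2 * m + 1 ∈ Y} z.unpair.2.unpair.1 z.unpair.1
      z.unpair.2.unpair.2 then 0 else 1) (fun _ z => 2 * z + 2) (by
      intro e z Y Y' h
      have hz : z.unpair.2.unpair.1 ≤ z := (Nat.unpair_left_le _).trans (Nat.unpair_right_le _)
      have h₁ : Agree z.unpair.2.unpair.1 {m | 2 * m ∈ Y} {m | 2 * m ∈ Y'} := fun i hi =>
        h (2 * i) (by omega)
      have h₂ : Agree z.unpair.2.unpair.1 {m | 2 * m + 1 ∈ Y} {m | 2 * m + 1 ∈ Y'} := fun i hi =>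
        h (2 * i + 1) (by omega)
      refine if_congr ⟨hV _ _ _ _ _ _ _ _ h₁ h₂, hV _ _ _ _ _ _ _ _ h₁.symm h₂.symm⟩ rfl rfl)
  obtain ⟨A, hA⟩ := key
  refine ⟨A, fun D hD e W g hc hs => RecursiveIn.iff_nat.2 ?_⟩
  have h := RecursiveIn.iff_nat.1 (hA (join W D) (hD.trans (chi_le_join_right W D)) e)
  simp only [two_mul_mem_join, two_mul_add_one_mem_join, Set.ofPred_mem_eq] at h
  have hex : ∀ x, ∃ k : ℕ, V e W D k.unpair.1 x k.unpair.2 := fun x => by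
    obtain ⟨n, hn⟩ := hc x
    exact ⟨Nat.pair n (g x), by simpa using hn⟩
  have h' := Nat.recursiveIn_find
    (f := fun x k => if V e W D k.unpair.1 x k.unpair.2 then 0 else 1) h
    (g := fun x => Nat.find (hex x)) fun x =>
      ⟨by simp [Nat.find_spec (hex x)], fun m hm => by simp [Nat.find_min (hex x) hm]⟩
  refine (Nat.recursiveIn_some_comp (f := fun n => Part.some n.unpair.2) .right h').of_eq
    fun x => ?_
  exact congrArg Part.some (hs _ _ _ (Nat.find_spec (hex x)))

theorem chi_join_turingReducible {A B : Set ℕ} {f : ℕ →. ℕ} (hA : chi A ≤ᵀ f)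
    (hB : chi B ≤ᵀ f) : chi (join A B) ≤ᵀ f := by
  classical
  have hh : Nat.RecursiveIn {f} fun n : ℕ => Part.some (n / 2) :=
    Nat.Primrec.recursiveIn (f := fun n => n / 2)
      (Primrec.nat_iff.1 (Primrec.nat_div.comp Primrec.id (Primrec.const 2)))
  have h₁ := Nat.recursiveIn_some_comp (RecursiveIn.iff_nat.1 hA) hh
  have h₂ := Nat.recursiveIn_some_comp (RecursiveIn.iff_nat.1 hB) hh
  let s : ℕ → ℕ := fun z => if z.unpair.1 % 2 = 0 then z.unpair.2.unpair.1 else z.unpair.2.unpair.2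
  have hs : Nat.RecursiveIn {f} fun z => Part.some (s z) :=
    Nat.Primrec.recursiveIn (f := s) (Primrec.nat_iff.1 (Primrec.ite
      (PrimrecRel.comp Primrec.eq (Primrec.nat_mod.comp (Primrec.fst.comp Primrec.unpair)
        (Primrec.const 2)) (Primrec.const 0))
      (Primrec.fst.comp (Primrec.unpair.comp (Primrec.snd.comp Primrec.unpair)))
      (Primrec.snd.comp (Primrec.unpair.comp (Primrec.snd.comp Primrec.unpair)))))
  have h₃ := Nat.recursiveIn_some_comp hs (Nat.recursiveIn_some_pair Nat.recursiveIn_some_id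
    (Nat.recursiveIn_some_pair h₁ h₂))
  refine RecursiveIn.iff_nat.2 (h₃.of_eq fun n => ?_)
  simp only [s, Nat.unpair_pair, chi]
  rcases Nat.even_or_odd' n with ⟨k, rfl | rfl⟩
  · have : 2 * k / 2 = k := by omega
    simp only [this, two_mul_mem_join, Nat.mul_mod_right, if_true]
  · have h1 : (2 * k + 1) / 2 = k := by omega
    have h2 : ¬ (2 * k + 1) % 2 = 0 := by omega
    simp only [h1, two_mul_add_one_mem_join, h2, if_false]

theorem deg_eq_iff {A B : Set ℕ} : deg A = deg B ↔ chi A ≤ᵀ chi B ∧ chi B ≤ᵀ chi A :=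
  Quotient.eq

theorem deg_join_eq_iff {A B D : Set ℕ} :
    deg (join A D) = deg (join B D) ↔ chi A ≤ᵀ chi (join B D) ∧ chi B ≤ᵀ chi (join A D) := by
  rw [deg_eq_iff]
  exact ⟨fun h => ⟨(chi_le_join_left _ _).trans h.1, (chi_le_join_left _ _).trans h.2⟩,
    fun h => ⟨chi_join_turingReducible h.1 (chi_le_join_right _ _),
      chi_join_turingReducible h.2 (chi_le_join_right _ _)⟩⟩

/-- The recursion theorem. The function that the S-m-n theorem would provide need not be computed:
it is coded into the base of a cone. -/
theorem onCone_exists_fixed_index :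
    OnCone fun D => ∀ G : ℕ →. ℕ, G ≤ᵀ chi D → ∃ e, ∀ n, Phi e D n = G (Nat.pair e n) := by
  have hS : ∀ z, ∃ w, ∀ (D : Set ℕ) (n : ℕ), Phi w D n = Phi z D (Nat.pair z n) := by
    intro z
    obtain ⟨k, hk⟩ : ∃ k : OracleCode, ∀ D n, k.eval D n = Part.some z := by
      induction z with
      | zero => exact ⟨.zero, fun D n => rfl⟩
      | succ z ih =>
        obtain ⟨k, hk⟩ := ih
        refine ⟨.comp .succ k, fun D n => ?_⟩
        simp only [OracleCode.eval, hk]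
        exact Part.bind_some _ _
    obtain ⟨w, hw⟩ := OracleCode.ofNat_surjective
      (.comp (OracleCode.ofNat z) (.pair k (.pair .left .right)))
    refine ⟨w, fun D n => ?_⟩
    have h : (OracleCode.pair k (.pair .left .right)).eval D n = Part.some (Nat.pair z n) := by
      refine Part.ext fun y => ?_
      simp [OracleCode.eval, hk, Seq.seq]
    simp only [Phi, hw]
    refine (congrArg (fun p : Part ℕ => p.bind _) h).trans (Part.bind_some _ _)
  choose S hS using hS
  refine (onCone_recursiveIn S).mono fun D hD G hG => ?_
  have h₁ : Nat.RecursiveIn {chi D} fun n : ℕ => Part.some n.unpair.1 := .left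
  have h₂ : Nat.RecursiveIn {chi D} fun n : ℕ => Part.some n.unpair.2 := .right
  have h := Nat.recursiveIn_some_comp (RecursiveIn.iff_nat.1 hG)
    (Nat.recursiveIn_some_pair (Nat.recursiveIn_some_comp (f := fun n => Part.some (S n)) hD h₁) h₂)
  obtain ⟨z, hz⟩ := exists_Phi_eq (RecursiveIn.iff_nat.2 h)
  exact ⟨S z, fun n => by rw [hS, hz]; simp⟩

/-! ### The relation: cycles on consecutive blocks -/

/-- The length of the `k`-th block. All lengths are at least two, each length occurs infinitely
often, and no ordered pair of lengths occurs twice as the lengths of consecutive blocks. -/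
def blockLen (k : ℕ) : ℕ := if k % 2 = 0 then (k / 2).unpair.1 + 2 else k / 2 + 3

/-- The first element of the `k`-th block. -/
def blockStart : ℕ → ℕ
  | 0 => 0
  | k + 1 => blockStart k + blockLen k

/-- The relation of the theorem: the cycle through each block in increasing order. -/
def cyc (u v : ℕ) : Prop :=
  ∃ k < u + 1, (v = u + 1 ∧ blockStart k ≤ u ∧ v < blockStart (k + 1)) ∨
    (v = blockStart k ∧ u + 1 = blockStart (k + 1))

theorem blockStart_succ (k : ℕ) : blockStart (k + 1) = blockStart k + blockLen k := rfl

theorem two_le_blockLen (k : ℕ) : 2 ≤ blockLen k := by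
  unfold blockLen
  split_ifs <;> omega

theorem blockLen_pair_injective {k l : ℕ} (h : blockLen k = blockLen l)
    (h' : blockLen (k + 1) = blockLen (l + 1)) : k = l := by
  -- the length increases from a block of even index to the next one, and from no other block
  have key : ∀ k, (k % 2 = 0 ∧ blockLen (k + 1) = k / 2 + 3 ∧ blockLen k < blockLen (k + 1)) ∨
      (k % 2 = 1 ∧ blockLen k = k / 2 + 3 ∧ blockLen (k + 1) ≤ blockLen k) := by
    intro k
    have h₁ := Nat.unpair_left_le (k / 2)
    have h₂ := Nat.unpair_left_le ((k + 1) / 2)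
    unfold blockLen
    rcases Nat.mod_two_eq_zero_or_one k with hk | hk
    · have : (k + 1) % 2 ≠ 0 := by omega
      left
      rw [if_pos hk, if_neg this]
      omega
    · have : (k + 1) % 2 = 0 := by omega
      right
      rw [if_pos this, if_neg (by omega)]
      omega
  have h₁ := key k
  have h₂ := key l
  omega

theorem blockStart_strictMono : StrictMono blockStart :=
  strictMono_nat_of_lt_succ fun k => by
    have := two_le_blockLen k
    rw [blockStart_succ]
    omega

theorem blockStart_lt_succ (k : ℕ) : blockStart k < blockStart (k + 1) :=
  blockStart_strictMono (Nat.lt_succ_self k)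

theorem le_blockStart (k : ℕ) : k ≤ blockStart k := blockStart_strictMono.le_apply

theorem exists_blockLen_eq (k N : ℕ) : ∃ j, N ≤ blockStart j ∧ blockLen j = blockLen k := by
  refine ⟨2 * Nat.pair (blockLen k - 2) N, ?_, ?_⟩
  · have := Nat.right_le_pair (blockLen k - 2) N
    have := le_blockStart (2 * Nat.pair (blockLen k - 2) N)
    omega
  · have := two_le_blockLen k
    have h : 2 * Nat.pair (blockLen k - 2) N / 2 = Nat.pair (blockLen k - 2) N := by omega
    rw [blockLen, if_pos (by omega), h, Nat.unpair_pair]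
    dsimp only
    omega

theorem exists_block (u : ℕ) : ∃ k, blockStart k ≤ u ∧ u < blockStart (k + 1) := by
  induction u with
  | zero => exact ⟨0, le_rfl, (le_blockStart 1)⟩
  | succ u ih =>
    obtain ⟨k, h₁, h₂⟩ := ih
    rcases (Nat.succ_le_of_lt h₂).lt_or_eq with h | h
    · exact ⟨k, by omega, h⟩
    · exact ⟨k + 1, h.ge, by have := blockStart_lt_succ (k + 1); omega⟩

theorem block_unique {k l u : ℕ} (h₁ : blockStart k ≤ u) (h₂ : u < blockStart (k + 1))
    (h₃ : blockStart l ≤ u) (h₄ : u < blockStart (l + 1)) : k = l := by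
  have := blockStart_strictMono.lt_iff_lt.1 (h₁.trans_lt h₄)
  have := blockStart_strictMono.lt_iff_lt.1 (h₃.trans_lt h₂)
  omega

/-- The relation in terms of a block that contains the first argument. -/
theorem cyc_iff {k u v : ℕ} (h₁ : blockStart k ≤ u) (h₂ : u < blockStart (k + 1)) :
    cyc u v ↔ (v = u + 1 ∧ v < blockStart (k + 1)) ∨
      (v = blockStart k ∧ u + 1 = blockStart (k + 1)) := by
  constructor
  · rintro ⟨l, -, ⟨hv, hu, hl⟩ | ⟨hv, hu⟩⟩
    · obtain rfl := block_unique h₁ h₂ hu (by omega)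
      exact Or.inl ⟨hv, hl⟩
    · have := blockStart_lt_succ l
      obtain rfl := block_unique (l := l) h₁ h₂ (by omega) (by omega)
      exact Or.inr ⟨hv, hu⟩
  · have hk := (le_blockStart k).trans h₁
    rintro (⟨hv, hu⟩ | ⟨hv, hu⟩)
    · exact ⟨k, by omega, Or.inl ⟨hv, h₁, hu⟩⟩
    · exact ⟨k, by omega, Or.inr ⟨hv, hu⟩⟩

/-- The relation in terms of the block and the offset in the block of both arguments. -/
theorem cyc_add_iff {k l a b : ℕ} (ha : a < blockLen k) (hb : b < blockLen l) :
    cyc (blockStart k + a) (blockStart l + b) ↔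
      k = l ∧ (b = a + 1 ∨ (b = 0 ∧ a + 1 = blockLen k)) := by
  rw [cyc_iff (k := k) (by omega) (by rw [blockStart_succ]; omega), blockStart_succ]
  constructor
  · intro h
    have : k = l := block_unique (u := blockStart l + b) (by omega)
      (by rw [blockStart_succ]; omega) (by omega) (by rw [blockStart_succ]; omega)
    subst this
    omega
  · rintro ⟨rfl, h⟩
    omega

theorem cyc_block {k u v : ℕ} (h : cyc u v) :
    (blockStart k ≤ u ∧ u < blockStart (k + 1)) ↔
      (blockStart k ≤ v ∧ v < blockStart (k + 1)) := by
  obtain ⟨l, h₁, h₂⟩ := exists_block u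
  have hl := (cyc_iff h₁ h₂).1 h
  have hv : blockStart l ≤ v ∧ v < blockStart (l + 1) := by omega
  constructor
  · rintro ⟨h₃, h₄⟩
    obtain rfl := block_unique h₁ h₂ h₃ h₄
    exact hv
  · rintro ⟨h₃, h₄⟩
    obtain rfl := block_unique hv.1 hv.2 h₃ h₄
    exact ⟨h₁, h₂⟩

theorem cyc_last_first (k : ℕ) : cyc (blockStart (k + 1) - 1) (blockStart k) := by
  have := blockStart_lt_succ k
  rw [cyc_iff (k := k) (by omega) (by omega)]
  omega

theorem computablePred_cyc : ComputablePred fun p : ℕ × ℕ => cyc p.1 p.2 := by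
  have hlen : Primrec blockLen := by
    unfold blockLen
    exact Primrec.ite (Primrec.eq.comp (Primrec.nat_mod.comp Primrec.id (Primrec.const 2))
        (Primrec.const 0))
      (Primrec.nat_add.comp (Primrec.fst.comp (Primrec.unpair.comp
        (Primrec.nat_div.comp Primrec.id (Primrec.const 2)))) (Primrec.const 2))
      (Primrec.nat_add.comp (Primrec.nat_div.comp Primrec.id (Primrec.const 2)) (Primrec.const 3))
  have hst : Primrec blockStart := by
    refine (Primrec.nat_rec₁ (f := fun k s => s + blockLen k) 0
      (Primrec.nat_add.comp Primrec.snd (hlen.comp Primrec.fst))).of_eq fun k => ?_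
    induction k with
    | zero => rfl
    | succ k ih => rw [blockStart_succ, ← ih]
  have hsucc : Primrec fun k => blockStart (k + 1) := hst.comp Primrec.succ
  have hrel : PrimrecRel fun k z : ℕ =>
      (z.unpair.2 = z.unpair.1 + 1 ∧ blockStart k ≤ z.unpair.1 ∧
        z.unpair.2 < blockStart (k + 1)) ∨
      (z.unpair.2 = blockStart k ∧ z.unpair.1 + 1 = blockStart (k + 1)) := by
    have hu : Primrec fun z : ℕ × ℕ => z.2.unpair.1 :=
      Primrec.fst.comp (Primrec.unpair.comp Primrec.snd)
    have hv : Primrec fun z : ℕ × ℕ => z.2.unpair.2 :=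
      Primrec.snd.comp (Primrec.unpair.comp Primrec.snd)
    exact PrimrecPred.or
      ((Primrec.eq.comp hv (Primrec.succ.comp hu)).and
        ((Primrec.nat_le.comp (hst.comp Primrec.fst) hu).and
          (Primrec.nat_lt.comp hv (hsucc.comp Primrec.fst))))
      ((Primrec.eq.comp hv (hst.comp Primrec.fst)).and
        (Primrec.eq.comp (Primrec.succ.comp hu) (hsucc.comp Primrec.fst)))
  have h := (hrel.exists_lt.comp (Primrec.succ.comp Primrec.fst)
    (Primrec₂.natPair.comp Primrec.fst Primrec.snd) :
      PrimrecPred fun p : ℕ × ℕ => ∃ k < p.1.succ, _)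
  exact (h.of_eq fun p => by simp only [Nat.unpair_pair]; rfl).computablePred

/-! ### Copies of `ω` from sequences of insertions -/

/-- Elements `0, 1, 2, …` are inserted into a linear order one after the other, `s` at the place
where it has `q s` predecessors. `pos q s x` is the position of `x` among the elements below `s`
(for `x < s`; the values at other arguments have no meaning). -/
def pos (q : ℕ → ℕ) : ℕ → ℕ → ℕ
  | 0, _ => 0
  | s + 1, x => if x = s then q s else if q s ≤ pos q s x then pos q s x + 1 else pos q s x

theorem pos_self (q : ℕ → ℕ) (s : ℕ) : pos q (s + 1) s = q s := if_pos rfl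

theorem pos_succ_of_le {q : ℕ → ℕ} {s x : ℕ} (hx : x < s) (h : q s ≤ pos q s x) :
    pos q (s + 1) x = pos q s x + 1 := by
  rw [pos, if_neg hx.ne, if_pos h]

theorem pos_succ_of_lt {q : ℕ → ℕ} {s x : ℕ} (hx : x < s) (h : pos q s x < q s) :
    pos q (s + 1) x = pos q s x := by
  rw [pos, if_neg hx.ne, if_neg h.not_ge]

theorem pos_congr {q q' : ℕ → ℕ} {s : ℕ} (h : ∀ t < s, q t = q' t) (x : ℕ) :
    pos q s x = pos q' s x := by
  induction s with
  | zero => rfl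
  | succ s ih =>
    rw [pos, pos, ih fun t ht => h t (by omega), h s (by omega)]

theorem pos_lt {q : ℕ → ℕ} (hq : ∀ s, q s ≤ s) {s x : ℕ} (hx : x < s) : pos q s x < s := by
  induction s with
  | zero => omega
  | succ s ih =>
    have := hq s
    rw [pos]
    split_ifs with h₁ h₂
    · omega
    · have := ih (by omega); omega
    · have := ih (by omega); omega

/-- Distances between elements can only grow. -/
theorem pos_succ_add_le {q : ℕ → ℕ} {s x y : ℕ} (hx : x < s) (hy : y < s)
    (h : pos q s x ≤ pos q s y) :
    pos q s y + pos q (s + 1) x ≤ pos q (s + 1) y + pos q s x := by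
  rw [pos, pos, if_neg hx.ne, if_neg hy.ne]
  split_ifs <;> omega

theorem pos_le_pos {q : ℕ → ℕ} {s t x : ℕ} (hx : x < s) (hst : s ≤ t) :
    pos q s x ≤ pos q t x := by
  induction t, hst using Nat.le_induction with
  | base => exact le_rfl
  | succ t ht ih =>
    rw [pos, if_neg (by omega)]
    split_ifs <;> omega

theorem pos_add_le {q : ℕ → ℕ} {s t x y : ℕ} (hx : x < s) (hy : y < s) (hst : s ≤ t)
    (h : pos q s x ≤ pos q s y) : pos q s y + pos q t x ≤ pos q t y + pos q s x := by
  induction t, hst using Nat.le_induction with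
  | base => exact le_rfl
  | succ t ht ih =>
    have := pos_succ_add_le (q := q) (hx.trans_le ht) (hy.trans_le ht) (by omega)
    omega

theorem pos_injOn {q : ℕ → ℕ} {s x y : ℕ} (hx : x < s) (hy : y < s)
    (h : pos q s x = pos q s y) : x = y := by
  induction s with
  | zero => omega
  | succ s ih =>
    rcases Nat.lt_succ_iff_lt_or_eq.1 hx with hx | rfl <;>
      rcases Nat.lt_succ_iff_lt_or_eq.1 hy with hy | rfl
    · rw [pos, pos, if_neg hx.ne, if_neg hy.ne] at h
      refine ih hx hy ?_
      split_ifs at h <;> omega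
    · rw [pos_self, pos, if_neg hx.ne] at h
      split_ifs at h <;> omega
    · rw [pos_self, pos, if_neg hy.ne] at h
      split_ifs at h <;> omega
    · rfl

theorem exists_pos_eq {q : ℕ → ℕ} (hq : ∀ s, q s ≤ s) {s p : ℕ} (hp : p < s) :
    ∃ x < s, pos q s x = p := by
  have hinj : Function.Injective fun x : Fin s => (⟨pos q s x, pos_lt hq x.2⟩ : Fin s) :=
    fun x y h => Fin.ext (pos_injOn x.2 y.2 (congrArg Fin.val h))
  obtain ⟨x, hx⟩ := (Finite.injective_iff_surjective.1 hinj) ⟨p, hp⟩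
  exact ⟨x, x.2, congrArg Fin.val hx⟩

theorem pos_eq_of_forall_lt {q : ℕ → ℕ} {s t x : ℕ} (hx : x < s) (hst : s ≤ t)
    (h : ∀ r, s ≤ r → r < t → pos q s x < q r) : pos q t x = pos q s x := by
  induction t, hst using Nat.le_induction with
  | base => rfl
  | succ t ht ih =>
    have ih := ih fun r h₁ h₂ => h r h₁ (by omega)
    rw [pos_succ_of_lt (hx.trans_le ht) (by rw [ih]; exact h t ht (by omega)), ih]

theorem limit_eq_of_forall_lt {q : ℕ → ℕ} {s x p : ℕ} (hp : ∀ᶠ t in atTop, pos q t x = p)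
    (hx : x < s) (h : ∀ t, s ≤ t → pos q s x < q t) : p = pos q s x := by
  obtain ⟨t, h₁, h₂⟩ := (hp.and (eventually_ge_atTop s)).exists
  rw [← h₁, pos_eq_of_forall_lt hx h₂ fun r hr _ => h r hr]

/-- The linear order that results from a sequence of insertions. -/
def insOrder (q : ℕ → ℕ) (x y : ℕ) : Prop :=
  pos q (max x y + 1) x < pos q (max x y + 1) y

theorem insOrder_iff {q : ℕ → ℕ} {s x y : ℕ} (hx : x < s) (hy : y < s) :
    insOrder q x y ↔ pos q s x < pos q s y := by
  have hm : max x y + 1 ≤ s := by omega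
  unfold insOrder
  constructor
  · intro h
    have := pos_add_le (by omega) (by omega) hm h.le
    omega
  · intro h
    by_contra h'
    have h' := Nat.le_of_not_lt h'
    have := pos_add_le (by omega) (by omega) hm h'
    omega

/-- If insertions eventually leave alone each initial segment and each element, then the result is
a copy of `ω`, and positions converge to the isomorphism. -/
theorem exists_relIso_insOrder {q : ℕ → ℕ} (hq : ∀ s, q s ≤ s) (ht : Tendsto q atTop atTop)
    (hx : ∀ x, ∀ᶠ s in atTop, pos q s x < q s) :
    ∃ i : ((· < ·) : ℕ → ℕ → Prop) ≃r insOrder q,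
      ∀ x, ∀ᶠ s in atTop, pos q s x = i.symm x := by
  have hlim : ∀ x, ∃ p, ∀ᶠ s in atTop, pos q s x = p := by
    intro x
    obtain ⟨s, hs⟩ := eventually_atTop.1 (hx x)
    refine ⟨pos q (max s (x + 1)) x, eventually_atTop.2 ⟨max s (x + 1), fun t ht => ?_⟩⟩
    induction t, ht using Nat.le_induction with
    | base => rfl
    | succ t ht ih => rw [pos_succ_of_lt (by omega) (hs t (by omega)), ih]
  choose p hp using hlim
  have hiff : ∀ x y, insOrder q x y ↔ p x < p y := by
    intro x y
    obtain ⟨s, h₁, h₂, h₃⟩ := ((hp x).and ((hp y).and (eventually_gt_atTop (max x y)))).exists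
    rw [insOrder_iff (s := s) (by omega) (by omega), h₁, h₂]
  have hinj : Function.Injective p := by
    intro x y h
    obtain ⟨s, h₁, h₂, h₃⟩ := ((hp x).and ((hp y).and (eventually_gt_atTop (max x y)))).exists
    exact pos_injOn (s := s) (q := q) (by omega) (by omega) (by rw [h₁, h₂, h])
  have hsurj : Function.Surjective p := by
    intro n
    obtain ⟨s, hs⟩ := eventually_atTop.1 (ht.eventually_gt_atTop n)
    obtain ⟨x, hxs, hxp⟩ := exists_pos_eq hq (s := max s (n + 1)) (p := n) (by omega)
    refine ⟨x, ?_⟩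
    obtain ⟨t, h₁, h₂⟩ := ((hp x).and (eventually_ge_atTop (max s (n + 1)))).exists
    rw [← h₁, pos_eq_of_forall_lt hxs h₂ fun r hr _ => by
      rw [hxp]; exact hs r (by omega), hxp]
  refine ⟨⟨(Equiv.ofBijective p ⟨hinj, hsurj⟩).symm, fun {a b} => ?_⟩, hp⟩
  rw [hiff]
  exact iff_of_eq (congrArg₂ _ (Equiv.ofBijective_apply_symm_apply p ⟨hinj, hsurj⟩ a)
    (Equiv.ofBijective_apply_symm_apply p ⟨hinj, hsurj⟩ b))

/-! ### Insertions with priorities -/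

/-- The restraint on the `n`-th requirement at stage `s`, if `r t` is the requirement that acts at
stage `t`: it bounds the number of elements that are present after the last action of a
requirement of higher priority. It is strictly increasing in `n`. -/
def level (r : ℕ → ℕ) (n s : ℕ) : ℕ := n + {t ∈ Finset.range s | r t < n}.sup (· + 1)

theorem level_congr {r r' : ℕ → ℕ} {s : ℕ} (h : ∀ t < s, r t = r' t) (n : ℕ) :
    level r n s = level r' n s := by
  unfold level
  congr 2
  refine Finset.filter_congr fun t ht => ?_
  rw [h t (Finset.mem_range.1 ht)]

theorem le_level (r : ℕ → ℕ) (n s : ℕ) : n ≤ level r n s := Nat.le_add_right _ _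

theorem succ_le_level {r : ℕ → ℕ} {n s t : ℕ} (ht : t < s) (h : r t < n) :
    t + 1 ≤ level r n s :=
  (Finset.le_sup (f := (· + 1)) (Finset.mem_filter.2 ⟨Finset.mem_range.2 ht, h⟩)).trans
    (Nat.le_add_left _ _)

theorem level_lt_level (r : ℕ → ℕ) {m n : ℕ} (h : m < n) (s : ℕ) :
    level r m s < level r n s := by
  refine Nat.add_lt_add_of_lt_of_le h (Finset.sup_mono fun t ht => ?_)
  rw [Finset.mem_filter] at ht ⊢
  exact ⟨ht.1, ht.2.trans h⟩

theorem level_eq {r : ℕ → ℕ} {n s t : ℕ} (hst : s ≤ t)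
    (h : ∀ u, s ≤ u → u < t → n ≤ r u) : level r n t = level r n s := by
  unfold level
  congr 2
  ext u
  simp only [Finset.mem_filter, Finset.mem_range]
  constructor
  · rintro ⟨h₁, h₂⟩
    refine ⟨?_, h₂⟩
    by_contra h₃
    exact absurd h₂ (not_lt.2 (h u (by omega) h₁))
  · exact fun h => ⟨by omega, h.2⟩

theorem eventually_lt_tag {r : ℕ → ℕ} (h : ∀ n, ∀ᶠ s in atTop, r s ≠ n) (x : ℕ) :
    ∀ᶠ s in atTop, x < r s := by
  have := (Finset.eventually_all (Finset.range (x + 1))).2 fun n _ => h n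
  filter_upwards [this] with s hs
  by_contra h'
  exact hs (r s) (Finset.mem_range.2 (by omega)) rfl

theorem tendsto_of_tags {q r : ℕ → ℕ} (hr : ∀ s, r s ≤ q s)
    (hfin : ∀ n, ∀ᶠ s in atTop, r s ≠ n) : Tendsto q atTop atTop :=
  tendsto_atTop.2 fun b => (eventually_lt_tag hfin b).mono fun s hs => hs.le.trans (hr s)

/-- If a requirement never inserts below its own number, nor among the elements that were present
when a requirement of higher priority acted, and if it acts only finitely often, then eventually all
insertions happen beyond a given element. -/
theorem eventually_pos_lt_of_tags {q r : ℕ → ℕ} (hq : ∀ s, q s ≤ s) (hr : ∀ s, r s ≤ q s)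
    (hp : ∀ s, ∀ t < s, r t < r s → t + 1 ≤ q s) (hfin : ∀ n, ∀ᶠ s in atTop, r s ≠ n) (x : ℕ) :
    ∀ᶠ s in atTop, pos q s x < q s := by
  have key : ∀ s, x + 1 ≤ s → pos q s x ≤ x ∨ ∃ t < s, r t ≤ x ∧ pos q s x ≤ t := by
    intro s hs
    induction s, hs using Nat.le_induction with
    | base => exact Or.inl (by rw [pos_self]; exact hq x)
    | succ s hs ih =>
      rcases lt_or_ge (pos q s x) (q s) with h | h
      · rw [pos_succ_of_lt (by omega) h]
        exact ih.imp_right fun ⟨t, ht, h⟩ => ⟨t, by omega, h⟩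
      · by_cases hx : r s ≤ x
        · refine Or.inr ⟨s, by omega, hx, ?_⟩
          have := pos_lt hq (s := s + 1) (x := x) (by omega)
          omega
        · rcases ih with ih | ⟨t, ht, ht', ih⟩
          · have := hr s
            omega
          · have := hp s t ht (by omega)
            omega
  filter_upwards [eventually_lt_tag hfin x, eventually_gt_atTop x] with s hs hsx
  rcases key s hsx with h | ⟨t, ht, ht', h⟩
  · have := hr s
    omega
  · have := hp s t ht (by omega)
    omega

/-! ### Constructions relative to an oracle -/

/-- The sequence whose value at `s` is obtained from its values below `s` by `step s`. -/
noncomputable def histRec {α : Type} [Inhabited α] (step : ℕ → (ℕ → α) → α) : ℕ → α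
  | s => step s fun t => if _h : t < s then histRec step t else default

theorem histRec_eq {α : Type} [Inhabited α] {step : ℕ → (ℕ → α) → α}
    (h : ∀ s f g, (∀ t < s, f t = g t) → step s f = step s g) (s : ℕ) :
    histRec step s = step s (histRec step) := by
  rw [histRec]
  exact h s _ _ fun t ht => dif_pos ht

theorem histRec_congr {α : Type} [Inhabited α] {step step' : ℕ → (ℕ → α) → α} {n : ℕ}
    (h : ∀ s ≤ n, ∀ f, step s f = step' s f) {s : ℕ} (hs : s ≤ n) :
    histRec step s = histRec step' s := by
  induction s using Nat.strong_induction_on with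
  | _ s ih =>
    rw [histRec, histRec, h s hs]
    congr 1
    funext t
    split_ifs with ht
    · exact ih t ht (by omega)
    · rfl

open Classical in
/-- The order that results from a sequence of insertions is computable from the oracle, if
the `s`-th insertion depends on the bits of the oracle below `s`. -/
theorem onCone_insOrder (q : ℕ → Set ℕ → ℕ → ℕ)
    (hq : ∀ e s D D', Agree s D D' → q e D s = q e D' s) :
    OnCone fun D => ∀ e, chi (pairSet (insOrder (q e D))) ≤ᵀ chi D := by
  refine onCone_turingReducible
    (fun e D n => if n ∈ pairSet (insOrder (q e D)) then 1 else 0) (fun _ n => n)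
    fun e n D D' h => ?_
  have h₁ := Nat.unpair_left_le n
  have h₂ := Nat.unpair_right_le n
  have hc := pos_congr (q := q e D) (q' := q e D') (s := max n.unpair.1 n.unpair.2 + 1)
    fun t ht => hq e t D D' (h.mono (by omega))
  refine if_congr ?_ rfl rfl
  change insOrder _ _ _ ↔ insOrder _ _ _
  rw [insOrder, insOrder, hc, hc]

/-- The part of the domain of `Phi e D` that the first `t` bits of `D` confirm. -/
def Wt (e : ℕ) (D : Set ℕ) (t : ℕ) : Set ℕ :=
  {x | x < t ∧ ∀ D', Agree t D D' → (Phi e D' x).Dom}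

theorem Wt_congr {e t : ℕ} {D D' : Set ℕ} (h : Agree t D D') : Wt e D t = Wt e D' t :=
  Set.ext fun _ => and_congr_right fun _ =>
    ⟨fun hx E hE => hx E (h.trans hE), fun hx E hE => hx E (h.symm.trans hE)⟩

theorem Wt_subset {e t : ℕ} {D : Set ℕ} : Wt e D t ⊆ (Phi e D).Dom :=
  fun _ hx => hx.2 D (Agree.refl t D)

theorem eventually_mem_Wt {e x : ℕ} {D : Set ℕ} (hx : x ∈ (Phi e D).Dom) :
    ∀ᶠ t in atTop, x ∈ Wt e D t := by
  obtain ⟨y, hy⟩ := (PFun.mem_dom _ _).1 hx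
  obtain ⟨u, hu⟩ := Phi_exists_use hy
  filter_upwards [eventually_gt_atTop x, eventually_ge_atTop u] with t ht htu
  exact ⟨ht, fun D' hD' => Part.dom_iff_mem.2 ⟨y, hu D' (hD'.mono htu)⟩⟩

theorem ceIn_iff {D W : Set ℕ} : CEIn D W ↔ ∃ e, (Phi e D).Dom = W := by
  constructor
  · rintro ⟨f, hf, rfl⟩
    obtain ⟨e, rfl⟩ := exists_Phi_eq hf
    exact ⟨e, rfl⟩
  · rintro ⟨e, rfl⟩
    exact ⟨_, Phi_turingReducible e D, rfl⟩

/-! ### Every c.e. degree is in the spectrum -/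

/-- The number `n` is confirmed to be in the domain of `Phi e D` at stage `s`, and not before. -/
def Enters (e : ℕ) (D : Set ℕ) (s n : ℕ) : Prop := n ∈ Wt e D s ∧ ∀ t < s, n ∉ Wt e D t

theorem Enters.congr {e s n : ℕ} {D D' : Set ℕ} (h : Agree s D D') (hn : Enters e D s n) :
    Enters e D' s n :=
  ⟨Wt_congr h ▸ hn.1, fun t ht => Wt_congr (h.mono ht.le) ▸ hn.2 t ht⟩

open Classical in
/-- A stage of the construction that codes the domain of `Phi e D`: the least number that enters
it, and whose block is complete, breaks this block by an insertion at its start. The components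
of the result are the place of the insertion and the number that acts. If there is no such
number then an element is added at the end. -/
noncomputable def codeStep (e : ℕ) (D : Set ℕ) (s : ℕ) (f : ℕ → ℕ × ℕ) : ℕ × ℕ :=
  if h : ∃ n, Enters e D s n ∧ blockStart (level (fun t => (f t).2) n s + 1) ≤ s then
    (blockStart (level (fun t => (f t).2) (Nat.find h) s), Nat.find h)
  else (s, s)

/-- The sequence of insertions that codes the domain of `Phi e D`. -/
noncomputable def codeIns (e : ℕ) (D : Set ℕ) (s : ℕ) : ℕ := (histRec (codeStep e D) s).1

/-- The number that acts at stage `s`; the stage itself if none does. -/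
noncomputable def codeTag (e : ℕ) (D : Set ℕ) (s : ℕ) : ℕ := (histRec (codeStep e D) s).2

open Classical in
theorem codeStep_eq (e : ℕ) (D : Set ℕ) (s : ℕ) :
    (codeIns e D s, codeTag e D s) =
      if h : ∃ n, Enters e D s n ∧ blockStart (level (codeTag e D) n s + 1) ≤ s then
        (blockStart (level (codeTag e D) (Nat.find h) s), Nat.find h)
      else (s, s) := by
  refine histRec_eq (step := codeStep e D) (fun s f g h => ?_) s
  have : (fun n => level (fun t => (f t).2) n s) = fun n => level (fun t => (g t).2) n s :=
    funext fun n => level_congr (fun t ht => by rw [h t ht]) n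
  have hn := fun n => congrFun this n
  simp only [codeStep, hn]

theorem histRec_codeStep_congr {e n : ℕ} {D D' : Set ℕ} (h : Agree n D D') {s : ℕ} (hs : s ≤ n) :
    histRec (codeStep e D) s = histRec (codeStep e D') s := by
  refine histRec_congr (fun t ht f => ?_) hs
  have : Enters e D t = Enters e D' t := funext fun m => propext
    ⟨Enters.congr (h.mono ht), Enters.congr (h.mono ht).symm⟩
  unfold codeStep
  rw [this]

theorem codeIns_congr {e s : ℕ} {D D' : Set ℕ} (h : Agree s D D') :
    codeIns e D s = codeIns e D' s := congrArg Prod.fst (histRec_codeStep_congr h le_rfl)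

theorem codeTag_congr {e s : ℕ} {D D' : Set ℕ} (h : Agree s D D') :
    codeTag e D s = codeTag e D' s := congrArg Prod.snd (histRec_codeStep_congr h le_rfl)

theorem code_cases (e : ℕ) (D : Set ℕ) (s : ℕ) :
    (Enters e D s (codeTag e D s) ∧
      blockStart (level (codeTag e D) (codeTag e D s) s + 1) ≤ s ∧
      codeIns e D s = blockStart (level (codeTag e D) (codeTag e D s) s)) ∨
    (codeIns e D s = s ∧ codeTag e D s = s) := by
  classical
  have h := codeStep_eq e D s
  split_ifs at h with hn
  · obtain ⟨h₁, h₂⟩ := Prod.mk.inj h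
    rw [← h₂] at h₁
    have := Nat.find_spec hn
    rw [← h₂] at this
    exact Or.inl ⟨this.1, this.2, h₁⟩
  · exact Or.inr (Prod.mk.inj h)

theorem code_of_enters {e s n : ℕ} {D : Set ℕ} (h : Enters e D s n)
    (h' : blockStart (level (codeTag e D) n s + 1) ≤ s)
    (hmin : ∀ m < n, ¬ Enters e D s m) :
    codeTag e D s = n ∧ codeIns e D s = blockStart (level (codeTag e D) n s) := by
  classical
  have hs := codeStep_eq e D s
  have hn : ∃ n, Enters e D s n ∧ blockStart (level (codeTag e D) n s + 1) ≤ s := ⟨n, h, h'⟩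
  rw [dif_pos hn] at hs
  have hf : Nat.find hn = n := (Nat.find_eq_iff hn).2 ⟨⟨h, h'⟩, fun m hm hm' => hmin m hm hm'.1⟩
  obtain ⟨h₁, h₂⟩ := Prod.mk.inj hs
  rw [hf] at h₁ h₂
  exact ⟨h₂, h₁⟩

theorem codeIns_le (e : ℕ) (D : Set ℕ) (s : ℕ) : codeIns e D s ≤ s := by
  rcases code_cases e D s with ⟨-, h, h'⟩ | ⟨h, -⟩
  · have := blockStart_lt_succ (level (codeTag e D) (codeTag e D s) s)
    omega
  · exact h.le

theorem level_le_codeIns (e : ℕ) (D : Set ℕ) (s : ℕ) :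
    codeIns e D s = s ∧ codeTag e D s = s ∨
      level (codeTag e D) (codeTag e D s) s ≤ codeIns e D s := by
  rcases code_cases e D s with ⟨-, h, h'⟩ | h
  · exact Or.inr (h' ▸ le_blockStart _)
  · exact Or.inl h

theorem codeTag_le (e : ℕ) (D : Set ℕ) (s : ℕ) : codeTag e D s ≤ codeIns e D s := by
  rcases level_le_codeIns e D s with h | h
  · omega
  · exact (le_level _ _ _).trans h

theorem code_priority (e : ℕ) (D : Set ℕ) (s t : ℕ) (ht : t < s)
    (h : codeTag e D t < codeTag e D s) : t + 1 ≤ codeIns e D s := by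
  rcases level_le_codeIns e D s with h' | h'
  · omega
  · exact (succ_le_level ht h).trans h'

theorem eventually_codeTag_ne (e : ℕ) (D : Set ℕ) (n : ℕ) :
    ∀ᶠ s in atTop, codeTag e D s ≠ n := by
  by_cases hn : ∃ t, n ∈ Wt e D t
  · obtain ⟨t, ht⟩ := hn
    filter_upwards [eventually_gt_atTop t, eventually_gt_atTop n] with s hs hsn h
    rcases code_cases e D s with h' | h'
    · exact h'.1.2 t hs (h ▸ ht)
    · omega
  · filter_upwards [eventually_gt_atTop n] with s hsn h
    rcases code_cases e D s with h' | h'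
    · exact hn ⟨s, h ▸ h'.1.1⟩
    · omega

/-- While no number below `n` acts, the block that belongs to `n` is touched only by `n`. -/
theorem lt_codeIns {e : ℕ} {D : Set ℕ} {n s t : ℕ} (hst : s ≤ t)
    (hs : blockStart (level (codeTag e D) n s + 1) ≤ s)
    (h : ∀ u, s ≤ u → u < t → n ≤ codeTag e D u) (ht : n < codeTag e D t) :
    blockStart (level (codeTag e D) n s + 1) ≤ codeIns e D t := by
  rcases code_cases e D t with ⟨-, -, h'⟩ | h'
  · rw [h', ← level_eq hst h]
    exact blockStart_strictMono.monotone (level_lt_level _ ht t)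
  · omega

/-- The certificates for values of the coding relation from `W`: the confirmed part of `W` is
correct as far as it matters for the positions of the two arguments. -/
def CodeCert (e : ℕ) (W D : Set ℕ) (s z v : ℕ) : Prop :=
  z.unpair.1 < s ∧ z.unpair.2 < s ∧
    (∃ b ≤ s, pos (codeIns e D) s z.unpair.1 < b ∧ pos (codeIns e D) s z.unpair.2 < b ∧
      ∀ m < b, m ∈ W → ∃ t < s, m ∈ Wt e D t) ∧
    ((cyc (pos (codeIns e D) s z.unpair.1) (pos (codeIns e D) s z.unpair.2) ∧ v = 1) ∨
      (¬ cyc (pos (codeIns e D) s z.unpair.1) (pos (codeIns e D) s z.unpair.2) ∧ v = 0))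

/-- The certificates for `W` from the coding relation `Y`: at stage `s`, the block of each
number up to `n` that is not confirmed to be in `W` is complete and is never broken. -/
def DecodeCert (e : ℕ) (Y D : Set ℕ) (N n v : ℕ) : Prop :=
  ∃ s ≤ N, (∀ m ≤ n, (∃ t < s, m ∈ Wt e D t) ∨
    (blockStart (level (codeTag e D) m s + 1) ≤ s ∧ ∀ u < s, ∀ w < s,
      pos (codeIns e D) s u = blockStart (level (codeTag e D) m s) →
      pos (codeIns e D) s w = blockStart (level (codeTag e D) m s + 1) - 1 →
      Nat.pair w u < N ∧ Nat.pair w u ∈ Y)) ∧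
    (((∃ t < s, n ∈ Wt e D t) ∧ v = 1) ∨ ((¬ ∃ t < s, n ∈ Wt e D t) ∧ v = 0))

theorem exists_Wt_congr {e s x : ℕ} {D D' : Set ℕ} (h : Agree s D D') :
    (∃ t < s, x ∈ Wt e D t) ↔ ∃ t < s, x ∈ Wt e D' t :=
  exists_congr fun t => and_congr_right fun ht => by rw [Wt_congr (h.mono ht.le)]

theorem CodeCert.congr {e s z v : ℕ} {W W' D D' : Set ℕ} (hW : Agree s W W') (hD : Agree s D D')
    (h : CodeCert e W D s z v) : CodeCert e W' D' s z v := by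
  have hp := pos_congr (q := codeIns e D) (q' := codeIns e D') (s := s)
    fun t ht => codeIns_congr (hD.mono ht.le)
  obtain ⟨h₁, h₂, ⟨b, hb, h₃, h₄, h₅⟩, h₆⟩ := h
  rw [hp, hp] at h₆
  rw [hp] at h₃ h₄
  exact ⟨h₁, h₂, ⟨b, hb, h₃, h₄, fun m hm hmW =>
    (exists_Wt_congr hD).1 (h₅ m hm ((hW m (hm.trans_le hb)).2 hmW))⟩, h₆⟩

theorem DecodeCert.congr {e N n v : ℕ} {Y Y' D D' : Set ℕ} (hY : Agree N Y Y')
    (hD : Agree N D D') (h : DecodeCert e Y D N n v) : DecodeCert e Y' D' N n v := by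
  obtain ⟨s, hs, h₁, h₂⟩ := h
  have hD := hD.mono hs
  have hp := pos_congr (q := codeIns e D) (q' := codeIns e D') (s := s)
    fun t ht => codeIns_congr (hD.mono ht.le)
  have hl := level_congr (r := codeTag e D) (r' := codeTag e D') (s := s)
    fun t ht => codeTag_congr (hD.mono ht.le)
  refine ⟨s, hs, fun m hm => (h₁ m hm).imp (exists_Wt_congr hD).1 fun h => ?_, ?_⟩
  · refine ⟨hl m ▸ h.1, fun u hu w hw hpu hpw => ?_⟩
    rw [← hp, ← hl] at hpu hpw
    have := h.2 u hu w hw hpu hpw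
    exact ⟨this.1, (hY _ this.1).1 this.2⟩
  · rwa [exists_Wt_congr hD] at h₂

section

variable {e : ℕ} {D : Set ℕ} {i : ((· < ·) : ℕ → ℕ → Prop) ≃r insOrder (codeIns e D)}

theorem CodeCert.sound (hi : ∀ x, ∀ᶠ s in atTop, pos (codeIns e D) s x = i.symm x) {s z v : ℕ}
    (h : CodeCert e (Phi e D).Dom D s z v) :
    (z ∈ pairSet (transfer i cyc) ∧ v = 1) ∨ (z ∉ pairSet (transfer i cyc) ∧ v = 0) := by
  obtain ⟨h₁, h₂, ⟨b, hb, h₃, h₄, h₅⟩, h₆⟩ := h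
  -- numbers that act from stage `s` on are at least `b`, and so are their insertions
  have hins : ∀ t, s ≤ t → b ≤ codeIns e D t := by
    intro t ht
    refine le_trans ?_ (codeTag_le e D t)
    by_contra hlt
    rcases code_cases e D t with ⟨h, -, -⟩ | h
    · obtain ⟨t', ht', hm⟩ := h₅ _ (not_le.1 hlt) (Wt_subset h.1)
      exact h.2 t' (by omega) hm
    · omega
  have hx := limit_eq_of_forall_lt (hi _) h₁ fun t ht => h₃.trans_le (hins t ht)
  have hy := limit_eq_of_forall_lt (hi _) h₂ fun t ht => h₄.trans_le (hins t ht)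
  rw [← hx, ← hy] at h₆
  exact h₆

theorem CodeCert.complete (hi : ∀ x, ∀ᶠ s in atTop, pos (codeIns e D) s x = i.symm x) (z : ℕ) :
    ∃ s v, CodeCert e (Phi e D).Dom D s z v := by
  classical
  set b := max (i.symm z.unpair.1) (i.symm z.unpair.2) + 1 with hb
  have hW : ∀ᶠ s in atTop, ∀ m ∈ Finset.range b, m ∈ (Phi e D).Dom → ∃ t < s, m ∈ Wt e D t := by
    refine (Finset.eventually_all _).2 fun m _ => ?_
    by_cases hm : m ∈ (Phi e D).Dom
    · obtain ⟨t, ht⟩ := (eventually_mem_Wt hm).exists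
      filter_upwards [eventually_gt_atTop t] with s hs _ using ⟨t, hs, ht⟩
    · exact Eventually.of_forall fun s h => absurd h hm
  obtain ⟨s, h₁, h₂, h₃, h₄, h₅⟩ := (hW.and ((hi z.unpair.1).and ((hi z.unpair.2).and
    ((eventually_ge_atTop b).and (eventually_gt_atTop z))))).exists
  refine ⟨s, if cyc (pos (codeIns e D) s z.unpair.1) (pos (codeIns e D) s z.unpair.2) then 1 else 0,
    (Nat.unpair_left_le z).trans_lt h₅, (Nat.unpair_right_le z).trans_lt h₅,
    ⟨b, h₄, by omega, by omega, fun m hm => h₁ m (Finset.mem_range.2 hm)⟩, ?_⟩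
  split_ifs with h <;> simp [h]

theorem DecodeCert.sound (hi : ∀ x, ∀ᶠ s in atTop, pos (codeIns e D) s x = i.symm x) {N n v : ℕ}
    (h : DecodeCert e (pairSet (transfer i cyc)) D N n v) :
    (n ∈ (Phi e D).Dom ∧ v = 1) ∨ (n ∉ (Phi e D).Dom ∧ v = 0) := by
  classical
  obtain ⟨s, hs, h₁, h₂⟩ := h
  rcases h₂ with ⟨⟨t, -, ht⟩, hv⟩ | ⟨hn, hv⟩
  · exact Or.inl ⟨Wt_subset ht, hv⟩
  refine Or.inr ⟨fun hnW => ?_, hv⟩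
  -- the least number that enters `W` at stage `s` or later
  have hex : ∃ m, m ∈ (Phi e D).Dom ∧ ¬ ∃ t < s, m ∈ Wt e D t := ⟨n, hnW, hn⟩
  obtain ⟨m, ⟨hmW, hms⟩, hmin⟩ : ∃ m, (m ∈ (Phi e D).Dom ∧ ¬ ∃ t < s, m ∈ Wt e D t) ∧
      ∀ k < m, ¬ (k ∈ (Phi e D).Dom ∧ ¬ ∃ t < s, k ∈ Wt e D t) :=
    ⟨Nat.find hex, Nat.find_spec hex, fun k hk => Nat.find_min hex hk⟩
  have hmn : m ≤ n := not_lt.1 fun h => hmin n h ⟨hnW, hn⟩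
  obtain ⟨hc, hcode⟩ := (h₁ m hmn).resolve_left hms
  set κ := level (codeTag e D) m s with hκ
  have hκs : blockStart κ < blockStart (κ + 1) := blockStart_lt_succ κ
  have hm_le : m < s := (le_level _ _ s).trans_lt (hκ ▸ (le_blockStart κ).trans_lt (by omega))
  have hent : ∃ t, m ∈ Wt e D t := (eventually_mem_Wt hmW).exists
  obtain ⟨t, ht, htm⟩ : ∃ t, m ∈ Wt e D t ∧ ∀ t' < t, m ∉ Wt e D t' :=
    ⟨Nat.find hent, Nat.find_spec hent, fun t' h => Nat.find_min hent h⟩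
  have hst : s ≤ t := not_lt.1 fun h => hms ⟨t, h, ht⟩
  -- after stage `s` no smaller number acts, and `m` acts at stage `t` only
  have hge : ∀ u, s ≤ u → m ≤ codeTag e D u := by
    intro u hu
    by_contra hlt
    rcases code_cases e D u with ⟨h, -, -⟩ | h
    · exact hmin _ (not_le.1 hlt) ⟨Wt_subset h.1, fun ⟨t', ht', h'⟩ => h.2 t' (by omega) h'⟩
    · omega
  have hgt : ∀ u, s ≤ u → u ≠ t → m < codeTag e D u := by
    intro u hu hut
    refine lt_of_le_of_ne (hge u hu) fun hmu => ?_
    rcases code_cases e D u with ⟨h, -, -⟩ | h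
    · rw [← hmu] at h
      rcases lt_or_gt_of_ne hut with h' | h'
      · exact htm u h' h.1
      · exact h.2 t h' ht
    · omega
  have hins : ∀ u, s ≤ u → u ≠ t → blockStart (κ + 1) ≤ codeIns e D u := fun u hu hut =>
    lt_codeIns hu hc (fun u' h _ => hge u' h) (hgt u hu hut)
  have hlt : level (codeTag e D) m t = κ := level_eq hst fun u h _ => hge u h
  have hact := (code_of_enters (n := m) ⟨ht, htm⟩ (by rw [hlt]; omega) fun k hk hk' =>
    hmin k hk ⟨Wt_subset hk'.1, fun ⟨t', ht', h'⟩ => hk'.2 t' (by omega) h'⟩).2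
  rw [hlt] at hact
  -- the insertion of `m` separates the first and the last element of its block
  obtain ⟨u, hu, hpu⟩ := exists_pos_eq (codeIns_le e D) (s := s) (p := blockStart κ) (by omega)
  obtain ⟨w, hw, hpw⟩ := exists_pos_eq (codeIns_le e D) (s := s) (p := blockStart (κ + 1) - 1)
    (by omega)
  have hR := (hcode u hu w hw hpu hpw).2
  have hpu' : pos (codeIns e D) t u = blockStart κ := by
    rw [← hpu]
    exact pos_eq_of_forall_lt hu hst fun r h₁ h₂ => by
      have := hins r h₁ (by omega); omega
  have hpw' : pos (codeIns e D) t w = blockStart (κ + 1) - 1 := by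
    rw [← hpw]
    exact pos_eq_of_forall_lt hw hst fun r h₁ h₂ => by
      have := hins r h₁ (by omega); omega
  have hpu₁ : pos (codeIns e D) (t + 1) u = blockStart κ + 1 := by
    rw [pos_succ_of_le (by omega) (by omega), hpu']
  have hpw₁ : pos (codeIns e D) (t + 1) w = blockStart (κ + 1) := by
    rw [pos_succ_of_le (by omega) (by omega), hpw']
    omega
  have hlen := two_le_blockLen κ
  have hsucc := blockStart_succ κ
  have hiu : i.symm u = blockStart κ + 1 := by
    rw [← hpu₁]
    refine limit_eq_of_forall_lt (hi u) (by omega) fun r hr => ?_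
    have := hins r (by omega) (by omega)
    omega
  have hiw : blockStart (κ + 1) ≤ i.symm w := by
    obtain ⟨r, hr, hr'⟩ := ((hi w).and (eventually_ge_atTop (t + 1))).exists
    rw [← hr, ← hpw₁]
    exact pos_le_pos (by omega) hr'
  have hR' : cyc (i.symm w) (i.symm u) := by
    simpa [pairSet, transfer] using hR
  have := (cyc_block (k := κ) hR').2 (by omega)
  omega

theorem DecodeCert.complete (hi : ∀ x, ∀ᶠ s in atTop, pos (codeIns e D) s x = i.symm x) (n : ℕ) :
    ∃ N v, DecodeCert e (pairSet (transfer i cyc)) D N n v := by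
  classical
  have hten := tendsto_of_tags (codeTag_le e D) (eventually_codeTag_ne e D)
  have key : ∀ᶠ s in atTop, ∀ m ∈ Finset.range (n + 1), (∃ t < s, m ∈ Wt e D t) ∨
    (blockStart (level (codeTag e D) m s + 1) ≤ s ∧ ∀ u < s, ∀ w < s,
      pos (codeIns e D) s u = blockStart (level (codeTag e D) m s) →
      pos (codeIns e D) s w = blockStart (level (codeTag e D) m s + 1) - 1 →
      Nat.pair w u ∈ pairSet (transfer i cyc)) := by
    refine (Finset.eventually_all _).2 fun m _ => ?_
    obtain ⟨a, ha⟩ := eventually_atTop.1 (eventually_lt_tag (eventually_codeTag_ne e D) m)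
    set κ := level (codeTag e D) m a with hκ
    obtain ⟨b, hb⟩ := eventually_atTop.1 (hten.eventually_ge_atTop (blockStart (κ + 1)))
    filter_upwards [eventually_ge_atTop a, eventually_ge_atTop b,
      eventually_ge_atTop (blockStart (κ + 1))] with s h₁ h₂ h₃
    have hlev : level (codeTag e D) m s = κ := level_eq h₁ fun u hu _ => (ha u hu).le
    rw [hlev]
    refine Or.inr ⟨h₃, fun u hu w hw hpu hpw => ?_⟩
    have := blockStart_lt_succ κ
    have hiu := limit_eq_of_forall_lt (hi u) hu fun t ht => by
      have := hb t (by omega); omega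
    have hiw := limit_eq_of_forall_lt (hi w) hw fun t ht => by
      have := hb t (by omega); omega
    have : cyc (i.symm w) (i.symm u) := by
      rw [hiu, hiw, hpu, hpw]
      exact cyc_last_first κ
    simpa [pairSet, transfer] using this
  obtain ⟨s, hs⟩ := key.exists
  refine ⟨max s (Nat.pair s s), if ∃ t < s, n ∈ Wt e D t then 1 else 0, s, le_max_left _ _,
    fun m hm => (hs m (Finset.mem_range.2 (by omega))).imp_right fun h => ⟨h.1,
      fun u hu w hw hpu hpw => ⟨?_, h.2 u hu w hw hpu hpw⟩⟩, ?_⟩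
  · exact lt_max_of_lt_right ((Nat.pair_lt_pair_left u hw).trans (Nat.pair_lt_pair_right s hu))
  · split_ifs with h
    · exact Or.inl ⟨h, rfl⟩
    · exact Or.inr ⟨h, rfl⟩

end

/-- On a cone, every c.e. degree is in the spectrum. -/
theorem onCone_ceDegrees_subset : OnCone fun D => ceDegrees D ⊆ dgSp (· < ·) cyc D := by
  classical
  refine ((onCone_insOrder codeIns fun e s D D' h => codeIns_congr h).and
    ((onCone_turingReducible_join CodeCert fun _ _ _ _ _ _ _ _ hW hD h => h.congr hW hD).and
    (onCone_turingReducible_join DecodeCert fun _ _ _ _ _ _ _ _ hW hD h => h.congr hW hD))).mono ?_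
  rintro D ⟨h₁, h₂, h₃⟩ a ⟨W, hW, rfl⟩
  obtain ⟨e, rfl⟩ := ceIn_iff.1 hW
  obtain ⟨i, hi⟩ := exists_relIso_insOrder (codeIns_le e D)
    (tendsto_of_tags (codeTag_le e D) (eventually_codeTag_ne e D))
    (eventually_pos_lt_of_tags (codeIns_le e D) (codeTag_le e D) (code_priority e D)
      (eventually_codeTag_ne e D))
  refine ⟨_, i, h₁ e, deg_join_eq_iff.2 ⟨?_, ?_⟩⟩
  · have hs : ∀ n x v, DecodeCert e (pairSet (transfer i cyc)) D n x v →
        v = if x ∈ (Phi e D).Dom then 1 else 0 := by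
      intro n x v h
      rcases h.sound hi with ⟨h', rfl⟩ | ⟨h', rfl⟩
      · exact (if_pos h').symm
      · exact (if_neg h').symm
    exact h₃ e _ (fun x => if x ∈ (Phi e D).Dom then 1 else 0) (fun x => by
      obtain ⟨N, v, h⟩ := DecodeCert.complete hi x
      exact ⟨N, hs _ _ _ h ▸ h⟩) hs
  · have hs : ∀ n x v, CodeCert e (Phi e D).Dom D n x v →
        v = if x ∈ pairSet (transfer i cyc) then 1 else 0 := by
      intro n x v h
      rcases h.sound hi with ⟨h', rfl⟩ | ⟨h', rfl⟩
      · exact (if_pos h').symm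
      · exact (if_neg h').symm
    exact h₂ e _ (fun x => if x ∈ pairSet (transfer i cyc) then 1 else 0) (fun x => by
      obtain ⟨N, v, h⟩ := CodeCert.complete hi x
      exact ⟨N, hs _ _ _ h ▸ h⟩) hs

/-! ### The relation cannot alternate -/

/-- If elements that fill a block move apart, and the relation among them is the same as before,
then they fill a block of the same length again. -/
theorem exists_block_of_cyc_iff {F : Set ℕ} {K k : ℕ} {p p' : ℕ → ℕ} (hk : k < K)
    (hsurj : ∀ n < blockStart K, ∃ x ∈ F, p x = n)
    (hgap : ∀ x ∈ F, ∀ y ∈ F, p x ≤ p y → p y + p' x ≤ p' y + p x)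
    (hR : ∀ x ∈ F, ∀ y ∈ F, (cyc (p' x) (p' y) ↔ cyc (p x) (p y))) :
    ∃ j, blockLen j = blockLen k ∧
      ∀ x ∈ F, ∀ o < blockLen k, p x = blockStart k + o → p' x = blockStart j + o := by
  have hlen := two_le_blockLen k
  have hsucc := blockStart_succ k
  have hK : blockStart (k + 1) ≤ blockStart K := blockStart_strictMono.monotone hk
  obtain ⟨a, haF, ha⟩ := hsurj (blockStart k) (by omega)
  have hinj : ∀ x ∈ F, ∀ y ∈ F, p x = p y → p' x = p' y := fun x hx y hy h => by
    have := hgap x hx y hy h.le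
    have := hgap y hy x hx h.ge
    omega
  have key : ∀ o < blockLen k, ∀ x ∈ F, p x = blockStart k + o → p' x = p' a + o := by
    intro o
    induction o with
    | zero => exact fun _ x hx hpx => hinj x hx a haF (by omega)
    | succ o ih =>
      intro ho x hx hpx
      obtain ⟨y, hy, hpy⟩ := hsurj (blockStart k + o) (by omega)
      have hy' := ih (by omega) y hy hpy
      have hc : cyc (p' y) (p' x) := by
        rw [hR y hy x hx, hpy, hpx]
        exact (cyc_add_iff (by omega) ho).2 ⟨rfl, Or.inl rfl⟩
      have := hgap y hy x hx (by omega)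
      obtain ⟨l, h₁, h₂⟩ := exists_block (p' y)
      have := (cyc_iff h₁ h₂).1 hc
      omega
  obtain ⟨z, hzF, hz⟩ := hsurj (blockStart k + (blockLen k - 1)) (by omega)
  have hz' := key _ (by omega) z hzF hz
  have hc : cyc (p' z) (p' a) := by
    rw [hR z hzF a haF, hz, ha]
    exact (cyc_add_iff (l := k) (b := 0) (by omega) (by omega)).2 ⟨rfl, by omega⟩
  obtain ⟨j, h₁, h₂⟩ := exists_block (p' z)
  have := (cyc_iff h₁ h₂).1 hc
  have := blockStart_succ j
  refine ⟨j, by omega, fun x hx o ho hpx => ?_⟩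
  have := key o ho x hx hpx
  omega

/-- Six configurations, in each of which an initial segment of blocks is filled, and which arise
from each other by moving elements apart. If the relation on each is the same again two steps
later, then the first two have the same relation. -/
theorem cyc_iff_of_alternating {F : ℕ → Set ℕ} {K : ℕ → ℕ} {p : ℕ → ℕ → ℕ}
    (hlt : ∀ t ≤ 5, ∀ x ∈ F t, p t x < blockStart (K t))
    (hsurj : ∀ t ≤ 5, ∀ n < blockStart (K t), ∃ x ∈ F t, p t x = n)
    (hsub : ∀ t < 5, F t ⊆ F (t + 1))
    (hgap : ∀ s t, s ≤ t → t ≤ 5 → ∀ x ∈ F s, ∀ y ∈ F s, p s x ≤ p s y →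
      p s y + p t x ≤ p t y + p s x)
    (hmono : ∀ s t, s ≤ t → t ≤ 5 → ∀ x ∈ F s, p s x ≤ p t x)
    (hR : ∀ t, t + 2 ≤ 5 → ∀ x ∈ F t, ∀ y ∈ F t,
      (cyc (p (t + 2) x) (p (t + 2) y) ↔ cyc (p t x) (p t y))) :
    ∀ x ∈ F 0, ∀ y ∈ F 0, (cyc (p 1 x) (p 1 y) ↔ cyc (p 0 x) (p 0 y)) := by
  intro x₀ hx₀ y₀ hy₀
  by_contra hne
  have hF1 : F 0 ⊆ F 1 := hsub 0 (by omega)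
  have hF2 : F 1 ⊆ F 2 := hsub 1 (by omega)
  have hF3 : F 2 ⊆ F 3 := hsub 2 (by omega)
  have hF4 : F 3 ⊆ F 4 := hsub 3 (by omega)
  have restore : ∀ t, t + 2 ≤ 5 → ∀ k < K t, ∃ j, blockLen j = blockLen k ∧
      ∀ x ∈ F t, ∀ o < blockLen k, p t x = blockStart k + o → p (t + 2) x = blockStart j + o :=
    fun t ht k hk => exists_block_of_cyc_iff hk (hsurj t (by omega))
      (hgap t (t + 2) (by omega) ht) (hR t ht)
  have restore4 : ∀ t, t + 4 ≤ 5 → ∀ k < K t, ∃ j, blockLen j = blockLen k ∧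
      ∀ x ∈ F t, ∀ o < blockLen k, p t x = blockStart k + o → p (t + 4) x = blockStart j + o :=
    fun t ht k hk => exists_block_of_cyc_iff hk (hsurj t (by omega))
      (hgap t (t + 4) (by omega) ht) fun x hx y hy =>
        (hR (t + 2) (by omega) x (hsub _ (by omega) (hsub _ (by omega) hx)) y
          (hsub _ (by omega) (hsub _ (by omega) hy))).trans (hR t (by omega) x hx y hy)
  -- the block `k` of `x₀` in the first configuration, its length `c` and its first element `a`
  obtain ⟨k, hk₁, hk₂⟩ := exists_block (p 0 x₀)
  have hkK : k < K 0 := blockStart_strictMono.lt_iff_lt.1 (hk₁.trans_lt (hlt 0 (by omega) x₀ hx₀))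
  have hkS : blockStart (k + 1) ≤ blockStart (K 0) := blockStart_strictMono.monotone hkK
  have hc := two_le_blockLen k
  have hks := blockStart_succ k
  obtain ⟨a, haF, ha⟩ := hsurj 0 (by omega) (blockStart k) (by omega)
  obtain ⟨j₂, hj₂, hr₂⟩ := restore 0 (by omega) k hkK
  obtain ⟨j₄, hj₄, hr₄⟩ := restore4 0 (by omega) k hkK
  simp only [Nat.zero_add] at hr₂ hr₄
  have ha₂ := hr₂ a haF 0 (by omega) (by omega)
  have ha₄ := hr₄ a haF 0 (by omega) (by omega)
  -- between two returns of the relation the block stays contiguous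
  have hcont₁ : ∀ x ∈ F 0, ∀ o < blockLen k, p 0 x = blockStart k + o → p 1 x = p 1 a + o := by
    intro x hx o ho hpx
    have h₁ := hr₂ x hx o ho hpx
    have h₂ := hgap 0 1 (by omega) (by omega) a haF x hx (by omega)
    have h₃ := hgap 1 2 (by omega) (by omega) a (hF1 haF) x (hF1 hx) (by omega)
    omega
  have hcont₃ : ∀ x ∈ F 0, ∀ o < blockLen k, p 0 x = blockStart k + o → p 3 x = p 3 a + o := by
    intro x hx o ho hpx
    have h₁ := hr₂ x hx o ho hpx
    have h₁' := hr₄ x hx o ho hpx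
    have h₂ := hgap 2 3 (by omega) (by omega) a (hF2 (hF1 haF)) x (hF2 (hF1 hx)) (by omega)
    have h₃ := hgap 3 4 (by omega) (by omega) a (hF3 (hF2 (hF1 haF))) x (hF3 (hF2 (hF1 hx)))
      (by omega)
    omega
  have hnot : ∀ j, p 1 a = blockStart j → blockLen j ≠ blockLen k := by
    intro j hj hlen
    apply hne
    have hjs := blockStart_succ j
    have hx₁ := hcont₁ x₀ hx₀ (p 0 x₀ - blockStart k) (by omega) (by omega)
    have hiff : ∀ y ∈ F 0, (blockStart k ≤ p 0 y ∧ p 0 y < blockStart (k + 1)) ↔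
        (blockStart j ≤ p 1 y ∧ p 1 y < blockStart (j + 1)) := by
      intro y hy
      constructor
      · intro h
        have := hcont₁ y hy (p 0 y - blockStart k) (by omega) (by omega)
        omega
      · intro h
        obtain ⟨z, hz, hpz⟩ := hsurj 0 (by omega) (blockStart k + (p 1 y - blockStart j)) (by omega)
        have h₁ := hcont₁ z hz _ (by omega) hpz
        have h₂ := hgap 0 1 (by omega) (by omega) z hz y hy
        have h₃ := hgap 0 1 (by omega) (by omega) y hy z hz
        omega
    by_cases hy : blockStart k ≤ p 0 y₀ ∧ p 0 y₀ < blockStart (k + 1)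
    · have hy₁ := hcont₁ y₀ hy₀ (p 0 y₀ - blockStart k) (by omega) (by omega)
      rw [cyc_iff (k := j) (by omega) (by omega), cyc_iff hk₁ hk₂]
      omega
    · have hx := (hiff x₀ hx₀).1 ⟨hk₁, hk₂⟩
      exact iff_of_false (fun h => hy ((hiff y₀ hy₀).2 ((cyc_block h).1 hx)))
        fun h => hy ((cyc_block h).1 ⟨hk₁, hk₂⟩)
  obtain ⟨m, hm₁, hm₂⟩ := exists_block (p 1 a)
  have hms := blockStart_succ m
  have hin : ∀ n, ∀ x ∈ F 1, blockStart n ≤ p 1 x → n < K 1 := fun n x hx h =>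
    blockStart_strictMono.lt_iff_lt.1 (h.trans_lt (hlt 1 (by omega) x hx))
  -- the block of the second configuration that contains `a` also contains its predecessor
  have hprev : p 1 a = blockStart m := by
    by_contra hlt'
    have hmK := hin m a (hF1 haF) hm₁
    have := hlt 1 (by omega) a (hF1 haF)
    obtain ⟨z, hzF, hz⟩ := hsurj 1 (by omega) (p 1 a - 1) (by omega)
    obtain ⟨n₃, hn₃, hr₃⟩ := restore 1 (by omega) m hmK
    obtain ⟨n₅, hn₅, hr₅⟩ := restore4 1 (by omega) m hmK
    have hz₃ := hr₃ z hzF (p 1 z - blockStart m) (by omega) (by omega)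
    have ha₃ := hr₃ a (hF1 haF) (p 1 a - blockStart m) (by omega) (by omega)
    have hz₅ := hr₅ z hzF (p 1 z - blockStart m) (by omega) (by omega)
    have ha₅ := hr₅ a (hF1 haF) (p 1 a - blockStart m) (by omega) (by omega)
    simp only [Nat.reduceAdd] at hz₃ ha₃ hz₅ ha₅
    have g₁ := hgap 1 2 (by omega) (by omega) z hzF a (hF1 haF) (by omega)
    have g₂ := hgap 2 3 (by omega) (by omega) z (hF2 hzF) a (hF2 (hF1 haF)) (by omega)
    have g₃ := hgap 3 4 (by omega) (by omega) z (hF3 (hF2 hzF)) a (hF3 (hF2 (hF1 haF))) (by omega)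
    have g₄ := hgap 4 5 (by omega) (by omega) z (hF4 (hF3 (hF2 hzF))) a
      (hF4 (hF3 (hF2 (hF1 haF)))) (by omega)
    obtain ⟨i, rfl⟩ : ∃ i, j₂ = i + 1 := by
      cases j₂ with
      | zero => simp [blockStart] at ha₂; omega
      | succ i => exact ⟨i, rfl⟩
    have his := blockStart_succ i
    have hil := two_le_blockLen i
    have hiK : i < K 2 := blockStart_strictMono.lt_iff_lt.1
      (lt_of_le_of_lt (by omega) (hlt 2 (by omega) z (hF2 hzF)))
    obtain ⟨l, hl, hrl⟩ := restore 2 (by omega) i hiK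
    have hz₄ := hrl z (hF2 hzF) (blockLen i - 1) (by omega) (by omega)
    simp only [Nat.reduceAdd] at hz₄
    have hls := blockStart_succ l
    obtain rfl : l + 1 = j₄ := blockStart_strictMono.injective (by omega)
    obtain rfl : i = l := blockLen_pair_injective hl.symm (by omega)
    have m₁ := hmono 2 3 (by omega) (by omega) a (hF2 (hF1 haF))
    have m₂ := hmono 3 4 (by omega) (by omega) a (hF3 (hF2 (hF1 haF)))
    have hns := blockStart_succ n₃
    have hiss := blockStart_lt_succ (i + 1)
    obtain rfl := block_unique (k := i + 1) (l := n₃) (u := p 3 a) (by omega) (by omega) (by omega)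
      (by omega)
    omega
  -- no block of the second configuration contains the last element of the block and its successor
  have hnext : ∀ n, ¬ (blockStart n < p 1 a + blockLen k ∧
      p 1 a + blockLen k < blockStart (n + 1)) := by
    rintro n ⟨hn₁, hn₂⟩
    obtain ⟨z', hz'F, hz'⟩ := hsurj 0 (by omega) (blockStart k + (blockLen k - 1)) (by omega)
    have hz'₁ := hcont₁ z' hz'F _ (by omega) hz'
    have hz'₂ := hr₂ z' hz'F _ (by omega) hz'
    have hz'₄ := hr₄ z' hz'F _ (by omega) hz'
    have hnK := hin n z' (hF1 hz'F) (by omega)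
    have hnS : blockStart (n + 1) ≤ blockStart (K 1) := blockStart_strictMono.monotone hnK
    have hns := blockStart_succ n
    obtain ⟨z, hzF, hz⟩ := hsurj 1 (by omega) (p 1 a + blockLen k) (by omega)
    obtain ⟨n₃, hn₃, hr₃⟩ := restore 1 (by omega) n hnK
    obtain ⟨n₅, hn₅, hr₅⟩ := restore4 1 (by omega) n hnK
    have hz₃ := hr₃ z hzF (p 1 z - blockStart n) (by omega) (by omega)
    have hz'₃ := hr₃ z' (hF1 hz'F) (p 1 z' - blockStart n) (by omega) (by omega)
    have hz₅ := hr₅ z hzF (p 1 z - blockStart n) (by omega) (by omega)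
    have hz'₅ := hr₅ z' (hF1 hz'F) (p 1 z' - blockStart n) (by omega) (by omega)
    simp only [Nat.reduceAdd] at hz₃ hz'₃ hz₅ hz'₅
    have g₁ := hgap 1 2 (by omega) (by omega) z' (hF1 hz'F) z hzF (by omega)
    have g₂ := hgap 2 3 (by omega) (by omega) z' (hF2 (hF1 hz'F)) z (hF2 hzF) (by omega)
    have g₃ := hgap 3 4 (by omega) (by omega) z' (hF3 (hF2 (hF1 hz'F))) z (hF3 (hF2 hzF))
      (by omega)
    have g₄ := hgap 4 5 (by omega) (by omega) z' (hF4 (hF3 (hF2 (hF1 hz'F)))) z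
      (hF4 (hF3 (hF2 hzF))) (by omega)
    have hjs₂ := blockStart_succ j₂
    have hjs₄ := blockStart_succ j₄
    have hil := two_le_blockLen (j₂ + 1)
    have hiK : j₂ + 1 < K 2 := blockStart_strictMono.lt_iff_lt.1
      (lt_of_le_of_lt (by omega) (hlt 2 (by omega) z (hF2 hzF)))
    obtain ⟨l, hl, hrl⟩ := restore 2 (by omega) (j₂ + 1) hiK
    have hz₄ := hrl z (hF2 hzF) 0 (by omega) (by omega)
    simp only [Nat.reduceAdd] at hz₄
    obtain rfl : l = j₄ + 1 := blockStart_strictMono.injective (by omega)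
    obtain rfl : j₂ = j₄ := blockLen_pair_injective (by omega) hl.symm
    have m₁ := hmono 2 3 (by omega) (by omega) z' (hF2 (hF1 hz'F))
    have m₂ := hmono 3 4 (by omega) (by omega) z' (hF3 (hF2 (hF1 hz'F)))
    have hns₃ := blockStart_succ n₃
    obtain rfl := block_unique (k := j₂) (l := n₃) (u := p 3 z') (by omega) (by omega) (by omega)
      (by omega)
    omega
  -- so the block consists of at least two blocks of the second configuration
  have hms' := blockStart_succ (m + 1)
  have hml := two_le_blockLen (m + 1)
  have hnm := hnot m hprev
  have h₁ := hnext m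
  have h₂ := hnext (m + 1)
  obtain ⟨b, hbF, hb⟩ := hsurj 0 (by omega) (blockStart k + blockLen m) (by omega)
  have hb₁ := hcont₁ b hbF _ (by omega) hb
  have hb₃ := hcont₃ b hbF _ (by omega) hb
  obtain ⟨n, hn, hrn⟩ := restore 1 (by omega) m (hin m a (hF1 haF) (by omega))
  obtain ⟨n', hn', hrn'⟩ := restore 1 (by omega) (m + 1) (hin (m + 1) b (hF1 hbF) (by omega))
  have ha₃ := hrn a (hF1 haF) 0 (by omega) (by omega)
  have hb₃' := hrn' b (hF1 hbF) 0 (by omega) (by omega)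
  simp only [Nat.reduceAdd] at ha₃ hb₃'
  have hns := blockStart_succ n
  obtain rfl : n' = n + 1 := blockStart_strictMono.injective (by omega)
  obtain rfl : m = n := blockLen_pair_injective hn.symm hn'.symm
  have m₁ := hmono 1 2 (by omega) (by omega) a (hF1 haF)
  have m₂ := hmono 2 3 (by omega) (by omega) a (hF2 (hF1 haF))
  obtain rfl : j₂ = m := blockStart_strictMono.injective (by omega)
  omega

/-! ### Counting predecessors in a copy -/

open Classical in
/-- The number of predecessors of `x` below `N` in the relation that is coded by `β`. -/
noncomputable def cnt (β : Set ℕ) (N x : ℕ) : ℕ := {z ∈ Finset.range N | Nat.pair z x ∈ β}.card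

open Classical in
theorem cnt_congr {β β' : Set ℕ} {N x : ℕ} (h : ∀ z < N, Nat.pair z x ∈ β ↔ Nat.pair z x ∈ β') :
    cnt β N x = cnt β' N x :=
  congrArg Finset.card (Finset.filter_congr fun z hz => h z (Finset.mem_range.1 hz))

theorem copy_iff {B : ℕ → ℕ → Prop} (i : ((· < ·) : ℕ → ℕ → Prop) ≃r B)
    (x y : ℕ) : B x y ↔ i.symm x < i.symm y := i.symm.map_rel_iff.symm

theorem pair_mem_copy_iff {B : ℕ → ℕ → Prop} (i : ((· < ·) : ℕ → ℕ → Prop) ≃r B)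
    (x y : ℕ) : Nat.pair x y ∈ pairSet B ↔ i.symm x < i.symm y := by
  rw [← copy_iff i]
  simp [pairSet]

theorem cnt_le_cnt {B : ℕ → ℕ → Prop} (i : ((· < ·) : ℕ → ℕ → Prop) ≃r B)
    {N x y : ℕ} (h : i.symm x ≤ i.symm y) :
    cnt (pairSet B) N x ≤ cnt (pairSet B) N y := by
  classical
  refine Finset.card_le_card fun z hz => ?_
  rw [Finset.mem_filter, pair_mem_copy_iff i] at hz ⊢
  exact ⟨hz.1, hz.2.trans_le h⟩

theorem cnt_lt_cnt {B : ℕ → ℕ → Prop} (i : ((· < ·) : ℕ → ℕ → Prop) ≃r B)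
    {N x y : ℕ} (hx : x < N) (h : i.symm x < i.symm y) :
    cnt (pairSet B) N x < cnt (pairSet B) N y := by
  classical
  refine Finset.card_lt_card ⟨fun z hz => ?_, fun hsub => ?_⟩
  · rw [Finset.mem_filter, pair_mem_copy_iff i] at hz ⊢
    exact ⟨hz.1, hz.2.trans h⟩
  · have := hsub (Finset.mem_filter.2 ⟨Finset.mem_range.2 hx, (pair_mem_copy_iff i x y).2 h⟩)
    rw [Finset.mem_filter, pair_mem_copy_iff i] at this
    exact lt_irrefl _ this.2

/-- A copy arises from the insertions of its elements in their numerical order. -/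
theorem cnt_eq_pos {B : ℕ → ℕ → Prop} (i : ((· < ·) : ℕ → ℕ → Prop) ≃r B)
    {N x : ℕ} (hx : x < N) :
    cnt (pairSet B) N x = pos (fun s => cnt (pairSet B) s s) N x := by
  classical
  induction N with
  | zero => omega
  | succ s ih =>
    have hsucc : cnt (pairSet B) (s + 1) x =
        cnt (pairSet B) s x + if Nat.pair s x ∈ pairSet B then 1 else 0 := by
      unfold cnt
      rw [Finset.range_add_one, Finset.filter_insert]
      split_ifs with h
      · rw [Finset.card_insert_of_notMem (by simp)]
      · rfl
    rw [hsucc, pos]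
    rcases Nat.lt_succ_iff_lt_or_eq.1 hx with hx | rfl
    · rw [if_neg hx.ne, ← ih hx]
      by_cases h : i.symm s < i.symm x
      · rw [if_pos ((pair_mem_copy_iff i _ _).2 h), if_pos (cnt_le_cnt i h.le)]
      · have hne : i.symm x ≠ i.symm s := fun h => hx.ne (i.symm.injective h)
        have := cnt_lt_cnt i (y := s) hx (by omega)
        rw [if_neg (fun h' => h ((pair_mem_copy_iff i _ _).1 h')), if_neg (by omega)]
        rfl
    · rw [if_pos rfl, if_neg fun h => lt_irrefl _ ((pair_mem_copy_iff i _ _).1 h)]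
      rfl

open Classical in
theorem cnt_self_le (β : Set ℕ) (s : ℕ) : cnt β s s ≤ s :=
  (Finset.card_filter_le _ _).trans (Finset.card_range s).le

theorem cnt_eq {B : ℕ → ℕ → Prop} (i : ((· < ·) : ℕ → ℕ → Prop) ≃r B)
    {N x : ℕ} (h : ∀ p < i.symm x, i p < N) : cnt (pairSet B) N x = i.symm x := by
  classical
  rw [cnt, ← Finset.card_range (i.symm x),
    ← Finset.card_image_of_injective (Finset.range (i.symm x)) i.injective]
  congr 1
  ext z
  rw [Finset.mem_filter, pair_mem_copy_iff i, Finset.mem_image]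
  constructor
  · rintro ⟨-, hz⟩
    exact ⟨i.symm z, Finset.mem_range.2 hz, i.apply_symm_apply z⟩
  · rintro ⟨p, hp, rfl⟩
    have hp := Finset.mem_range.1 hp
    exact ⟨Finset.mem_range.2 (h p hp), by rwa [i.symm_apply_apply]⟩

theorem eventually_lt_of_copy {B : ℕ → ℕ → Prop} (i : ((· < ·) : ℕ → ℕ → Prop) ≃r B)
    (b : ℕ) : ∀ᶠ N in atTop, ∀ p < b, i p < N := by
  have := (Finset.eventually_all (Finset.range b)).2 fun p _ => eventually_gt_atTop (i p)
  exact this.mono fun N h p hp => h p (Finset.mem_range.2 hp)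

/-! ### The spectrum consists of `Δ⁰₂` degrees -/

/-- The certificates for the values of the approximation to the relation on a copy, where `β` is
the order of the copy. The other oracle and the index play no role. -/
def ApproxCert (_ : ℕ) (β _ : Set ℕ) (n z v : ℕ) : Prop :=
  (∀ a < z.unpair.2, Nat.pair a z.unpair.1.unpair.1 < n ∧ Nat.pair a z.unpair.1.unpair.2 < n) ∧
    ((cyc (cnt β z.unpair.2 z.unpair.1.unpair.1) (cnt β z.unpair.2 z.unpair.1.unpair.2) ∧ v = 1) ∨
      (¬ cyc (cnt β z.unpair.2 z.unpair.1.unpair.1) (cnt β z.unpair.2 z.unpair.1.unpair.2) ∧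
        v = 0))

theorem ApproxCert.congr {e n z v : ℕ} {β β' D D' : Set ℕ} (h : Agree n β β')
    (hz : ApproxCert e β D n z v) : ApproxCert e β' D' n z v := by
  refine ⟨hz.1, ?_⟩
  have h₁ := cnt_congr (N := z.unpair.2) (x := z.unpair.1.unpair.1) fun a ha => h _ (hz.1 a ha).1
  have h₂ := cnt_congr (N := z.unpair.2) (x := z.unpair.1.unpair.2) fun a ha => h _ (hz.1 a ha).2
  rw [← h₁, ← h₂]
  exact hz.2

theorem onCone_dgSp_subset : OnCone fun D => dgSp (· < ·) cyc D ⊆ delta02Degrees D := by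
  classical
  refine (onCone_turingReducible_join ApproxCert fun _ _ _ _ _ _ _ _ hβ _ h => h.congr hβ).mono ?_
  rintro D h a ⟨B, i, hB, rfl⟩
  let g : ℕ → ℕ := fun z => if cyc (cnt (pairSet B) z.unpair.2 z.unpair.1.unpair.1)
    (cnt (pairSet B) z.unpair.2 z.unpair.1.unpair.2) then 1 else 0
  have hs : ∀ n z v, ApproxCert 0 (pairSet B) D n z v → v = g z := by
    rintro n z v ⟨-, ⟨h, rfl⟩ | ⟨h, rfl⟩⟩
    · exact (if_pos h).symm
    · exact (if_neg h).symm
  have hg := h 0 (pairSet B) g (fun z => by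
    have key := (Finset.eventually_all (Finset.range z.unpair.2)).2 fun a _ =>
      (eventually_gt_atTop (Nat.pair a z.unpair.1.unpair.1)).and
        (eventually_gt_atTop (Nat.pair a z.unpair.1.unpair.2))
    obtain ⟨n, hn⟩ := key.exists
    refine ⟨n, fun a ha => hn a (Finset.mem_range.2 ha), ?_⟩
    simp only [g]
    split_ifs with h
    · exact Or.inl ⟨h, rfl⟩
    · exact Or.inr ⟨h, rfl⟩) hs
  refine ⟨_, ⟨_, hg.trans (chi_join_turingReducible hB (TuringReducible.refl _)),
    fun s => {z | cyc (cnt (pairSet B) s z.unpair.1) (cnt (pairSet B) s z.unpair.2)},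
    fun x s => ?_, fun x => ?_⟩, rfl⟩
  · simp only [g, Nat.unpair_pair]
    by_cases h : cyc (cnt (pairSet B) s x.unpair.1) (cnt (pairSet B) s x.unpair.2) <;>
      simp [chi, h]
  · filter_upwards [eventually_lt_of_copy i (i.symm x.unpair.1),
      eventually_lt_of_copy i (i.symm x.unpair.2)] with s h₁ h₂
    change cyc _ _ ↔ cyc _ _
    rw [cnt_eq i h₁, cnt_eq i h₂]

/-! ### The spectrum is not uniformly equal to the `Δ⁰₂` degrees -/

/-- The value of the diagonal set after `n` changes: it alternates between `∅` and `{0}`. -/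
def toggleSet (n : ℕ) : Set ℕ := {z | z = 0 ∧ n % 2 = 1}

open Classical in
/-- With oracle `D` and parameters `e`, `e.unpair.1` is a number of a `Δ⁰₂` approximation and the
components of `e.unpair.2` are indices of the functions `f`, `g₁`, `g₂` that are claimed to witness
uniformity. The condition says that these describe a copy whose elements below `d.1` are ordered
such that, on those among them that lie in the first `d.2` blocks, the relation is what `toggleSet n`
computes, and suffices to compute the value of `toggleSet n` at `0`; the elements that were
considered with the previous data `d₀` are still among them. -/
def ToggleCond (e n : ℕ) (d₀ d : ℕ × ℕ) (D : Set ℕ) : Prop :=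
  ∃ m ∈ Phi e.unpair.2.unpair.1 D e.unpair.1,
  ∃ j ∈ Phi e.unpair.2.unpair.2.unpair.1 D e.unpair.1,
  ∃ l ∈ Phi e.unpair.2.unpair.2.unpair.2 D e.unpair.1,
  ∃ β : Set ℕ, blockStart d.2 ≤ d.1 ∧
    (∀ x < d.1, ∀ y < d.1,
      (if Nat.pair x y ∈ β then 1 else 0) ∈ Phi m D (Nat.pair x y)) ∧
    (d₀.1 ≤ d.1 ∧ ∀ x < d₀.1, cnt β d₀.1 x < blockStart d₀.2 → cnt β d.1 x < blockStart d.2) ∧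
    (∀ x < d.1, ∀ y < d.1, cnt β d.1 x < blockStart d.2 → cnt β d.1 y < blockStart d.2 →
      (if cyc (cnt β d.1 x) (cnt β d.1 y) then 1 else 0) ∈
        Phi j (join (toggleSet n) D) (Nat.pair x y)) ∧
    ∀ Y : Set ℕ, (∀ x < d.1, ∀ y < d.1, cnt β d.1 x < blockStart d.2 →
      cnt β d.1 y < blockStart d.2 → (Nat.pair x y ∈ Y ↔ cyc (cnt β d.1 x) (cnt β d.1 y))) →
      n % 2 ∈ Phi l (join Y D) 0

/-- The bits of `D` below `s` guarantee the condition. -/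
def ToggleReady (e : ℕ) (D : Set ℕ) (s n : ℕ) (d₀ d : ℕ × ℕ) : Prop :=
  ∀ D', Agree s D D' → ToggleCond e n d₀ d D'

open Classical in
/-- One step of the diagonalization: if fewer than six changes have been made and some data are a
reason for the next one, then it is made and the data are recorded. -/
noncomputable def toggleStep (R : ℕ → ℕ × ℕ → ℕ × ℕ → Prop) (S : ℕ × (ℕ → ℕ × ℕ)) :
    ℕ × (ℕ → ℕ × ℕ) :=
  if h : S.1 < 6 ∧ ∃ d, R S.1 (S.2 S.1) d then
    (S.1 + 1, Function.update S.2 (S.1 + 1) h.2.choose)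
  else S

/-- The state of the diagonalization at stage `s`: the number `n` of changes of the diagonal set
and, at arguments `1, …, n`, the data that were the reason for them. -/
noncomputable def toggle (e : ℕ) (D : Set ℕ) : ℕ → ℕ × (ℕ → ℕ × ℕ)
  | 0 => (0, fun _ => (0, 0))
  | s + 1 => toggleStep (ToggleReady e D s) (toggle e D s)

theorem ToggleReady.congr {e s n : ℕ} {D D' : Set ℕ} {d₀ d : ℕ × ℕ} (h : Agree s D D')
    (hd : ToggleReady e D s n d₀ d) : ToggleReady e D' s n d₀ d :=
  fun E hE => hd E (h.trans hE)

theorem toggle_congr {e s : ℕ} {D D' : Set ℕ} (h : Agree s D D') :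
    toggle e D s = toggle e D' s := by
  induction s with
  | zero => rfl
  | succ s ih =>
    have ih := ih (h.mono s.le_succ)
    have hr : ToggleReady e D s = ToggleReady e D' s := by
      funext n d₀ d
      exact propext ⟨ToggleReady.congr (h.mono s.le_succ),
        ToggleReady.congr (h.mono s.le_succ).symm⟩
    rw [toggle, toggle, ih, hr]

theorem toggle_fst_mono (e : ℕ) (D : Set ℕ) : Monotone fun s => (toggle e D s).1 := by
  refine monotone_nat_of_le_succ fun s => ?_
  rw [toggle, toggleStep]
  split_ifs
  · exact Nat.le_succ _
  · exact le_rfl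

theorem toggle_fst_le (e : ℕ) (D : Set ℕ) (s : ℕ) : (toggle e D s).1 ≤ 6 := by
  induction s with
  | zero => exact Nat.zero_le _
  | succ s ih =>
    rw [toggle, toggleStep]
    split_ifs with h
    · exact h.1
    · exact ih

theorem toggle_eq_of_fst_eq {e : ℕ} {D : Set ℕ} {s : ℕ}
    (h : (toggle e D (s + 1)).1 = (toggle e D s).1) : toggle e D (s + 1) = toggle e D s := by
  rw [toggle, toggleStep] at h ⊢
  split_ifs at h ⊢ with h'
  · exact absurd h (Nat.succ_ne_self _)
  · rfl

theorem toggle_cond (e : ℕ) (D : Set ℕ) (s : ℕ) : ∀ t < (toggle e D s).1,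
    ToggleCond e t ((toggle e D s).2 t) ((toggle e D s).2 (t + 1)) D := by
  induction s with
  | zero => exact fun t ht => absurd ht (Nat.not_lt_zero t)
  | succ s ih =>
    rw [toggle, toggleStep]
    split_ifs with h
    · intro t ht
      dsimp only at ht ⊢
      rw [Function.update_of_ne (by omega)]
      rcases Nat.lt_succ_iff_lt_or_eq.1 ht with ht | rfl
      · rw [Function.update_of_ne (by omega)]
        exact ih t ht
      · rw [Function.update_self]
        exact h.2.choose_spec D (Agree.refl s D)
    · exact ih

theorem toggle_stable (e : ℕ) (D : Set ℕ) :
    ∃ n δ, ∀ᶠ s in atTop, toggle e D s = (n, δ) := by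
  obtain ⟨n, hn⟩ : ∃ n, ∀ᶠ s in atTop, (toggle e D s).1 = n := by
    have hfin : (Set.range fun s => (toggle e D s).1).Finite :=
      (Set.finite_Iic 6).subset (by rintro _ ⟨s, rfl⟩; exact toggle_fst_le e D s)
    obtain ⟨s, hs⟩ : ∃ s, ∀ t, (toggle e D t).1 ≤ (toggle e D s).1 := by
      obtain ⟨_, ⟨s, rfl⟩, h⟩ := hfin.exists_maximal (Set.range_nonempty _)
      refine ⟨s, fun t => ?_⟩
      rcases le_total (toggle e D t).1 (toggle e D s).1 with h' | h'
      · exact h'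
      · exact h ⟨t, rfl⟩ h'
    exact ⟨_, eventually_atTop.2 ⟨s, fun t ht => le_antisymm (hs t) (toggle_fst_mono e D ht)⟩⟩
  obtain ⟨s, hs⟩ := eventually_atTop.1 hn
  refine ⟨n, (toggle e D s).2, eventually_atTop.2 ⟨s, fun t ht => ?_⟩⟩
  induction t, ht using Nat.le_induction with
  | base => exact Prod.ext (hs s le_rfl) rfl
  | succ t ht ih => rw [toggle_eq_of_fst_eq (by rw [hs t ht, hs (t + 1) (by omega)]), ih]

theorem eventually_mem_Phi {e x y : ℕ} {D : Set ℕ} (h : y ∈ Phi e D x) :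
    ∀ᶠ s in atTop, ∀ D', Agree s D D' → y ∈ Phi e D' x := by
  obtain ⟨u, hu⟩ := Phi_exists_use h
  filter_upwards [eventually_ge_atTop u] with s hs D' hD' using hu D' (hD'.mono hs)

theorem eventually_mem_Phi_join {e x y : ℕ} {C D : Set ℕ} (h : y ∈ Phi e (join C D) x) :
    ∀ᶠ s in atTop, ∀ D', Agree s D D' → y ∈ Phi e (join C D') x := by
  obtain ⟨u, hu⟩ := Phi_exists_use h
  filter_upwards [eventually_ge_atTop u] with s hs D' hD'
  exact hu _ ((Agree.refl u C).join (hD'.mono hs))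

theorem chi_eq_some_iff {A : Set ℕ} {x : ℕ} {p : Prop} [Decidable p] :
    (if p then 1 else 0) ∈ chi A x ↔ (p ↔ x ∈ A) := by
  simp only [chi, Part.mem_some_iff]
  by_cases h₁ : p <;> by_cases h₂ : x ∈ A <;> simp [h₁, h₂]

/-- As long as the diagonal set is computed correctly, its next change happens eventually. -/
theorem eventually_toggleReady {e n m j l : ℕ} {D : Set ℕ} (d₀ : ℕ × ℕ)
    {B : ℕ → ℕ → Prop} (i : ((· < ·) : ℕ → ℕ → Prop) ≃r B)
    (hm : m ∈ Phi e.unpair.2.unpair.1 D e.unpair.1)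
    (hj : j ∈ Phi e.unpair.2.unpair.2.unpair.1 D e.unpair.1)
    (hl : l ∈ Phi e.unpair.2.unpair.2.unpair.2 D e.unpair.1)
    (hB : Phi m D = chi (pairSet B))
    (hR : Phi j (join (toggleSet n) D) = chi (pairSet (transfer i cyc)))
    (hC : Phi l (join (pairSet (transfer i cyc)) D) = chi (toggleSet n)) :
    ∃ d, ∀ᶠ s in atTop, ToggleReady e D s n d₀ d := by
  classical
  have hl₀ : n % 2 ∈ Phi l (join (pairSet (transfer i cyc)) D) 0 := by
    rw [hC]
    rcases Nat.mod_two_eq_zero_or_one n with h | h <;> simp [chi, toggleSet, h]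
  obtain ⟨u, hu⟩ := Phi_exists_use hl₀
  -- the first `k` blocks contain all elements that matter for the computation, or did before
  obtain ⟨k, hk⟩ : ∃ k, ∀ x < max u d₀.1, i.symm x < blockStart k := by
    have := (Finset.eventually_all (Finset.range (max u d₀.1))).2 fun x _ =>
      eventually_gt_atTop (i.symm x)
    obtain ⟨k, hk⟩ := this.exists
    exact ⟨k, fun x hx => (hk x (Finset.mem_range.2 hx)).trans_le (le_blockStart k)⟩
  obtain ⟨N, hN, hN₁, hN₂⟩ := ((eventually_lt_of_copy i (blockStart k)).and
    ((eventually_ge_atTop (blockStart k)).and (eventually_ge_atTop d₀.1))).exists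
  have hcnt : ∀ x, i.symm x < blockStart k → cnt (pairSet B) N x = i.symm x := fun x hx =>
    cnt_eq i fun p hp => hN p (hp.trans hx)
  have hcnt' : ∀ x, cnt (pairSet B) N x < blockStart k → i.symm x < blockStart k := by
    intro x hx
    by_contra h
    have h₁ := hcnt (i (cnt (pairSet B) N x)) (by rwa [i.symm_apply_apply])
    rw [i.symm_apply_apply] at h₁
    have h₂ := cnt_lt_cnt i (N := N) (x := i (cnt (pairSet B) N x)) (y := x) (hN _ hx)
      (by rw [i.symm_apply_apply]; omega)
    omega
  have hcnteq : ∀ x, cnt (pairSet B) N x < blockStart k → cnt (pairSet B) N x = i.symm x :=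
    fun x hx => hcnt x (hcnt' x hx)
  have e₁ : ∀ᶠ s in atTop, ∀ z ∈ Finset.range N ×ˢ Finset.range N, ∀ D', Agree s D D' →
      (if Nat.pair z.1 z.2 ∈ pairSet B then 1 else 0) ∈ Phi m D' (Nat.pair z.1 z.2) :=
    (Finset.eventually_all _).2 fun z _ => eventually_mem_Phi (by rw [hB, chi_eq_some_iff])
  have e₂ : ∀ᶠ s in atTop, ∀ z ∈ Finset.range N ×ˢ Finset.range N,
      cnt (pairSet B) N z.1 < blockStart k → cnt (pairSet B) N z.2 < blockStart k →
      ∀ D', Agree s D D' →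
      (if cyc (cnt (pairSet B) N z.1) (cnt (pairSet B) N z.2) then 1 else 0) ∈
        Phi j (join (toggleSet n) D') (Nat.pair z.1 z.2) := by
    refine (Finset.eventually_all _).2 fun z _ => ?_
    by_cases h : cnt (pairSet B) N z.1 < blockStart k ∧ cnt (pairSet B) N z.2 < blockStart k
    · refine (eventually_mem_Phi_join ?_).mono fun s hs _ _ => hs
      rw [hR, chi_eq_some_iff, hcnteq _ h.1, hcnteq _ h.2]
      simp [pairSet, transfer]
    · exact Eventually.of_forall fun s h₁ h₂ => absurd ⟨h₁, h₂⟩ h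
  refine ⟨(N, k), ?_⟩
  filter_upwards [eventually_mem_Phi hm, eventually_mem_Phi hj, eventually_mem_Phi hl, e₁, e₂,
    eventually_ge_atTop u] with s h₁ h₂ h₃ h₄ h₅ h₆ D' hD'
  refine ⟨m, h₁ D' hD', j, h₂ D' hD', l, h₃ D' hD', pairSet B, hN₁, fun x hx y hy =>
    h₄ (x, y) (by simp [hx, hy]) D' hD', ⟨hN₂, fun x hx _ => ?_⟩,
    fun x hx y hy hx' hy' => h₅ (x, y) (by simp [hx, hy]) hx' hy' D' hD', fun Y hY => ?_⟩
  · have := hk x (lt_max_of_lt_right hx)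
    exact (hcnt x this).trans_lt this
  · refine hu _ (Agree.join (fun z hz => ?_) (hD'.mono h₆))
    have hz₁ := hk z.unpair.1 (lt_max_of_lt_left ((Nat.unpair_left_le z).trans_lt hz))
    have hz₂ := hk z.unpair.2 (lt_max_of_lt_left ((Nat.unpair_right_le z).trans_lt hz))
    have hlt : ∀ x, i.symm x < blockStart k → x < N := fun x hx => by
      simpa using hN _ hx
    have := hY _ (hlt _ hz₁) _ (hlt _ hz₂) (by rwa [hcnt _ hz₁]) (by rwa [hcnt _ hz₂])
    rw [Nat.pair_unpair, hcnt _ hz₁, hcnt _ hz₂] at this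
    rw [this]
    exact Iff.rfl

/-- The diagonal set cannot change six times, since the relation cannot alternate. -/
theorem not_toggleCond_six {e : ℕ} {D : Set ℕ} {δ : ℕ → ℕ × ℕ} {m : ℕ}
    {B : ℕ → ℕ → Prop} (i : ((· < ·) : ℕ → ℕ → Prop) ≃r B)
    (hm : m ∈ Phi e.unpair.2.unpair.1 D e.unpair.1) (hB : Phi m D = chi (pairSet B))
    (hδ : ∀ t < 6, ToggleCond e t (δ t) (δ (t + 1)) D) : False := by
  classical
  obtain ⟨j, hj⟩ : ∃ j, j ∈ Phi e.unpair.2.unpair.2.unpair.1 D e.unpair.1 := by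
    obtain ⟨_, _, j, hj, _⟩ := hδ 0 (by omega)
    exact ⟨j, hj⟩
  obtain ⟨l, hl⟩ : ∃ l, l ∈ Phi e.unpair.2.unpair.2.unpair.2 D e.unpair.1 := by
    obtain ⟨_, _, _, _, l, hl, _⟩ := hδ 0 (by omega)
    exact ⟨l, hl⟩
  let K : ℕ → ℕ := fun t => (δ (t + 1)).2
  let N : ℕ → ℕ := fun t => (δ (t + 1)).1
  let p : ℕ → ℕ → ℕ := fun t x => cnt (pairSet B) (N t) x
  let F : ℕ → Set ℕ := fun t => {x | x < N t ∧ p t x < blockStart (K t)}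
  have key : ∀ t < 6, blockStart (K t) ≤ N t ∧
      ((δ t).1 ≤ N t ∧ ∀ x < (δ t).1, cnt (pairSet B) (δ t).1 x < blockStart (δ t).2 →
        p t x < blockStart (K t)) ∧
      (∀ x ∈ F t, ∀ y ∈ F t, (if cyc (p t x) (p t y) then 1 else 0) ∈
        Phi j (join (toggleSet t) D) (Nat.pair x y)) ∧
      ∀ Y : Set ℕ, (∀ x ∈ F t, ∀ y ∈ F t, (Nat.pair x y ∈ Y ↔ cyc (p t x) (p t y))) →
        t % 2 ∈ Phi l (join Y D) 0 := by
    intro t ht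
    obtain ⟨m', hm', j', hj', l', hl', β, h₁, h₂, h₃, h₄, h₅⟩ := hδ t ht
    obtain rfl := Part.mem_unique hm hm'
    obtain rfl := Part.mem_unique hj hj'
    obtain rfl := Part.mem_unique hl hl'
    have hβ : ∀ M ≤ N t, ∀ x < N t, cnt β M x = cnt (pairSet B) M x := fun M hM x hx =>
      cnt_congr fun z hz => by
        have := h₂ z (hz.trans_le hM) x hx
        rwa [hB, chi_eq_some_iff] at this
    refine ⟨h₁, ⟨h₃.1, fun x hx hx' => ?_⟩, fun x hx y hy => ?_, fun Y hY => h₅ Y ?_⟩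
    · have hxN : x < N t := hx.trans_le h₃.1
      have := h₃.2 x hx
      rw [hβ _ h₃.1 x hxN] at this
      have h := this hx'
      rw [hβ (δ (t + 1)).1 le_rfl x hxN] at h
      exact h
    · have := h₄ x hx.1 y hy.1
      simp only [N] at hβ
      rw [hβ _ le_rfl x hx.1, hβ _ le_rfl y hy.1] at this
      exact this hx.2 hy.2
    · intro x hx y hy hpx hpy
      simp only [N] at hβ
      rw [hβ _ le_rfl x hx] at hpx ⊢
      rw [hβ _ le_rfl y hy] at hpy ⊢
      exact hY x ⟨hx, hpx⟩ y ⟨hy, hpy⟩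
  have hN : ∀ s t, s ≤ t → t ≤ 5 → N s ≤ N t := by
    intro s t hst
    induction t, hst using Nat.le_induction with
    | base => exact fun _ => le_rfl
    | succ t _ ih => exact fun ht => (ih (by omega)).trans (key (t + 1) (by omega)).2.1.1
  let q : ℕ → ℕ := fun s => cnt (pairSet B) s s
  have hq : ∀ s, q s ≤ s := fun s => cnt_self_le _ s
  have hp : ∀ t, ∀ x < N t, p t x = pos q (N t) x := fun t x hx => cnt_eq_pos i hx
  have hsub : ∀ t < 5, F t ⊆ F (t + 1) := fun t ht x hx =>
    ⟨hx.1.trans_le (hN t (t + 1) (by omega) (by omega)),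
      (key (t + 1) (by omega)).2.1.2 x hx.1 hx.2⟩
  have hR : ∀ t, t + 2 ≤ 5 → ∀ x ∈ F t, ∀ y ∈ F t,
      (cyc (p (t + 2) x) (p (t + 2) y) ↔ cyc (p t x) (p t y)) := by
    intro t ht x hx y hy
    have h₁ := (key t (by omega)).2.2.1 x hx y hy
    have h₂ := (key (t + 2) (by omega)).2.2.1 x (hsub _ (by omega) (hsub _ (by omega) hx)) y
      (hsub _ (by omega) (hsub _ (by omega) hy))
    have : toggleSet (t + 2) = toggleSet t := by simp [toggleSet]
    rw [this] at h₂
    have := Part.mem_unique h₂ h₁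
    split_ifs at this <;> simp_all
  have halt := cyc_iff_of_alternating (F := F) (K := K) (p := p) (fun t _ x hx => hx.2)
    (fun t ht n hn => by
      obtain ⟨x, hx, hpx⟩ := exists_pos_eq hq (hn.trans_le (key t (by omega)).1)
      rw [← hp t x hx] at hpx
      exact ⟨x, ⟨hx, hpx ▸ hn⟩, hpx⟩) hsub
    (fun s t hst ht x hx y hy h => by
      have h' := hN s t hst ht
      rw [hp s x hx.1, hp s y hy.1, hp t x (hx.1.trans_le h'), hp t y (hy.1.trans_le h')]
      rw [hp s x hx.1, hp s y hy.1] at h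
      exact pos_add_le hx.1 hy.1 h' h)
    (fun s t hst ht x hx => by
      have h' := hN s t hst ht
      rw [hp s x hx.1, hp t x (hx.1.trans_le h')]
      exact pos_le_pos hx.1 h') hR
  -- so an oracle with the second relation gives the first value of the diagonal set
  let Y : Set ℕ := {z | cyc (p 1 z.unpair.1) (p 1 z.unpair.2)}
  have h₀ := (key 0 (by omega)).2.2.2 Y fun x hx y hy => by
    simpa [Y] using halt x hx y hy
  have h₁ := (key 1 (by omega)).2.2.2 Y fun x hx y hy => by simp [Y]
  exact absurd (Part.mem_unique h₀ h₁) (by norm_num)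

theorem onCone_not_uniformlyDelta02 : OnCone fun D => ¬ UniformlyDelta02 (· < ·) cyc D := by
  classical
  have hG := onCone_turingReducible (fun c D z =>
    if z.unpair.2.unpair.1 ∈ toggleSet
      (toggle (Nat.pair z.unpair.1 c) D z.unpair.2.unpair.2).1 then 1 else 0)
    (fun _ z => z.unpair.2.unpair.2) fun c z D D' h => by
      rw [toggle_congr h]
  refine (hG.and onCone_exists_fixed_index).mono ?_
  rintro D ⟨hG, hfix⟩ ⟨f, g₁, g₂, hf, hg₁, hg₂, huni⟩
  obtain ⟨a, rfl⟩ := exists_Phi_eq hf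
  obtain ⟨b, rfl⟩ := exists_Phi_eq hg₁
  obtain ⟨c, rfl⟩ := exists_Phi_eq hg₂
  obtain ⟨e₀, he₀⟩ := hfix _ (hG (Nat.pair a (Nat.pair b c)))
  set e := Nat.pair e₀ (Nat.pair a (Nat.pair b c)) with he
  obtain ⟨n, δ, hs⟩ := toggle_stable e D
  have hindex : IsDelta02Index D e₀ (toggleSet n) := by
    refine ⟨fun s => toggleSet (toggle e D s).1, fun x s => ?_, fun x => ?_⟩
    · rw [he₀]
      simp only [Nat.unpair_pair, chi]
      exact congrArg Part.some (if_congr Iff.rfl rfl rfl)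
    · filter_upwards [hs] with s h
      rw [h]
  obtain ⟨m, hm, j, hj, l, hl, B, i, hB, hR, hC⟩ := huni e₀ _ hindex
  rw [show a = e.unpair.2.unpair.1 by simp [he], show e₀ = e.unpair.1 by simp [he]] at hm
  rw [show b = e.unpair.2.unpair.2.unpair.1 by simp [he], show e₀ = e.unpair.1 by simp [he]] at hj
  rw [show c = e.unpair.2.unpair.2.unpair.2 by simp [he], show e₀ = e.unpair.1 by simp [he]] at hl
  obtain ⟨s, hsn⟩ := hs.exists
  have hn := toggle_fst_le e D s
  have hcond := toggle_cond e D s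
  rw [hsn] at hn hcond
  rcases hn.lt_or_eq with hn | rfl
  · obtain ⟨d, hd⟩ := eventually_toggleReady (δ n) i hm hj hl hB hR hC
    obtain ⟨t, h₁, h₂, h₃⟩ := (hd.and (hs.and ((tendsto_add_atTop_nat 1).eventually hs))).exists
    rw [toggle, h₂, toggleStep, dif_pos ⟨hn, d, h₁⟩] at h₃
    exact absurd (congrArg Prod.fst h₃) (Nat.succ_ne_self n)
  · exact not_toggleCond_six i hm hB hcond

/-! ### Finite injury -/

/-- Starting at stage `s`, the list `l` of insertions respects the bound `κ`, and never inserts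
beyond the last element. -/
def ValidPlan (κ : ℕ) : ℕ → List ℕ → Prop
  | _, [] => True
  | s, p :: l => κ ≤ p ∧ p ≤ s ∧ ValidPlan κ (s + 1) l

/-- The list `l` of insertions is what happens from stage `s` on. -/
def Follows (q : ℕ → ℕ) : ℕ → List ℕ → Prop
  | _, [] => True
  | s, p :: l => q s = p ∧ Follows q (s + 1) l

/-- What happens at a stage of a priority construction: the position `q` of the new element, the
requirement `r` that is responsible for it, the insertions `plan` which this requirement has still
to make in the following stages, and the phase in which each requirement is afterwards. -/
structure Stage (P : Type) where
  q : ℕ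
  r : ℕ
  plan : List ℕ
  phase : ℕ → P

section

variable {P : Type} [Inhabited P]

instance : Inhabited (Stage P) := ⟨⟨0, 0, [], fun _ => default⟩⟩

/-- The situation before stage `s`. -/
def before (A : ℕ → Stage P) : ℕ → Stage P
  | 0 => default
  | s + 1 => A s

/-- The rules of a priority construction. Here `Act s q κ n φ φ' l` says that at stage `s`, with
earlier insertions `q` and restraint `κ`, requirement `n` can go from phase `φ` to phase `φ'` and
make the insertions `l`. Begun lists of insertions are completed; then the requirement
of highest priority that can act does so and resets those of lower priority. If there is none, then
an element is added at the end; this counts as an action of requirement `s`. -/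
def IsStep (Act : ℕ → (ℕ → ℕ) → ℕ → ℕ → P → P → List ℕ → Prop) (s : ℕ) (A : ℕ → Stage P)
    (a : Stage P) : Prop :=
  let b := before A s
  let can := fun m => Act s (fun t => (A t).q) (level (fun t => (A t).r) m s) m (b.phase m)
  (b.plan = a.q :: a.plan ∧ a.r = b.r ∧
    ∀ m, (a.r < m → a.phase m = default) ∧ (m ≤ a.r → a.phase m = b.phase m)) ∨
  (b.plan = [] ∧ can a.r (a.phase a.r) (a.q :: a.plan) ∧
    ∀ m, (a.r < m → a.phase m = default) ∧
      (m < a.r → a.phase m = b.phase m ∧ ∀ φ l, ¬ can m φ l)) ∨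
  (b.plan = [] ∧ (∀ m φ l, ¬ can m φ l) ∧ a.q = s ∧ a.r = s ∧ a.plan = [] ∧
    ∀ m, (a.r < m → a.phase m = default) ∧ (m ≤ a.r → a.phase m = b.phase m))

open Classical in
theorem exists_isStep (Act : ℕ → (ℕ → ℕ) → ℕ → ℕ → P → P → List ℕ → Prop)
    (hne : ∀ s q κ n φ φ', ¬ Act s q κ n φ φ' []) (s : ℕ) (A : ℕ → Stage P) :
    ∃ a, IsStep Act s A a := by
  rcases hplan : (before A s).plan with _ | ⟨p, l⟩
  · by_cases h : ∃ m φ l, Act s (fun t => (A t).q) (level (fun t => (A t).r) m s) m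
      ((before A s).phase m) φ l
    · obtain ⟨φ, l, hl⟩ := Nat.find_spec h
      rcases l with _ | ⟨p, l⟩
      · exact absurd hl (hne _ _ _ _ _ _)
      · refine ⟨⟨p, Nat.find h, l, fun m => if Nat.find h < m then default else
          if m = Nat.find h then φ else (before A s).phase m⟩, Or.inr (Or.inl ⟨hplan, ?_, fun m =>
            ⟨fun hm => if_pos hm, fun hm => ⟨?_, fun φ l h' => Nat.find_min h hm ⟨φ, l, h'⟩⟩⟩⟩)⟩
        · simpa using hl
        · exact (if_neg (lt_asymm hm)).trans (if_neg hm.ne)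
    · push Not at h
      exact ⟨⟨s, s, [], fun m => if s < m then default else (before A s).phase m⟩,
        Or.inr (Or.inr ⟨hplan, h, rfl, rfl, rfl, fun m =>
          ⟨fun hm => if_pos hm, fun hm => if_neg (not_lt.2 hm)⟩⟩)⟩
  · exact ⟨⟨p, (before A s).r, l, fun m => if (before A s).r < m then default else
      (before A s).phase m⟩, Or.inl ⟨hplan, rfl, fun m =>
        ⟨fun hm => if_pos hm, fun hm => if_neg (not_lt.2 hm)⟩⟩⟩

/-- The priority construction with given possible actions. -/
noncomputable def priority (Act : ℕ → (ℕ → ℕ) → ℕ → ℕ → P → P → List ℕ → Prop) :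
    ℕ → Stage P :=
  histRec fun s A => Classical.epsilon (IsStep Act s A)

theorem before_congr {A A' : ℕ → Stage P} {s : ℕ} (h : ∀ t < s, A t = A' t) :
    before A s = before A' s := by
  cases s with
  | zero => rfl
  | succ s => exact h s (Nat.lt_succ_self s)

theorem isStep_priority {Act : ℕ → (ℕ → ℕ) → ℕ → ℕ → P → P → List ℕ → Prop}
    (hne : ∀ s q κ n φ φ', ¬ Act s q κ n φ φ' [])
    (hcongr : ∀ s q q', (∀ t < s, q t = q' t) → Act s q = Act s q') (s : ℕ) :
    IsStep Act s (priority Act) (priority Act s) := by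
  have : priority Act s = Classical.epsilon (IsStep Act s (priority Act)) := by
    refine histRec_eq (fun s f g h => ?_) s
    have h₁ : IsStep Act s f = IsStep Act s g := by
      unfold IsStep
      rw [before_congr h, hcongr s _ (fun t => (g t).q) fun t ht => by rw [h t ht]]
      simp only [level_congr (r := fun t => (f t).r) (r' := fun t => (g t).r)
        fun t ht => by rw [h t ht]]
    rw [h₁]
  rw [this]
  exact Classical.epsilon_spec (exists_isStep Act hne s _)

theorem priority_congr {Act Act' : ℕ → (ℕ → ℕ) → ℕ → ℕ → P → P → List ℕ → Prop} {s : ℕ}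
    (h : ∀ t ≤ s, Act t = Act' t) : priority Act s = priority Act' s := by
  refine histRec_congr (fun t ht f => ?_) le_rfl
  unfold IsStep
  rw [h t ht]

/-- Requirement `n`, with restraint `κ`, has arrived in phase `φ`, and its actions are completed
before stage `t`. Between its actions, no elements are inserted among those that were present after
the last one. -/
inductive Run (Act : ℕ → (ℕ → ℕ) → ℕ → ℕ → P → P → List ℕ → Prop) (q : ℕ → ℕ) (κ n : ℕ) :
    ℕ → P → Prop
  | start (t : ℕ) : Run Act q κ n t default
  | act {t s : ℕ} {φ φ' : P} {l : List ℕ} : Run Act q κ n t φ → t ≤ s →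
      (∀ u, t ≤ u → u < s → t ≤ q u) → Act s q κ n φ φ' l → Follows q s l →
      Run Act q κ n (s + l.length) φ'

variable {Act : ℕ → (ℕ → ℕ) → ℕ → ℕ → P → P → List ℕ → Prop} {A : ℕ → Stage P}

theorem IsStep.follows (hA : ∀ s, IsStep Act s A (A s)) {l : List ℕ} {s : ℕ}
    (h : (before A s).plan = l) :
    Follows (fun t => (A t).q) s l ∧ (before A (s + l.length)).plan = [] ∧
      (before A (s + l.length)).r = (before A s).r ∧
      ∀ m ≤ (before A s).r, (before A (s + l.length)).phase m = (before A s).phase m := by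
  induction l generalizing s with
  | nil => exact ⟨trivial, h, rfl, fun _ _ => rfl⟩
  | cons p l ih =>
    rcases hA s with ⟨h₁, h₂, h₃⟩ | ⟨h₁, -⟩ | ⟨h₁, -⟩
    · rw [h, List.cons.injEq] at h₁
      obtain ⟨i₁, i₂, i₃, i₄⟩ := ih (s := s + 1) h₁.2.symm
      rw [List.length_cons, show s + (l.length + 1) = s + 1 + l.length by omega]
      refine ⟨⟨h₁.1.symm, i₁⟩, i₂, i₃.trans h₂, fun m hm => ?_⟩
      have hm' : m ≤ (A s).r := by rw [h₂]; exact hm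
      exact (i₄ m hm').trans ((h₃ m).2 hm')
    · simp [h] at h₁
    · simp [h] at h₁

theorem IsStep.frequently (hA : ∀ s, IsStep Act s A (A s)) :
    ∃ᶠ s in atTop, (before A s).plan = [] :=
  frequently_atTop.2 fun _ => ⟨_, Nat.le_add_right _ _, (IsStep.follows hA rfl).2.1⟩

theorem IsStep.validPlan (hA : ∀ s, IsStep Act s A (A s))
    (hv : ∀ s q κ n φ φ' l, Act s q κ n φ φ' l → ValidPlan κ s l) (s : ℕ) :
    ValidPlan (level (fun t => (A t).r) (before A s).r s) s (before A s).plan := by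
  induction s with
  | zero => trivial
  | succ s ih =>
    have hlev : level (fun t => (A t).r) (A s).r (s + 1) = level (fun t => (A t).r) (A s).r s :=
      level_eq (Nat.le_succ s) fun u h₁ h₂ => by
        obtain rfl : u = s := by omega
        exact le_rfl
    change ValidPlan (level _ (A s).r (s + 1)) (s + 1) (A s).plan
    rw [hlev]
    rcases hA s with ⟨h₁, h₂, -⟩ | ⟨-, h₂, -⟩ | ⟨-, -, -, -, h₂, -⟩
    · rw [h₁, ← h₂] at ih
      exact ih.2.2
    · exact (hv _ _ _ _ _ _ _ h₂).2.2
    · rw [h₂]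
      trivial

theorem IsStep.bounds (hA : ∀ s, IsStep Act s A (A s))
    (hv : ∀ s q κ n φ φ' l, Act s q κ n φ φ' l → ValidPlan κ s l) (s : ℕ) :
    (A s).q ≤ s ∧ (A s).r ≤ (A s).q ∧ ∀ t < s, (A t).r < (A s).r → t + 1 ≤ (A s).q := by
  have key : ∀ {κ}, κ = level (fun t => (A t).r) (A s).r s → κ ≤ (A s).q →
      (A s).r ≤ (A s).q ∧ ∀ t < s, (A t).r < (A s).r → t + 1 ≤ (A s).q := by
    rintro κ rfl h
    exact ⟨(le_level _ _ _).trans h, fun t ht h' => (succ_le_level ht h').trans h⟩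
  rcases hA s with ⟨h₁, h₂, -⟩ | ⟨-, h₂, -⟩ | ⟨-, -, h₁, h₂, -⟩
  · have h := IsStep.validPlan hA hv s
    rw [h₁, ← h₂] at h
    exact ⟨h.2.1, key rfl h.1⟩
  · have h := hv _ _ _ _ _ _ _ h₂
    exact ⟨h.2.1, key rfl h.1⟩
  · rw [h₁, h₂]
    exact ⟨le_rfl, le_rfl, fun t ht _ => ht⟩

/-- As long as the phase of requirement `n` does not change, nobody of lower priority disturbs it,
and it does not act itself, except that it may count as the one that adds the element `n`. -/
theorem IsStep.quiet (hA : ∀ s, IsStep Act s A (A s))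
    (hv : ∀ s q κ n φ φ' l, Act s q κ n φ φ' l → ValidPlan κ s l)
    (hρ : ∀ s q κ n φ l, ¬ Act s q κ n φ φ l) {n t s : ℕ} {φ : P}
    (hn : ∀ u ≥ t, n ≤ (A u).r) (hplan : (before A t).plan = [])
    (hlast : t = 0 ∨ (before A t).r ≤ n)
    (hφ : ∀ u, t ≤ u → u ≤ s → (before A u).phase n = φ) {u : ℕ} (htu : t ≤ u) (hus : u < s) :
    t ≤ (A u).q ∧ ((A u).r = n → u = n) := by
  have key : ∀ u, t ≤ u → u < s → (A u).r = n → (A u).q = u ∧ (A u).plan = [] ∧ u = n := by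
    intro u htu
    induction u, htu using Nat.le_induction with
    | base =>
      intro hs hr
      rcases hA t with ⟨h₁, -⟩ | ⟨-, h₂, -⟩ | ⟨-, -, h₁, h₂, h₃, -⟩
      · simp [hplan] at h₁
      · rw [hr] at h₂
        have e₁ := hφ t le_rfl hs.le
        have e₂ : (A t).phase n = φ := hφ (t + 1) (by omega) hs
        rw [e₁, e₂] at h₂
        exact absurd h₂ (hρ _ _ _ _ _ _)
      · exact ⟨h₁, h₃, by omega⟩
    | succ u htu ih =>
      intro hs hr
      rcases hA (u + 1) with ⟨h₁, h₂, -⟩ | ⟨-, h₂, -⟩ | ⟨-, -, h₁, h₂, h₃, -⟩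
      · have := (ih (by omega) (h₂.symm.trans hr)).2.1
        simp [before, this] at h₁
      · rw [hr] at h₂
        have e₁ := hφ (u + 1) (by omega) hs.le
        have e₂ : (A (u + 1)).phase n = φ := hφ (u + 1 + 1) (by omega) hs
        rw [e₁, e₂] at h₂
        exact absurd h₂ (hρ _ _ _ _ _ _)
      · exact ⟨h₁, h₃, by omega⟩
  refine ⟨?_, fun h => (key u htu hus h).2.2⟩
  rcases (hn u htu).eq_or_lt with h | h
  · rw [(key u htu hus h.symm).1]
    exact htu
  · rcases hlast with rfl | hlast
    · exact Nat.zero_le _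
    · rcases t with _ | t
      · exact Nat.zero_le _
      · exact (IsStep.bounds hA hv u).2.2 t (by omega) (lt_of_le_of_lt hlast h)

/-- If requirements of higher priority do not act any more, then requirement `n` acts only finitely
often, and in the end it cannot act any more. -/
theorem IsStep.exists_run (hA : ∀ s, IsStep Act s A (A s)) (ρ : P → ℕ)
    (hv : ∀ s q κ n φ φ' l, Act s q κ n φ φ' l → ValidPlan κ s l)
    (hρ : ∀ s q κ n φ φ' l, Act s q κ n φ φ' l → ρ φ' < ρ φ) {n T : ℕ}
    (hn : ∀ u ≥ T, n ≤ (A u).r) :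
    (∀ᶠ u in atTop, (A u).r ≠ n) ∧
    ∃ κ t φ, Run Act (fun u => (A u).q) κ n t φ ∧ (∀ u ≥ t, t ≤ (A u).q) ∧
      ∃ᶠ s in atTop, ∀ φ' l, ¬ Act s (fun u => (A u).q) κ n φ φ' l := by
  classical
  have hρ' : ∀ s q κ n φ l, ¬ Act s q κ n φ φ l := fun s q κ n φ l h =>
    lt_irrefl _ (hρ _ _ _ _ _ _ _ h)
  -- `T` is the first stage after the last injury
  obtain ⟨T, hn, hmin⟩ : ∃ T, (∀ u ≥ T, n ≤ (A u).r) ∧ ∀ T' < T, ¬ ∀ u ≥ T', n ≤ (A u).r :=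
    have hex : ∃ T, ∀ u ≥ T, n ≤ (A u).r := ⟨T, hn⟩
    ⟨Nat.find hex, Nat.find_spec hex, fun _ h => Nat.find_min hex h⟩
  have hT : T = 0 ∨ (before A T).r < n := by
    rcases T with _ | T
    · exact Or.inl rfl
    · refine Or.inr (lt_of_not_ge fun h => hmin T (Nat.lt_succ_self T) fun u hu => ?_)
      rcases hu.lt_or_eq with hu | rfl
      · exact hn u hu
      · exact h
  have hlev : ∀ s ≥ T, level (fun u => (A u).r) n s = level (fun u => (A u).r) n T := fun s hs =>
    level_eq hs fun u hu _ => hn u hu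
  have hplan : (before A T).plan = [] := by
    rcases hT with rfl | hT
    · rfl
    · rcases hA T with ⟨-, h₂, -⟩ | ⟨h, -⟩ | ⟨h, -⟩
      · have := hn T le_rfl
        omega
      · exact h
      · exact h
  have hphase : (before A T).phase n = default := by
    rcases hT with rfl | hT
    · rfl
    · rcases T with _ | T
      · rfl
      · rcases hA T with ⟨-, -, h⟩ | ⟨-, -, h⟩ | ⟨-, -, -, -, -, h⟩ <;> exact (h n).1 hT
  set κ := level (fun u => (A u).r) n T with hκ
  suffices H : ∀ k t, T ≤ t → ρ ((before A t).phase n) = k →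
      Run Act (fun u => (A u).q) κ n t ((before A t).phase n) → (before A t).plan = [] →
      (t = 0 ∨ (before A t).r ≤ n) → (∀ᶠ u in atTop, (A u).r ≠ n) ∧
      ∃ t φ, Run Act (fun u => (A u).q) κ n t φ ∧ (∀ u ≥ t, t ≤ (A u).q) ∧
        ∃ᶠ s in atTop, ∀ φ' l, ¬ Act s (fun u => (A u).q) κ n φ φ' l by
    obtain ⟨h₁, t, φ, h₂⟩ := H _ T le_rfl rfl (by rw [hphase]; exact Run.start T) hplan
      (hT.imp_right le_of_lt)
    exact ⟨h₁, κ, t, φ, h₂⟩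
  intro k
  induction k using Nat.strong_induction_on with
  | _ k ih =>
    intro t htT hk hrun hplan hlast
    have hnt : ∀ u ≥ t, n ≤ (A u).r := fun u hu => hn u (htT.trans hu)
    by_cases hex : ∃ s ≥ t, (A s).phase n ≠ (before A t).phase n
    · -- the next action of requirement `n` is at the first stage at which its phase changes
      obtain ⟨s, ⟨hts, hs⟩, hsmin⟩ : ∃ s, (t ≤ s ∧ (A s).phase n ≠ (before A t).phase n) ∧
          ∀ u < s, ¬ (t ≤ u ∧ (A u).phase n ≠ (before A t).phase n) :=
        ⟨Nat.find hex, Nat.find_spec hex, fun _ h => Nat.find_min hex h⟩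
      have hφ : ∀ u, t ≤ u → u ≤ s → (before A u).phase n = (before A t).phase n := by
        intro u htu hus
        rcases htu.eq_or_lt with rfl | htu
        · rfl
        · rcases u with _ | u
          · omega
          · exact not_not.1 (not_and.1 (hsmin u (by omega)) (by omega))
      have hquiet := fun u h₁ h₂ => (IsStep.quiet hA hv hρ' hnt hplan hlast hφ (u := u) h₁ h₂).1
      have hr := hnt s hts
      rcases hA s with ⟨-, -, h⟩ | ⟨-, h₂, h₃⟩ | ⟨-, -, -, -, -, h⟩
      · exact absurd (((h n).2 hr).trans (hφ s hts le_rfl)) hs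
      · rcases hr.lt_or_eq with hr | hr
        · exact absurd (((h₃ n).2 hr).1.trans (hφ s hts le_rfl)) hs
        · rw [← hr, hlev s (htT.trans hts), hφ s hts le_rfl] at h₂
          obtain ⟨f₁, f₂, f₃, f₄⟩ := IsStep.follows hA (s := s + 1) (l := (A s).plan) rfl
          have f₅ := f₄ n hr.le
          have hrun' := Run.act hrun hts hquiet h₂ ⟨rfl, f₁⟩
          rw [List.length_cons, show s + ((A s).plan.length + 1) = s + 1 + (A s).plan.length
            by omega] at hrun'
          have hdec := hρ _ _ _ _ _ _ _ h₂
          rw [hk] at hdec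
          refine ih _ hdec (s + 1 + (A s).plan.length) (by omega) (congrArg ρ f₅) ?_ f₂
            (Or.inr (f₃.trans hr.symm).le)
          rw [f₅]
          exact hrun'
      · exact absurd (((h n).2 hr).trans (hφ s hts le_rfl)) hs
    · push Not at hex
      have hφ : ∀ u, t ≤ u → (before A u).phase n = (before A t).phase n := by
        intro u htu
        rcases htu.eq_or_lt with rfl | htu
        · rfl
        · rcases u with _ | u
          · omega
          · exact hex u (by omega)
      have hquiet := fun u (hu : t ≤ u) => IsStep.quiet hA hv hρ' (s := u + 1) hnt hplan hlast
        (fun u h₁ _ => hφ u h₁) hu (Nat.lt_succ_self u)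
      refine ⟨?_, t, _, hrun, fun u hu => (hquiet u hu).1, ?_⟩
      · filter_upwards [eventually_ge_atTop t, eventually_gt_atTop n] with u h₁ h₂ h₃
        exact h₂.ne' ((hquiet u h₁).2 h₃)
      · refine (IsStep.frequently hA).mp ((eventually_ge_atTop t).mono ?_)
        intro s hs hplan' φ' l hact
        rw [← hφ s hs, ← hlev s (htT.trans hs)] at hact
        rcases hA s with ⟨h, -⟩ | ⟨-, h₂, h₃⟩ | ⟨-, h, -⟩
        · simp [hplan'] at h
        · rcases (hnt s hs).lt_or_eq with hr | hr
          · exact ((h₃ n).2 hr).2 _ _ hact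
          · rw [← hr, hφ s hs, hex s hs] at h₂
            exact hρ' _ _ _ _ _ _ h₂
        · exact h n _ _ hact

theorem IsStep.eventually_ne (hA : ∀ s, IsStep Act s A (A s)) (ρ : P → ℕ)
    (hv : ∀ s q κ n φ φ' l, Act s q κ n φ φ' l → ValidPlan κ s l)
    (hρ : ∀ s q κ n φ φ' l, Act s q κ n φ φ' l → ρ φ' < ρ φ) (n : ℕ) :
    (∀ᶠ u in atTop, (A u).r ≠ n) ∧ ∃ T, ∀ u ≥ T, n ≤ (A u).r := by
  induction n using Nat.strong_induction_on with
  | _ n ih =>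
    have hT : ∃ T, ∀ u ≥ T, n ≤ (A u).r := by
      refine eventually_atTop.1 ?_
      filter_upwards [(Finset.eventually_all (Finset.range n)).2 fun m hm =>
        (ih m (Finset.mem_range.1 hm)).1] with u hu
      by_contra h
      exact hu _ (Finset.mem_range.2 (not_le.1 h)) rfl
    exact ⟨(IsStep.exists_run hA ρ hv hρ hT.choose_spec).1, hT⟩

end

/-! ### Restoring the relation after an insertion -/

/-- Where the insertions in the list `l` move the element at position `x`. -/
def runPlan (l : List ℕ) (x : ℕ) : ℕ := l.foldl (fun x p => if p ≤ x then x + 1 else x) x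

theorem runPlan_cons (p : ℕ) (l : List ℕ) (x : ℕ) :
    runPlan (p :: l) x = runPlan l (if p ≤ x then x + 1 else x) := rfl

theorem runPlan_append (l l' : List ℕ) (x : ℕ) :
    runPlan (l ++ l') x = runPlan l' (runPlan l x) := List.foldl_append

theorem runPlan_strictMono (l : List ℕ) : StrictMono (runPlan l) := by
  induction l with
  | nil => exact strictMono_id
  | cons p l ih =>
    intro x y h
    rw [runPlan_cons, runPlan_cons]
    refine ih ?_
    split_ifs <;> omega

theorem runPlan_replicate_of_lt {p x : ℕ} (d : ℕ) (h : x < p) :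
    runPlan (List.replicate d p) x = x := by
  induction d with
  | zero => rfl
  | succ d ih => rw [List.replicate_succ, runPlan_cons, if_neg h.not_ge, ih]

theorem runPlan_replicate_of_le {p x : ℕ} (d : ℕ) (h : p ≤ x) :
    runPlan (List.replicate d p) x = x + d := by
  induction d generalizing x with
  | zero => rfl
  | succ d ih =>
    rw [List.replicate_succ, runPlan_cons, if_pos h, ih (by omega)]
    omega

theorem ValidPlan.mono {κ κ' s : ℕ} {l : List ℕ} (h : ValidPlan κ s l) (hκ : κ' ≤ κ) :
    ValidPlan κ' s l := by
  induction l generalizing s with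
  | nil => trivial
  | cons p l ih => exact ⟨hκ.trans h.1, h.2.1, ih h.2.2⟩

theorem ValidPlan.replicate_append {κ s p d : ℕ} {l : List ℕ} (hκ : κ ≤ p) (hp : p ≤ s)
    (h : ValidPlan κ (s + d) l) : ValidPlan κ s (List.replicate d p ++ l) := by
  induction d generalizing s with
  | zero => exact h
  | succ d ih =>
    rw [List.replicate_succ, List.cons_append]
    refine ⟨hκ, hp, ih (by omega) ?_⟩
    rwa [show s + 1 + d = s + (d + 1) by omega]

theorem pos_add_length {q : ℕ → ℕ} {s x : ℕ} {l : List ℕ} (hx : x < s) (h : Follows q s l) :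
    pos q (s + l.length) x = runPlan l (pos q s x) := by
  induction l generalizing s with
  | nil => rfl
  | cons p l ih =>
    have h' := ih (hx.trans (Nat.lt_succ_self s)) h.2
    rw [List.length_cons, show s + (l.length + 1) = s + 1 + l.length by omega, h', runPlan_cons,
      pos, if_neg hx.ne, h.1]

/-- If the blocks from `κ` on have been shifted by `δ`, then further insertions make each of the
next `m` of them coincide with a block of the same length. -/
theorem exists_plan (m κ δ N : ℕ) (hN : blockStart (κ + m) + δ ≤ N) :
    ∃ l, l ≠ [] ∧ ValidPlan (blockStart κ + δ) N l ∧ (∀ x < blockStart κ + δ, runPlan l x = x) ∧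
      ∀ i < m, ∃ j, blockLen j = blockLen (κ + i) ∧ ∀ o < blockLen (κ + i),
        runPlan l (blockStart (κ + i) + δ + o) = blockStart j + o := by
  induction m generalizing κ δ N with
  | zero =>
    refine ⟨[N], by simp, ⟨hN, le_rfl, trivial⟩, fun x hx => if_neg ?_, fun i hi => by omega⟩
    rw [Nat.add_zero] at hN
    omega
  | succ m ih =>
    obtain ⟨j, hj, hlen⟩ := exists_blockLen_eq κ (blockStart κ + δ)
    obtain ⟨d, hd⟩ := Nat.exists_eq_add_of_le hj
    have hmono := blockStart_strictMono.monotone (show κ ≤ κ + (m + 1) by omega)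
    have hsucc := blockStart_succ κ
    obtain ⟨l, hne, hv, hfix, hl⟩ := ih (κ + 1) (δ + d) (N + d)
      (by rw [show κ + 1 + m = κ + (m + 1) by omega]; omega)
    refine ⟨List.replicate d (blockStart κ + δ) ++ l, by simp [hne],
      ValidPlan.replicate_append le_rfl (by omega) (hv.mono (by omega)), fun x hx => ?_,
      fun i hi => ?_⟩
    · rw [runPlan_append, runPlan_replicate_of_lt d hx, hfix x (by omega)]
    · rcases i with _ | i
      · refine ⟨j, hlen, fun o ho => ?_⟩
        rw [Nat.add_zero] at ho ⊢
        rw [runPlan_append, runPlan_replicate_of_le d (by omega), hfix _ (by omega)]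
        omega
      · obtain ⟨j, h₁, h₂⟩ := hl i (by omega)
        rw [show κ + 1 + i = κ + (i + 1) by omega] at h₁ h₂
        refine ⟨j, h₁, fun o ho => ?_⟩
        have := blockStart_strictMono.monotone (show κ ≤ κ + (i + 1) by omega)
        rw [runPlan_append, runPlan_replicate_of_le d (by omega), ← h₂ o ho]
        congr 1
        omega

/-- After an insertion at the beginning of block `κ`, further insertions restore the relation on
the elements that were in the first `k` blocks. -/
theorem exists_restoring_plan {κ k N : ℕ} (hκ : κ ≤ k) (hN : blockStart k < N) :
    ∃ l, l ≠ [] ∧ ValidPlan (blockStart κ) N l ∧ ∀ u < blockStart k, ∀ v < blockStart k,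
      (cyc (runPlan (blockStart κ :: l) u) (runPlan (blockStart κ :: l) v) ↔ cyc u v) := by
  obtain ⟨m, rfl⟩ := Nat.exists_eq_add_of_le hκ
  obtain ⟨l, hne, hv, hfix, hl⟩ := exists_plan m κ 1 N hN
  refine ⟨l, hne, hv.mono (by omega), ?_⟩
  have hblock : ∀ i, ∃ j, i < κ + m → blockLen j = blockLen i ∧ ∀ o < blockLen i,
      runPlan (blockStart κ :: l) (blockStart i + o) = blockStart j + o := by
    intro i
    rcases lt_or_ge i κ with hi | hi
    · refine ⟨i, fun _ => ⟨rfl, fun o ho => ?_⟩⟩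
      have h₁ := blockStart_strictMono.monotone (Nat.succ_le_of_lt hi)
      have h₂ := blockStart_succ i
      rw [Nat.succ_eq_add_one] at h₁
      rw [runPlan_cons, if_neg (by omega), hfix _ (by omega)]
    · by_cases him : i < κ + m
      · obtain ⟨i, rfl⟩ := Nat.exists_eq_add_of_le hi
        obtain ⟨j, h₁, h₂⟩ := hl i (by omega)
        refine ⟨j, fun _ => ⟨h₁, fun o ho => ?_⟩⟩
        have := blockStart_strictMono.monotone hi
        rw [runPlan_cons, if_pos (by omega), ← h₂ o ho]
        congr 1
        omega
      · exact ⟨0, fun h => absurd h him⟩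
  choose J hJ using hblock
  have hinj : ∀ i < κ + m, ∀ i' < κ + m, J i = J i' → i = i' := by
    intro i hi i' hi' h
    have h₁ := (hJ i hi).2 0 (by have := two_le_blockLen i; omega)
    have h₂ := (hJ i' hi').2 0 (by have := two_le_blockLen i'; omega)
    rw [h, ← h₂] at h₁
    exact blockStart_strictMono.injective ((runPlan_strictMono _).injective h₁)
  have hoff : ∀ u < blockStart (κ + m), ∃ i < κ + m, ∃ o < blockLen i, u = blockStart i + o := by
    intro u hu
    obtain ⟨i, h₁, h₂⟩ := exists_block u
    rw [blockStart_succ] at h₂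
    exact ⟨i, blockStart_strictMono.lt_iff_lt.1 (h₁.trans_lt hu), u - blockStart i, by omega,
      by omega⟩
  intro u hu v hv
  obtain ⟨i, hi, o, ho, rfl⟩ := hoff u hu
  obtain ⟨i', hi', o', ho', rfl⟩ := hoff v hv
  obtain ⟨h₁, h₂⟩ := hJ i hi
  obtain ⟨h₁', h₂'⟩ := hJ i' hi'
  rw [h₂ o ho, h₂' o' ho', cyc_add_iff (by rw [h₁]; exact ho) (by rw [h₁']; exact ho'),
    cyc_add_iff ho ho', h₁]
  exact and_congr_left fun _ => ⟨hinj i hi i' hi', congrArg J⟩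

/-! ### A copy whose degree is not c.e. -/

/-- The phases of a requirement: it waits until it can break the relation; at stage `t` it has
broken it on the first `k` blocks, such that the computation of the c.e. set has to change below
`b`; it has restored the relation after such a change. -/
inductive Phase : Type
  | waiting : Phase
  | broken (t k b : ℕ) : Phase
  | restored : Phase

instance : Inhabited Phase := ⟨Phase.waiting⟩

/-- The number of actions that a requirement may still make. -/
def Phase.rank : Phase → ℕ
  | waiting => 2
  | broken _ _ _ => 1
  | restored => 0

open Classical in
/-- The number `n` codes a set `W` that is c.e. in `D`, and two functionals. The condition says that
the bits of `D` below `s` guarantee, first, that the `n.unpair.2.unpair.1`-th functional computes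
from `W`, with use `b`, that the relation holds between the last and the first element of the
block `κ`; and second, that the `n.unpair.2.unpair.2`-th functional computes `W` below `b` from the
relation on the elements that are in the first `k` blocks. Here `W` and the positions of
elements are taken as they are at stage `s`. -/
def Vulnerable (D : Set ℕ) (s : ℕ) (q : ℕ → ℕ) (κ n k b : ℕ) : Prop :=
  κ < k ∧ blockStart k ≤ s ∧ ∀ D', Agree s D D' →
    (∀ Y, Agree b (Wt n.unpair.1 D s) Y → ∀ x < s, ∀ y < s, pos q s x = blockStart (κ + 1) - 1 →
      pos q s y = blockStart κ → 1 ∈ Phi n.unpair.2.unpair.1 (join Y D') (Nat.pair x y)) ∧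
    ∀ Y : Set ℕ, (∀ x < s, ∀ y < s, pos q s x < blockStart k → pos q s y < blockStart k →
        (Nat.pair x y ∈ Y ↔ cyc (pos q s x) (pos q s y))) →
      ∀ z < b, (if z ∈ Wt n.unpair.1 D s then 1 else 0) ∈ Phi n.unpair.2.unpair.2 (join Y D') z

/-- The possible actions in the construction of a copy whose degree is not c.e. -/
def DiagAct (D : Set ℕ) (s : ℕ) (q : ℕ → ℕ) (κ n : ℕ) : Phase → Phase → List ℕ → Prop
  | .waiting, .broken t k b, l => t = s ∧ l = [blockStart κ] ∧ Vulnerable D s q κ n k b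
  | .broken t k b, .restored, l => t < s ∧
      (∃ x < b, x ∈ Wt n.unpair.1 D s ∧ x ∉ Wt n.unpair.1 D t) ∧ l ≠ [] ∧
      ValidPlan (blockStart κ) s l ∧ ∀ u < blockStart k, ∀ v < blockStart k,
        (cyc (runPlan (blockStart κ :: l) u) (runPlan (blockStart κ :: l) v) ↔ cyc u v)
  | _, _, _ => False

theorem not_diagAct_nil (D : Set ℕ) (s : ℕ) (q : ℕ → ℕ) (κ n : ℕ) (φ φ' : Phase) :
    ¬ DiagAct D s q κ n φ φ' [] := by
  cases φ <;> cases φ' <;> simp [DiagAct]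

theorem DiagAct.validPlan {D : Set ℕ} {s : ℕ} {q : ℕ → ℕ} {κ n : ℕ} {φ φ' : Phase} {l : List ℕ}
    (h : DiagAct D s q κ n φ φ' l) : ValidPlan κ s l := by
  cases φ <;> cases φ' <;> try exact h.elim
  · obtain ⟨rfl, rfl, h⟩ := h
    exact ⟨le_blockStart κ, (blockStart_strictMono.monotone h.1.le).trans h.2.1, trivial⟩
  · exact h.2.2.2.1.mono (le_blockStart κ)

theorem DiagAct.rank_lt {D : Set ℕ} {s : ℕ} {q : ℕ → ℕ} {κ n : ℕ} {φ φ' : Phase} {l : List ℕ}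
    (h : DiagAct D s q κ n φ φ' l) : φ'.rank < φ.rank := by
  cases φ <;> cases φ' <;> first | exact h.elim | exact Nat.lt_succ_self _

theorem diagAct_congr {D D' : Set ℕ} {s : ℕ} {q q' : ℕ → ℕ} (hD : Agree s D D')
    (hq : ∀ t < s, q t = q' t) : DiagAct D s q = DiagAct D' s q' := by
  have hpos : pos q s = pos q' s := funext (pos_congr hq)
  have hW : ∀ e, ∀ t ≤ s, Wt e D t = Wt e D' t := fun e t ht => Wt_congr (hD.mono ht)
  have hag : Agree s D = Agree s D' := funext fun E => propext ⟨hD.symm.trans, hD.trans⟩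
  funext κ n φ φ' l
  cases φ <;> cases φ' <;> try rfl
  · unfold DiagAct Vulnerable
    rw [hpos, hag, hW _ s le_rfl]
  · refine propext (and_congr_right fun ht => ?_)
    rw [hW _ s le_rfl, hW _ _ ht.le]

theorem pos_eq_of_quiet {q : ℕ → ℕ} (hq : ∀ s, q s ≤ s) {s t x : ℕ} (hx : x < t) (hts : t ≤ s)
    (h : ∀ u, t ≤ u → u < s → t ≤ q u) : pos q s x = pos q t x :=
  pos_eq_of_forall_lt hx hts fun u h₁ h₂ => (pos_lt hq hx).trans_le (h u h₁ h₂)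

theorem Run.broken {D : Set ℕ} {q : ℕ → ℕ} {κ n t t₁ k b : ℕ}
    (h : Run (DiagAct D) q κ n t (.broken t₁ k b)) :
    t = t₁ + 1 ∧ Vulnerable D t₁ q κ n k b ∧ Follows q t₁ [blockStart κ] := by
  generalize hφ : Phase.broken t₁ k b = φ at h
  cases h with
  | start => cases hφ
  | @act t s φ φ' l hrun hts hquiet hact hf =>
    subst hφ
    cases φ with
    | waiting =>
      obtain ⟨rfl, rfl, h⟩ := hact
      exact ⟨rfl, h, hf⟩
    | broken => exact hact.elim
    | restored => exact hact.elim

theorem Run.restored {D : Set ℕ} {q : ℕ → ℕ} {κ n t : ℕ}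
    (h : Run (DiagAct D) q κ n t .restored) :
    ∃ t₁ k b s l, t = s + l.length ∧ Run (DiagAct D) q κ n (t₁ + 1) (.broken t₁ k b) ∧ t₁ + 1 ≤ s ∧
      (∀ u, t₁ + 1 ≤ u → u < s → t₁ + 1 ≤ q u) ∧
      DiagAct D s q κ n (.broken t₁ k b) .restored l ∧ Follows q s l := by
  generalize hφ : Phase.restored = φ at h
  cases h with
  | start => cases hφ
  | @act t s φ φ' l hrun hts hquiet hact hf =>
    subst hφ
    cases φ with
    | waiting => exact hact.elim
    | broken t₁ k b =>
      obtain ⟨rfl, -⟩ := hrun.broken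
      exact ⟨t₁, k, b, s, l, rfl, hrun, hts, hquiet, hact, hf⟩
    | restored => exact hact.elim

section

variable {D : Set ℕ} {q : ℕ → ℕ} {n κ : ℕ} {i : ((· < ·) : ℕ → ℕ → Prop) ≃r insOrder q}

/-- If the relation and the c.e. set compute each other, then a requirement does not have to wait
forever before it can break the relation. -/
theorem eventually_vulnerable (hi : ∀ x, ∀ᶠ s in atTop, pos q s x = i.symm x)
    (hj : Phi n.unpair.2.unpair.1 (join (Phi n.unpair.1 D).Dom D) =
      chi (pairSet (transfer i cyc)))
    (hl : Phi n.unpair.2.unpair.2 (join (pairSet (transfer i cyc)) D) =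
      chi (Phi n.unpair.1 D).Dom) :
    ∃ k b, ∀ᶠ s in atTop, Vulnerable D s q κ n k b := by
  classical
  set W := (Phi n.unpair.1 D).Dom with hWdef
  set R := pairSet (transfer i cyc) with hR
  set x₀ := i (blockStart (κ + 1) - 1) with hx₀
  set y₀ := i (blockStart κ) with hy₀
  have h₁ : 1 ∈ Phi n.unpair.2.unpair.1 (join W D) (Nat.pair x₀ y₀) := by
    rw [hj]
    have : Nat.pair x₀ y₀ ∈ R := by simp [hR, pairSet, transfer, x₀, y₀, cyc_last_first]
    simp [chi, this]
  obtain ⟨b, hb⟩ := Phi_exists_use h₁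
  have h₂ : ∀ z, (if z ∈ W then 1 else 0) ∈ Phi n.unpair.2.unpair.2 (join R D) z := by
    intro z
    rw [hl]
    exact Part.mem_some _
  choose use huse using fun z => Phi_exists_use (h₂ z)
  obtain ⟨c, hc⟩ : ∃ c, ∀ z < b, use z ≤ c :=
    ⟨(Finset.range b).sup use, fun z hz => Finset.le_sup (Finset.mem_range.2 hz)⟩
  obtain ⟨k, hκk, hk⟩ : ∃ k, κ < k ∧ ∀ x < c, i.symm x < blockStart k := by
    have := (Finset.eventually_all (Finset.range c)).2 fun x _ =>
      eventually_gt_atTop (i.symm x)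
    obtain ⟨k, hk, hκ⟩ := (this.and (eventually_gt_atTop κ)).exists
    exact ⟨k, hκ, fun x hx => (hk x (Finset.mem_range.2 hx)).trans_le (le_blockStart k)⟩
  have hWs : ∀ᶠ s in atTop, ∀ z ∈ Finset.range b, (z ∈ Wt n.unpair.1 D s ↔ z ∈ W) := by
    refine (Finset.eventually_all _).2 fun z _ => ?_
    by_cases hz : z ∈ W
    · exact (eventually_mem_Wt hz).mono fun s hs => iff_of_true hs hz
    · exact Eventually.of_forall fun s => iff_of_false (fun h => hz (Wt_subset h)) hz
  have hpos : ∀ᶠ s in atTop, ∀ x ∈ Finset.range c, pos q s x = i.symm x :=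
    (Finset.eventually_all _).2 fun x _ => hi x
  refine ⟨k, b, ?_⟩
  filter_upwards [hWs, hpos, hi x₀, hi y₀, eventually_gt_atTop x₀, eventually_gt_atTop y₀,
    eventually_ge_atTop (blockStart k), eventually_ge_atTop b, eventually_ge_atTop c]
    with s hWs hpos hx hy hxs hys hks hbs hcs
  rw [hx₀, i.symm_apply_apply, ← hx₀] at hx
  rw [hy₀, i.symm_apply_apply, ← hy₀] at hy
  refine ⟨hκk, hks, fun D' hD' => ⟨fun Y hY x hxs' y hys' hx' hy' => ?_, fun Y hY z hz => ?_⟩⟩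
  · obtain rfl := pos_injOn hxs' hxs (hx'.trans hx.symm)
    obtain rfl := pos_injOn hys' hys (hy'.trans hy.symm)
    refine hb _ (Agree.join (fun z hz => ?_) (hD'.mono hbs))
    rw [← hWs z (Finset.mem_range.2 hz)]
    exact hY z hz
  · rw [if_congr (hWs z (Finset.mem_range.2 hz)) rfl rfl]
    refine huse z _ (Agree.join (fun w hw => ?_) (hD'.mono ((hc z hz).trans hcs)))
    have hw₁ := ((Nat.unpair_left_le w).trans_lt hw).trans_le (hc z hz)
    have hw₂ := ((Nat.unpair_right_le w).trans_lt hw).trans_le (hc z hz)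
    have e₁ := hpos _ (Finset.mem_range.2 hw₁)
    have e₂ := hpos _ (Finset.mem_range.2 hw₂)
    have := hY _ (hw₁.trans_le hcs) _ (hw₂.trans_le hcs) (by rw [e₁]; exact hk _ hw₁)
      (by rw [e₂]; exact hk _ hw₂)
    rw [Nat.pair_unpair, e₁, e₂] at this
    exact this.symm

/-- After the relation has been broken, the c.e. set changes below the use of the computation. -/
theorem exists_mem_of_broken (hi : ∀ x, ∀ᶠ s in atTop, pos q s x = i.symm x)
    (hq : ∀ s, q s ≤ s)
    (hj : Phi n.unpair.2.unpair.1 (join (Phi n.unpair.1 D).Dom D) =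
      chi (pairSet (transfer i cyc))) {t k b : ℕ}
    (hrun : Run (DiagAct D) q κ n (t + 1) (.broken t k b))
    (hquiet : ∀ u ≥ t + 1, t + 1 ≤ q u) :
    ∃ x < b, x ∈ (Phi n.unpair.1 D).Dom ∧ x ∉ Wt n.unpair.1 D t := by
  by_contra! hno
  obtain ⟨-, ⟨hκ, hk, hv⟩, hf⟩ := hrun.broken
  have hlim : ∀ x < t, i.symm x = runPlan [blockStart κ] (pos q t x) := by
    intro x hx
    obtain ⟨s, h₁, h₂⟩ := ((hi x).and (eventually_ge_atTop (t + 1))).exists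
    rw [← h₁, pos_eq_of_quiet hq (hx.trans (Nat.lt_succ_self t)) h₂ fun u hu _ => hquiet u hu]
    exact pos_add_length hx hf
  have hlen := two_le_blockLen κ
  have hsucc := blockStart_succ κ
  have hle := (blockStart_strictMono.monotone (Nat.succ_le_of_lt hκ)).trans hk
  rw [Nat.succ_eq_add_one] at hle
  obtain ⟨x, hx, hpx⟩ := exists_pos_eq hq (s := t) (p := blockStart (κ + 1) - 1) (by omega)
  obtain ⟨y, hy, hpy⟩ := exists_pos_eq hq (s := t) (p := blockStart κ) (by omega)
  have h := (hv D (Agree.refl t D)).1 (Phi n.unpair.1 D).Dom (fun z hz =>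
    ⟨fun h => Wt_subset h, hno z hz⟩) x hx y hy hpx hpy
  rw [hj] at h
  have hcyc : cyc (i.symm x) (i.symm y) := by
    by_contra hn
    have : Nat.pair x y ∉ pairSet (transfer i cyc) := by simpa [pairSet, transfer] using hn
    simp [chi, this] at h
  -- the last element is now the first one of the next block
  have ex : i.symm x = blockStart (κ + 1) := by
    rw [hlim x hx, hpx, runPlan_cons, if_pos (by omega)]
    change _ + 1 = _
    omega
  have ey : i.symm y = blockStart κ + 1 := by
    rw [hlim y hy, hpy, runPlan_cons, if_pos le_rfl]
    rfl
  rw [ex, ey, cyc_iff le_rfl (blockStart_lt_succ (κ + 1))] at hcyc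
  omega

/-- After the relation has been restored, it yields the old values of the c.e. set. -/
theorem not_run_restored (hi : ∀ x, ∀ᶠ s in atTop, pos q s x = i.symm x)
    (hq : ∀ s, q s ≤ s)
    (hl : Phi n.unpair.2.unpair.2 (join (pairSet (transfer i cyc)) D) =
      chi (Phi n.unpair.1 D).Dom) {t : ℕ}
    (hrun : Run (DiagAct D) q κ n t .restored) (hquiet : ∀ u ≥ t, t ≤ q u) : False := by
  obtain ⟨t₁, k, b, s, l, rfl, hrun, hts, hquiet', ⟨-, ⟨x, hxb, hxs, hxt⟩, -, -, hcyc⟩, hf⟩ :=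
    hrun.restored
  obtain ⟨-, ⟨hκ, hk, hv⟩, hf₁⟩ := hrun.broken
  have hlim : ∀ x < t₁, i.symm x = runPlan (blockStart κ :: l) (pos q t₁ x) := by
    intro x hx
    obtain ⟨s', h₁, h₂⟩ := ((hi x).and (eventually_ge_atTop (s + l.length))).exists
    rw [← h₁, pos_eq_of_quiet hq (by omega) h₂ fun u hu _ => hquiet u hu,
      pos_add_length (by omega) hf, pos_eq_of_quiet hq (by omega) hts hquiet']
    exact congrArg (runPlan l) (pos_add_length hx hf₁)
  have h := (hv D (Agree.refl t₁ D)).2 (pairSet (transfer i cyc)) (fun x hx y hy hx' hy' => by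
    rw [← hcyc _ hx' _ hy', ← hlim x hx, ← hlim y hy]
    simp [pairSet, transfer]) x hxb
  rw [hl, if_neg hxt] at h
  have : x ∈ (Phi n.unpair.1 D).Dom := Wt_subset hxs
  simp [chi, this] at h

end

theorem onCone_not_dgSp_subset : OnCone fun D => ¬ dgSp (· < ·) cyc D ⊆ ceDegrees D := by
  have hagree : ∀ s D D', Agree s D D' →
      (priority (DiagAct D) s).q = (priority (DiagAct D') s).q := fun s D D' h => by
    rw [priority_congr fun t ht => funext fun q => diagAct_congr (h.mono ht) fun _ _ => rfl]
  refine (onCone_insOrder (fun _ D s => (priority (DiagAct D) s).q)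
    fun _ s D D' h => hagree s D D' h).mono fun D hD hsub => ?_
  set A := priority (DiagAct D) with hAdef
  have hA : ∀ s, IsStep (DiagAct D) s A (A s) :=
    isStep_priority (not_diagAct_nil D) fun s q q' h => diagAct_congr (Agree.refl s D) h
  have hv : ∀ s q κ n φ φ' l, DiagAct D s q κ n φ φ' l → ValidPlan κ s l :=
    fun _ _ _ _ _ _ _ h => h.validPlan
  have hρ : ∀ s q κ n φ φ' l, DiagAct D s q κ n φ φ' l → φ'.rank < φ.rank :=
    fun _ _ _ _ _ _ _ h => h.rank_lt
  have hbounds := IsStep.bounds hA hv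
  have hfin := IsStep.eventually_ne hA Phase.rank hv hρ
  set q : ℕ → ℕ := fun s => (A s).q with hqdef
  have hq : ∀ s, q s ≤ s := fun s => (hbounds s).1
  have ht : Tendsto q atTop atTop :=
    tendsto_of_tags (fun s => (hbounds s).2.1) fun n => (hfin n).1
  obtain ⟨i, hi⟩ := exists_relIso_insOrder hq ht (eventually_pos_lt_of_tags hq
    (fun s => (hbounds s).2.1) (fun s => (hbounds s).2.2) fun n => (hfin n).1)
  obtain ⟨W, hW, hdeg⟩ := hsub ⟨insOrder q, i, hD 0, rfl⟩
  obtain ⟨e, rfl⟩ := ceIn_iff.1 hW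
  obtain ⟨h₁, h₂⟩ := deg_join_eq_iff.1 hdeg
  obtain ⟨j, hj⟩ := exists_Phi_eq h₁
  obtain ⟨l, hl⟩ := exists_Phi_eq h₂
  obtain ⟨n, hn⟩ : ∃ n, n = Nat.pair e (Nat.pair j l) := ⟨_, rfl⟩
  rw [show e = n.unpair.1 by simp [hn], show j = n.unpair.2.unpair.1 by simp [hn]] at hj
  rw [show e = n.unpair.1 by simp [hn], show l = n.unpair.2.unpair.2 by simp [hn]] at hl
  obtain ⟨T, hT⟩ := (hfin n).2
  obtain ⟨-, κ, t, φ, hrun, hquiet, hfreq⟩ := IsStep.exists_run hA Phase.rank hv hρ hT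
  cases φ with
  | waiting =>
    obtain ⟨k, b, hs⟩ := eventually_vulnerable (κ := κ) hi hj hl
    obtain ⟨s, h₁, h₂⟩ := (hfreq.and_eventually hs).exists
    exact h₁ (.broken s k b) _ ⟨rfl, rfl, h₂⟩
  | broken t₁ k b =>
    obtain ⟨rfl, ⟨hκ, hk, -⟩, -⟩ := hrun.broken
    obtain ⟨x, hxb, hx, hxt⟩ := exists_mem_of_broken hi hq hj hrun hquiet
    obtain ⟨s, h₁, h₂, h₃⟩ :=
      (hfreq.and_eventually ((eventually_mem_Wt hx).and (eventually_gt_atTop t₁))).exists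
    obtain ⟨p, hp⟩ := exists_restoring_plan hκ.le (hk.trans_lt h₃)
    exact h₁ .restored p ⟨h₃, ⟨x, hxb, h₂, hxt⟩, hp⟩
  | restored => exact not_run_restored hi hq hl hrun hquiet

end DegSpec

theorem mainTheorem5 :
    ∃ R : ℕ → ℕ → Prop, ComputablePred (fun p : ℕ × ℕ => R p.1 p.2) ∧
      OnCone (fun D => ceDegrees D ⊂ dgSp (· < ·) R D) ∧
      OnCone (fun D => dgSp (· < ·) R D ⊆ delta02Degrees D) ∧
      OnCone (fun D => ¬ UniformlyDelta02 (· < ·) R D) ∧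
      ((onConeClass ceDegrees < dgSpRel (· < ·) R ∧
          dgSpRel (· < ·) R < onConeClass delta02Degrees) ∨
        (dgSpRel (· < ·) R = onConeClass delta02Degrees ∧
          ¬ OnCone (fun D => UniformlyDelta02 (· < ·) R D))) := by
  -- properties of sets that contradict each other do not both hold on a cone
  have hcone : ∀ {P : Set ℕ → Prop}, OnCone P → ¬ OnCone fun D => ¬ P D := fun h h' => by
    obtain ⟨A, hA⟩ := h.and h'
    exact (hA A .rfl).2 (hA A .rfl).1
  refine ⟨cyc, computablePred_cyc, (onCone_ceDegrees_subset.and onCone_not_dgSp_subset).mono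
    fun D h => ⟨h.1, h.2⟩, onCone_dgSp_subset, onCone_not_uniformlyDelta02, ?_⟩
  by_cases h : dgSpRel (· < ·) cyc = onConeClass delta02Degrees
  · exact Or.inr ⟨h, fun h' => hcone h' onCone_not_uniformlyDelta02⟩
  · refine Or.inl ⟨lt_of_le_not_ge ?_ ?_, lt_of_le_of_ne ?_ h⟩
    · exact onCone_ceDegrees_subset
    · exact fun h' => hcone h' onCone_not_dgSp_subset
    · exact onCone_dgSp_subset
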